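/- Let $(M,g)$ be a closed oriented Riemannian surface, $E$ a smooth vector field on $M$, and $SM$ the unit circle bundle. Let $X$ be the generator of the geodesic flow on $SM$, $V$ the generator of the circle action $\rho_t(x,v)=(x,\cos t\,v+\sin t\,iv)$ on the fibres ($i$ is the rotation by $\pi/2$ given by the orientation), $X_\perp=[X,V]$, $\lambda(x,v)=\langle E(x),iv\rangle$, and $\mathbf G_E=X+\lambda V$ the generator of the Gaussian thermostat $(M,g,E)$. Let $\mathbb K=K-\operatorname{div}_gE$, where $K$ is the Gaussian curvature, and let $(\cdot,\cdot)$ and $\|\cdot\|$ be the inner product and norm of $L^2(SM)$ with respect to the volume form $d\Sigma^3$ of the metric for which $X,X_\perp,V$ are orthonormal. For $\alpha\in[0,1]$ the thermostat is called $\alpha$-controlled if $$\|\mathbf G_Ef\|^2-(\mathbb Kf,f)\ge\alpha\|\mathbf G_Ef\|^2\qquad\text{for all } f\in C^\infty(SM).$$ For $u\in C^\infty(SM,\mathbb C)$ and $k\in\mathbb Z$ let $u_k=\frac1{2\pi}\int_0^{2\pi}(u\circ\rho_t)e^{-ikt}\,dt$, so that $u=\sum_ku_k$ and $Vu_k=iku_k$.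 Put $\eta_\pm=\frac12(X\pm iX_\perp)$ and $\mu_\pm=\eta_\pm+\lambda_{\pm1}V$; thus $\lambda=\lambda_1+\lambda_{-1}$ and $\mathbf G_E=\mu_++\mu_-$. For an integer $m\ge1$ let $T_mu=\sum_{|k|\ge m+1}u_k$ and $Q_mu=T_mV\mathbf G_Eu$. **Proposition.** Suppose that $(M,g,E)$ is $\alpha$-controlled for some $\alpha\in[0,1]$ and that $m\ge1$ is an integer. Then for every $u\in C^\infty(SM,\mathbb C)$ with $u_k=0$ for all $|k|<m$, $$\begin{aligned}\|Q_mu\|^2\ \ge\ &\bigl(1-(m-1)^2+\alpha m^2\bigr)\bigl(\|\mu_-u_m\|^2+\|\mu_+u_{-m}\|^2\bigr)\\&+\bigl(1-m^2+\alpha(m+1)^2\bigr)\bigl(\|\mu_-u_{m+1}\|^2+\|\mu_+u_{-m-1}\|^2\bigr)\\&+\|T_m\mathbf G_Eu\|^2+\alpha\|T_m\mathbf G_EVu\|^2.\end{aligned}$$ -/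

import Mathlib

open scoped Manifold ContDiff Bundle Matrix

noncomputable section

/-- The coordinate plane `ℝ²`. -/
abbrev Plane : Type := EuclideanSpace ℝ (Fin 2)

/-- The `i`-th standard basis vector of `ℝ²`. -/
def stdVec (i : Fin 2) : Plane := EuclideanSpace.single i 1

/-- The partial derivative `∂f/∂xⁱ` of a function on (an open subset of) `ℝ²`. -/
def partialDeriv (i : Fin 2) (f : Plane → ℝ) (y : Plane) : ℝ := fderiv ℝ f y (stdVec i)

/-- A Gaussian thermostat `(M, g, E)` on an oriented Riemannian surface `M`.

A surface is a smooth manifold modelled on `ℝ²` (hence without boundary). The orientation of the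
Riemannian surface `(M, g)` is recorded by the rotation `v ↦ i v` of the tangent planes through the
angle `π/2` which it determines: a smooth field `J` of linear isometries with `J² = -1`. Such fields
correspond bijectively to the orientations of `(M, g)`. -/
structure GaussianThermostat (M : Type*) [TopologicalSpace M] [ChartedSpace Plane M]
    [IsManifold (𝓡 2) ∞ M] where
  /-- the Riemannian metric -/
  g : Bundle.ContMDiffRiemannianMetric (𝓡 2) ∞ Plane (fun x : M => TangentSpace (𝓡 2) x)
  /-- the rotation by `π/2` -/
  J : ∀ x : M, TangentSpace (𝓡 2) x →L[ℝ] TangentSpace (𝓡 2) x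
  J_sq : ∀ (x : M) (v : TangentSpace (𝓡 2) x), J x (J x v) = -v
  J_isometry : ∀ (x : M) (v w : TangentSpace (𝓡 2) x),
    g.inner x (J x v) (J x w) = g.inner x v w
  J_smooth : ContMDiff (𝓡 2).tangent (𝓡 2).tangent ∞
    (fun p : TangentBundle (𝓡 2) M => (⟨p.1, J p.1 p.2⟩ : TangentBundle (𝓡 2) M))
  /-- the external vector field -/
  E : ∀ x : M, TangentSpace (𝓡 2) x
  E_smooth : ContMDiff (𝓡 2) (𝓡 2).tangent ∞
    (fun x : M => (⟨x, E x⟩ : TangentBundle (𝓡 2) M))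

namespace GaussianThermostat

section

variable {M : Type*} [TopologicalSpace M] [ChartedSpace Plane M] [IsManifold (𝓡 2) ∞ M]
variable (T : GaussianThermostat M)

/-! ### Local coordinates. Everything is expressed in the chart of the atlas centred at `c`. -/

/-- The tangent vector with components `w` at the point with coordinates `y`. -/
def ofCoord (c : M) (y w : Plane) : TangentBundle (𝓡 2) M :=
  ⟨(extChartAt (𝓡 2) c).symm y, mfderiv 𝓘(ℝ, Plane) (𝓡 2) (extChartAt (𝓡 2) c).symm y w⟩

/-- The components of a tangent vector in the chart at `c`. -/
def components (c : M) (x : M) (v : TangentSpace (𝓡 2) x) : Plane :=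
  mfderiv (𝓡 2) 𝓘(ℝ, Plane) (extChartAt (𝓡 2) c) x v

/-- The matrix `g_ij` of the metric at the point with coordinates `y`. -/
def gram (c : M) (y : Plane) : Matrix (Fin 2) (Fin 2) ℝ :=
  Matrix.of fun i j => T.g.inner ((extChartAt (𝓡 2) c).symm y)
    (ofCoord c y (stdVec i)).2 (ofCoord c y (stdVec j)).2

/-- The Christoffel symbol `Γᵏ_ij` of the Levi-Civita connection. -/
def christoffel (c : M) (k i j : Fin 2) (y : Plane) : ℝ :=
  (1 / 2) * ∑ l, (T.gram c y)⁻¹ k l *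
    (partialDeriv i (fun z => T.gram c z j l) y + partialDeriv j (fun z => T.gram c z i l) y
      - partialDeriv l (fun z => T.gram c z i j) y)

/-- The acceleration `ẍᵏ = - Γᵏ_ij ẋⁱ ẋʲ` of a geodesic. -/
def geodesicAcceleration (c : M) (y w : Plane) : Plane :=
  WithLp.toLp 2 fun k => -∑ i, ∑ j, T.christoffel c k i j y * w i * w j

/-- The component of `∂_l` in `R(∂₁, ∂₂)∂₂ = ∇_{∂₁} ∇_{∂₂} ∂₂ - ∇_{∂₂} ∇_{∂₁} ∂₂`. -/
def riemann (c : M) (l : Fin 2) (y : Plane) : ℝ :=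
  partialDeriv 0 (T.christoffel c l 1 1) y - partialDeriv 1 (T.christoffel c l 0 1) y
    + ∑ n, (T.christoffel c n 1 1 y * T.christoffel c l 0 n y
      - T.christoffel c n 0 1 y * T.christoffel c l 1 n y)

/-- The Gaussian curvature `K = ⟨R(∂₁, ∂₂)∂₂, ∂₁⟩ / det g`. -/
def gaussCurvature (x : M) : ℝ :=
  (∑ l, T.gram x (extChartAt (𝓡 2) x x) 0 l * T.riemann x l (extChartAt (𝓡 2) x x)) /
    (T.gram x (extChartAt (𝓡 2) x x)).det

/-- The divergence `div_g E = (det g)^(-1/2) ∂_i ((det g)^(1/2) Eⁱ)`. -/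
def divE (x : M) : ℝ :=
  (∑ i, partialDeriv i (fun y => √(T.gram x y).det *
      components x ((extChartAt (𝓡 2) x).symm y) (T.E ((extChartAt (𝓡 2) x).symm y)) i)
    (extChartAt (𝓡 2) x x)) / √(T.gram x (extChartAt (𝓡 2) x x)).det

/-- The thermostat curvature `𝕂 = K - div_g E`. -/
def curvature (x : M) : ℝ := T.gaussCurvature x - T.divE x

/-! ### The unit sphere bundle -/

/-- The unit sphere bundle `SM`. -/
def SM : Type _ := {p : TangentBundle (𝓡 2) M // T.g.inner p.1 p.2 p.2 = 1}

variable {T} in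
/-- The base point of an element of `SM`. -/
def SM.base (p : T.SM) : M := p.1.1

variable {T} in
/-- The unit vector of an element of `SM`. -/
def SM.vec (p : T.SM) : TangentSpace (𝓡 2) p.base := p.1.2

theorem inner_J_self (x : M) (v : TangentSpace (𝓡 2) x) : T.g.inner x v (T.J x v) = 0 := by
  have h := T.J_isometry x v (T.J x v)
  rw [T.J_sq, map_neg, T.g.symm x (T.J x v) v] at h
  linarith

/-- The flow `ρ_t(x, v) = (x, cos t · v + sin t · iv)` of the circle action on the fibres. -/
def rot (t : ℝ) (p : T.SM) : T.SM :=
  ⟨⟨p.base, Real.cos t • p.vec + Real.sin t • T.J p.base p.vec⟩, by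
    have h1 : T.g.inner p.base p.vec p.vec = 1 := p.2
    have h2 := T.inner_J_self p.base p.vec
    have h3 : T.g.inner p.base (T.J p.base p.vec) p.vec = 0 := by rw [T.g.symm, h2]
    have h4 := T.J_isometry p.base p.vec p.vec
    simp only [map_add, map_smul, add_apply, smul_apply,
      smul_eq_mul, h1, h2, h3, h4]
    nlinarith [Real.sin_sq_add_cos_sq t]⟩

/-- The unit vector `v / |v|` in the direction of `v ≠ 0`. -/
def normalize (x : M) (v : TangentSpace (𝓡 2) x) (hv : v ≠ 0) : T.SM :=
  ⟨⟨x, (√(T.g.inner x v v))⁻¹ • v⟩, by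
    have h := T.g.pos x v hv
    simp only [map_smul, smul_apply, smul_eq_mul]
    rw [← mul_assoc, ← mul_inv, Real.mul_self_sqrt h.le, inv_mul_cancel₀ h.ne']⟩

open Classical in
/-- The extension `(x, v) ↦ u(x, v / |v|)` of a function on `SM` to nonzero tangent vectors. -/
def ext (u : T.SM → ℂ) (p : TangentBundle (𝓡 2) M) : ℂ :=
  if h : p.2 ≠ 0 then u (T.normalize p.1 p.2 h) else 0

/-- `u ∈ C^∞(SM, ℂ)`: the extension of `u` which is constant on rays is smooth off the zero
section. -/
def IsSmooth (u : T.SM → ℂ) : Prop :=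
  ContMDiffOn (𝓡 2).tangent 𝓘(ℝ, ℂ) ∞ (T.ext u) {p | p.2 ≠ 0}

/-- The vertical vector field `V`, the generator of the circle action. -/
def V (u : T.SM → ℂ) (p : T.SM) : ℂ := deriv (fun t : ℝ => u (T.rot t p)) 0

/-- The generator `X` of the geodesic flow: the derivative along the geodesic spray
`vᵏ ∂/∂xᵏ - Γᵏ_ij vⁱ vʲ ∂/∂vᵏ`, which is tangent to `SM`. -/
def X (u : T.SM → ℂ) (p : T.SM) : ℂ :=
  fderiv ℝ (fun z : Plane × Plane => T.ext u (ofCoord p.base z.1 z.2))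
    (extChartAt (𝓡 2) p.base p.base, components p.base p.base p.vec)
    (components p.base p.base p.vec,
      T.geodesicAcceleration p.base (extChartAt (𝓡 2) p.base p.base)
        (components p.base p.base p.vec))

/-- The vector field `X_⊥ = [X, V]`. -/
def Xperp (u : T.SM → ℂ) (p : T.SM) : ℂ := T.X (T.V u) p - T.V (T.X u) p

/-- The function `λ(x, v) = ⟨E(x), iv⟩`. -/
def lam (p : T.SM) : ℂ := (T.g.inner p.base (T.E p.base) (T.J p.base p.vec) : ℝ)

/-- The generator `G_E = X + λ V` of the thermostat flow. -/
def G (u : T.SM → ℂ) (p : T.SM) : ℂ := T.X u p + T.lam p * T.V u p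

/-! ### Fourier analysis in the fibres -/

/-- The Fourier component `u_k`. -/
def fourier (k : ℤ) (u : T.SM → ℂ) (p : T.SM) : ℂ :=
  (1 / (2 * Real.pi) : ℂ) *
    ∫ t in (0 : ℝ)..(2 * Real.pi), u (T.rot t p) * Complex.exp (-(Complex.I * k * t))

/-- `u ∈ ⨁_{|k| ≥ m} Ω_k`: a smooth function with `u_k = 0` for `|k| < m`. -/
def IsHighFrequency (m : ℕ) (u : T.SM → ℂ) : Prop :=
  T.IsSmooth u ∧ ∀ k : ℤ, |k| < m → T.fourier k u = 0

/-- The projection `T_m u = ∑_{|k| ≥ m+1} u_k`, that is `u = ∑_k u_k` with the finitely many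
components `u_k`, `|k| ≤ m`, removed. -/
def proj (m : ℕ) (u : T.SM → ℂ) (p : T.SM) : ℂ :=
  u p - ∑ k ∈ Finset.Icc (-(m : ℤ)) m, T.fourier k u p

/-- The operator `Q_m = T_m V G_E`. -/
def Q (m : ℕ) (u : T.SM → ℂ) : T.SM → ℂ := T.proj m (T.V (T.G u))

/-- `η_+ = (X + i X_⊥) / 2`. -/
def etaPlus (u : T.SM → ℂ) (p : T.SM) : ℂ := (T.X u p + Complex.I * T.Xperp u p) / 2

/-- `η_- = (X - i X_⊥) / 2`. -/
def etaMinus (u : T.SM → ℂ) (p : T.SM) : ℂ := (T.X u p - Complex.I * T.Xperp u p) / 2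

/-- `μ_+ = η_+ + λ_1 V`. -/
def muPlus (u : T.SM → ℂ) (p : T.SM) : ℂ := T.etaPlus u p + T.fourier 1 T.lam p * T.V u p

/-- `μ_- = η_- + λ_{-1} V`. -/
def muMinus (u : T.SM → ℂ) (p : T.SM) : ℂ := T.etaMinus u p + T.fourier (-1) T.lam p * T.V u p

/-! ### Integration and the `L²` norm -/

theorem stdVec_ne_zero (i : Fin 2) : stdVec i ≠ 0 := by
  simp [stdVec]

/-- Some unit tangent vector at `x`. -/
def unitAt (x : M) : T.SM :=
  T.normalize x (stdVec 0 : Plane) (stdVec_ne_zero 0)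

/-- The integral over the circle `S_xM` with respect to the angle. -/
def fibreIntegral {F : Type*} [NormedAddCommGroup F] [NormedSpace ℝ F] (f : T.SM → F) (x : M) : F :=
  ∫ t in (0 : ℝ)..(2 * Real.pi), f (T.rot t (T.unitAt x))

section

variable [CompactSpace M] [T2Space M]

/-- A smooth partition of unity subordinate to the atlas. -/
def partitionOfUnity (M : Type*) [TopologicalSpace M] [ChartedSpace Plane M]
    [IsManifold (𝓡 2) ∞ M] [CompactSpace M] [T2Space M] :
    SmoothPartitionOfUnity M (𝓡 2) M Set.univ :=
  (SmoothPartitionOfUnity.exists_isSubordinate_chartAt_source (𝓡 2) M).choose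

/-- The integral over the closed surface `M` with respect to the Riemannian area, which is
`(det g)^(1/2) dx¹ dx²` in coordinates. -/
def areaIntegral {F : Type*} [NormedAddCommGroup F] [NormedSpace ℝ F] (f : M → F) : F :=
  ∑ᶠ c : M, ∫ y in (extChartAt (𝓡 2) c).target,
    (partitionOfUnity M c ((extChartAt (𝓡 2) c).symm y) * √(T.gram c y).det) •
      f ((extChartAt (𝓡 2) c).symm y)

/-- The integral over `SM` with respect to the volume form `dΣ³` of the metric for which
`X, X_⊥, V` is an orthonormal frame, i.e. area of `M` times angle in the fibres. -/
def integral {F : Type*} [NormedAddCommGroup F] [NormedSpace ℝ F] (f : T.SM → F) : F :=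
  T.areaIntegral (T.fibreIntegral f)

/-- The `L²` inner product `(u, v) = ∫_{SM} u v̄ dΣ³`. -/
def l2Inner (u v : T.SM → ℂ) : ℂ := T.integral fun p => u p * (starRingEnd ℂ) (v p)

/-- The `L²` norm `‖u‖`. -/
def l2Norm (u : T.SM → ℂ) : ℝ := √(T.integral fun p => ‖u p‖ ^ 2)

/-- The thermostat is `α`-controlled, `α ∈ [0, 1]`:
`‖G_E u‖² - (𝕂 u, u) ≥ α ‖G_E u‖²` for all `u ∈ C^∞(SM)`. -/
def IsControlled (α : ℝ) : Prop :=
  α ∈ Set.Icc (0 : ℝ) 1 ∧ ∀ u : T.SM → ℂ, T.IsSmooth u →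
    α * T.l2Norm (T.G u) ^ 2 ≤
      T.l2Norm (T.G u) ^ 2 - (T.l2Inner (fun p => (T.curvature p.base : ℂ) * u p) u).re

end

end

end GaussianThermostat

end

/-! The inequality follows from an integral identity on `SM` and Fourier analysis in the fibres.

Write `a = V λ` and `H = [V, G_E] = a V - X_⊥`. The structure equations of the unit circle bundle,
`[V, X_⊥] = X` and `[X, X_⊥] = -K V` (`V_Xperp`, `X_Xperp`), together with `V a = -λ` and
`X a + X_⊥ λ = -div E` (`V_V_lam`, `X_V_lam_add_Xperp_lam`), give
`[G_E, H] = -λ G_E - a H + 𝕂 V` (`G_H`). The fields `V`, `X` and `X_⊥` preserve the volume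
(`integral_V`, `integral_X`, `integral_Xperp`), so integration by parts yields the Pestov identity
`‖V G_E u‖² = ‖G_E V u‖² + ‖G_E u‖² - (𝕂 V u, V u)` (`pestov`), and the control hypothesis for `V u`
gives `‖V G_E u‖² ≥ α ‖G_E V u‖² + ‖G_E u‖²`.

The operators `μ_±` shift frequencies by `±1` (`fourier_muPlus`, `fourier_muMinus`). If `u` has only
frequencies `k ≥ m`, then by orthogonality each of the three norms is the norm of the image under
`T_m` plus the norms of the components of frequency `m - 1` and `m`, and these are multiples of
`μ_- u_m` and `μ_- u_{m+1}`: this is the inequality for such `u` (`le_l2Norm_Q_of_positive`). A general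
`u` is split into its positive and negative frequencies; complex conjugation exchanges the two cases,
and the projections under `T_m` of the two parts are orthogonal. Splitting first, rather than applying
the Pestov identity to `u` itself, avoids the interaction of the two parts in the components of low
frequency when `m = 1`.

The geometric facts are proved in charts. `LocalSurface` is the geometry of an open subset of the
plane; the spray and the structure equations are computed there and transported to `SM` by
`coordFun`, which turns a function on `SM` into one on pairs `(y, w)`, `w ≠ 0`, constant on rays. The
invariance of the volume under the geodesic flow is reduced to the divergence theorem in the plane:
only the frequencies `±1` of `u` contribute to the integral of `X u`, and for a function
`f = -⟨e, v⟩` with these frequencies the integral of `X f` over the circle `S_xM` is a multiple of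
`div e`. -/

noncomputable section

set_option linter.unusedSectionVars false

/-! Shortcut instances: instance search for iterated spaces of linear maps of the plane is slow. -/

local instance : NormedAddCommGroup (Plane →L[ℝ] ℝ) := inferInstance
local instance : NormedSpace ℝ (Plane →L[ℝ] ℝ) := inferInstance
local instance : NormedAddCommGroup (Plane →L[ℝ] Plane) := inferInstance
local instance : NormedSpace ℝ (Plane →L[ℝ] Plane) := inferInstance
local instance : NormedAddCommGroup (Plane →L[ℝ] Plane →L[ℝ] ℝ) := inferInstance
local instance : NormedSpace ℝ (Plane →L[ℝ] Plane →L[ℝ] ℝ) := inferInstance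
local instance : NormedAddCommGroup (Plane →L[ℝ] Plane →L[ℝ] Plane) := inferInstance
local instance : NormedSpace ℝ (Plane →L[ℝ] Plane →L[ℝ] Plane) := inferInstance

theorem two_le_infty : (2 : WithTop ℕ∞) ≤ ∞ := WithTop.coe_le_coe.2 le_top

/-! ### Riemannian geometry in an open subset of the plane -/

/-- An oriented Riemannian metric on an open subset `Ω` of the plane, together with its Levi-Civita
connection: the metric `g`, the Christoffel symbols `Γ y v w = Γᵏ_ij vⁱ wʲ ∂_k`, determined by
symmetry and compatibility with `g`, and the rotation `J` by `π/2`. The values outside `Ω` are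
irrelevant. -/
structure LocalSurface (Ω : Set Plane) where
  g : Plane → Plane →L[ℝ] Plane →L[ℝ] ℝ
  Γ : Plane → Plane →L[ℝ] Plane →L[ℝ] Plane
  J : Plane → Plane →L[ℝ] Plane
  isOpen : IsOpen Ω
  g_smooth : ContDiffOn ℝ ∞ g Ω
  Γ_smooth : ContDiffOn ℝ ∞ Γ Ω
  J_smooth : ContDiffOn ℝ ∞ J Ω
  g_symm : ∀ y ∈ Ω, ∀ v w, g y v w = g y w v
  g_pos : ∀ y ∈ Ω, ∀ v, v ≠ 0 → 0 < g y v v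
  Γ_symm : ∀ y ∈ Ω, ∀ v w, Γ y v w = Γ y w v
  compat : ∀ y ∈ Ω, ∀ v w z, fderiv ℝ g y v w z = g y (Γ y v w) z + g y w (Γ y v z)
  J_sq : ∀ y ∈ Ω, ∀ v, J y (J y v) = -v
  J_isometry : ∀ y ∈ Ω, ∀ v w, g y (J y v) (J y w) = g y v w

namespace LocalSurface

variable {Ω : Set Plane} (S : LocalSurface Ω) {y : Plane} (hy : y ∈ Ω)

section Pointwise

include hy

theorem g_J_left (v w : Plane) : S.g y (S.J y v) w = -S.g y v (S.J y w) := by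
  have h := S.J_isometry y hy v (S.J y w)
  rw [S.J_sq y hy, map_neg] at h
  linarith

theorem g_self_J (v : Plane) : S.g y v (S.J y v) = 0 := by
  have h := S.g_J_left hy v v
  rw [S.g_symm y hy] at h
  linarith

theorem g_J_self (v : Plane) : S.g y (S.J y v) v = 0 := by
  rw [S.g_symm y hy, S.g_self_J hy]

/-- `w` and `J w` form an orthogonal basis with vectors of equal length. -/
theorem expand {w : Plane} (hw : w ≠ 0) (z : Plane) :
    S.g y w w • z = S.g y z w • w + S.g y z (S.J y w) • S.J y w := by
  have hN := (S.g_pos y hy w hw).ne'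
  have hJ := S.J_isometry y hy w w
  let Φ : Plane →ₗ[ℝ] Plane :=
    { toFun := fun z => WithLp.toLp 2 ![S.g y z w, S.g y z (S.J y w)]
      map_add' := fun a b => by ext i; fin_cases i <;> simp
      map_smul' := fun a b => by ext i; fin_cases i <;> simp }
  have hsurj : Function.Surjective Φ := by
    intro b
    refine ⟨(b 0 / S.g y w w) • w + (b 1 / S.g y w w) • S.J y w, ?_⟩
    ext i
    fin_cases i
    · simp [Φ, S.g_J_self hy, hN]
    · simp [Φ, S.g_self_J hy, hJ, hN]
  apply LinearMap.injective_iff_surjective.mpr hsurj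
  ext i
  fin_cases i
  · simp [Φ, S.g_J_self hy, mul_comm]
  · simp [Φ, S.g_self_J hy, hJ, mul_comm]

theorem eq_zero_of_orthogonal {w : Plane} (hw : w ≠ 0) {z : Plane} (h1 : S.g y z w = 0)
    (h2 : S.g y z (S.J y w) = 0) : z = 0 := by
  have h := S.expand hy hw z
  rw [h1, h2] at h
  simpa [(S.g_pos y hy w hw).ne'] using h

/-- The trace of an endomorphism, computed in the orthogonal basis `w, J w`. -/
theorem trace_eq (A : Plane →L[ℝ] Plane) {w : Plane} (hw : w ≠ 0) :
    S.g y (A w) w + S.g y (A (S.J y w)) (S.J y w) =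
      S.g y w w * ∑ i, A (stdVec i) i := by
  have hdec : ∀ z : Plane, z = ∑ i, z i • stdVec i := by
    intro z
    ext i
    fin_cases i <;> simp [stdVec]
  have h1 : ∀ i, S.g y w w * A (stdVec i) i =
      S.g y (stdVec i) w * A w i + S.g y (stdVec i) (S.J y w) * A (S.J y w) i := by
    intro i
    have := congrArg (fun z => A z i) (S.expand hy hw (stdVec i))
    simpa using this
  have h2 : ∀ a b : Plane, S.g y a b = ∑ i, S.g y (stdVec i) b * a i := by
    intro a b
    conv_lhs => rw [hdec a]
    simp [mul_comm]
  rw [Finset.mul_sum, Finset.sum_congr rfl fun i _ => h1 i, Finset.sum_add_distrib,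
    h2 (A w) w, h2 (A (S.J y w)) (S.J y w)]

/-- The determinant of the Gram matrix is the square of the area form. -/
theorem g_J_sq (v w : Plane) :
    S.g y (S.J y v) w ^ 2 + S.g y v w ^ 2 = S.g y v v * S.g y w w := by
  by_cases hv : v = 0
  · simp [hv]
  have h := congrArg (fun z => S.g y z w) (S.expand hy hv w)
  simp only [map_add, map_smul, add_apply, smul_apply, smul_eq_mul] at h
  rw [S.g_symm y hy w v, S.g_symm y hy w (S.J y v)] at h
  linarith

end Pointwise

/-- The area form `g(J v, w)`, evaluated on the coordinate basis. -/
def area (y : Plane) : ℝ := S.g y (S.J y (stdVec 0)) (stdVec 1)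

/-- The determinant of the Gram matrix. -/
def det (y : Plane) : ℝ :=
  S.g y (stdVec 0) (stdVec 0) * S.g y (stdVec 1) (stdVec 1) - S.g y (stdVec 0) (stdVec 1) ^ 2

theorem area_sq (hy : y ∈ Ω) : S.area y ^ 2 = S.det y := by
  have := S.g_J_sq hy (stdVec 0) (stdVec 1)
  rw [area, det]
  linarith

theorem eq_sum_stdVec (z : Plane) : z = z 0 • stdVec 0 + z 1 • stdVec 1 := by
  ext i
  fin_cases i <;> simp [stdVec]

theorem g_J_eq (hy : y ∈ Ω) (v w : Plane) :
    S.g y (S.J y v) w = (v 0 * w 1 - v 1 * w 0) * S.area y := by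
  conv_lhs => rw [eq_sum_stdVec v, eq_sum_stdVec w]
  have h := S.g_J_left hy (stdVec 1) (stdVec 0)
  rw [S.g_symm y hy] at h
  have h' : S.g y (S.J y (stdVec 1)) (stdVec 0) = -S.area y := by
    rw [S.g_symm y hy, h, area, S.g_symm y hy, S.g_symm y hy (S.J y _)]
  simp only [map_add, map_smul, add_apply, smul_apply, smul_eq_mul, S.g_J_self hy, h']
  rw [show S.g y (S.J y (stdVec 0)) (stdVec 1) = S.area y from rfl]
  ring

theorem det_pos (hy : y ∈ Ω) : 0 < S.det y := by
  rw [← S.area_sq hy]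
  have h0 : (stdVec 0 : Plane) ≠ 0 := by simp [stdVec]
  have h := S.g_J_eq hy (stdVec 0) (S.J y (stdVec 0))
  rw [S.J_isometry y hy] at h
  have := S.g_pos y hy _ h0
  have : S.area y ≠ 0 := by
    intro h'
    rw [h', mul_zero] at h
    linarith
  positivity

section Derivatives

include hy

include S in
theorem mem_nhds : Ω ∈ nhds y := S.isOpen.mem_nhds hy

theorem hasFDerivAt_g : HasFDerivAt S.g (fderiv ℝ S.g y) y :=
  ((S.g_smooth.contDiffAt (S.mem_nhds hy)).differentiableAt (by simp)).hasFDerivAt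

theorem hasFDerivAt_Γ : HasFDerivAt S.Γ (fderiv ℝ S.Γ y) y :=
  ((S.Γ_smooth.contDiffAt (S.mem_nhds hy)).differentiableAt (by simp)).hasFDerivAt

theorem hasFDerivAt_J : HasFDerivAt S.J (fderiv ℝ S.J y) y :=
  ((S.J_smooth.contDiffAt (S.mem_nhds hy)).differentiableAt (by simp)).hasFDerivAt

theorem fderiv_Γ_symm (v w z : Plane) : fderiv ℝ S.Γ y v w z = fderiv ℝ S.Γ y v z w := by
  have h1 : HasFDerivAt (fun x => S.Γ x w z)
      (((fderiv ℝ S.Γ y).flip w).flip z) y := by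
    have := ((S.hasFDerivAt_Γ hy).clm_apply (hasFDerivAt_const w y)).clm_apply
      (hasFDerivAt_const z y)
    refine this.congr_fderiv ?_
    ext; simp
  have h2 : HasFDerivAt (fun x => S.Γ x z w)
      (((fderiv ℝ S.Γ y).flip z).flip w) y := by
    have := ((S.hasFDerivAt_Γ hy).clm_apply (hasFDerivAt_const z y)).clm_apply
      (hasFDerivAt_const w y)
    refine this.congr_fderiv ?_
    ext; simp
  have h3 : (fun x => S.Γ x w z) =ᶠ[nhds y] fun x => S.Γ x z w := by
    filter_upwards [S.mem_nhds hy] with x hx using S.Γ_symm x hx w z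
  have := h1.unique (h2.congr_of_eventuallyEq h3)
  simpa using congrArg (fun L => L v) this

/-- The rotation is parallel: `∂_v J = J Γ_v - Γ_v J`. -/
theorem fderiv_J (v w : Plane) :
    fderiv ℝ S.J y v w = S.J y (S.Γ y v w) - S.Γ y v (S.J y w) := by
  by_cases hw : w = 0
  · simp [hw]
  -- the covariant derivative of `J`
  set A : Plane → Plane := fun z =>
    fderiv ℝ S.J y v z + S.Γ y v (S.J y z) - S.J y (S.Γ y v z) with hA
  have hJJ : ∀ z, fderiv ℝ S.J y v (S.J y z) + S.J y (fderiv ℝ S.J y v z) = 0 := by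
    intro z
    have h1 := (S.hasFDerivAt_J hy).clm_apply
      ((S.hasFDerivAt_J hy).clm_apply (hasFDerivAt_const z y))
    have h2 : (fun x => S.J x (S.J x z)) =ᶠ[nhds y] fun _ => -z := by
      filter_upwards [S.mem_nhds hy] with x hx using S.J_sq x hx z
    have h3 := h1.unique ((hasFDerivAt_const (-z) y).congr_of_eventuallyEq h2)
    have := congrArg (fun L => L v) h3
    simp at this
    rw [add_comm]
    exact this
  have hg : ∀ a b, S.g y (A a) b + S.g y a (A b) = 0 := by
    intro a b
    have h1 := ((S.hasFDerivAt_g hy).clm_apply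
      ((S.hasFDerivAt_J hy).clm_apply (hasFDerivAt_const a y))).clm_apply (hasFDerivAt_const b y)
    have h1' := ((S.hasFDerivAt_g hy).clm_apply (hasFDerivAt_const a y)).clm_apply
      ((S.hasFDerivAt_J hy).clm_apply (hasFDerivAt_const b y))
    have h2 : (fun x => S.g x (S.J x a) b) =ᶠ[nhds y] fun x => -(S.g x a (S.J x b)) := by
      filter_upwards [S.mem_nhds hy] with x hx using S.g_J_left hx a b
    have h3 := h1.unique (h1'.neg.congr_of_eventuallyEq h2)
    have := congrArg (fun L => L v) h3
    simp [S.compat y hy] at this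
    simp only [hA, map_add, map_sub, add_apply, sub_apply]
    have e1 := S.g_J_left hy (S.Γ y v a) b
    have e2 := S.g_J_left hy a (S.Γ y v b)
    linarith
  have hAJ : A (S.J y w) = -S.J y (A w) := by
    simp only [hA, map_add, map_sub, S.J_sq y hy, map_neg]
    rw [eq_neg_of_add_eq_zero_left (hJJ w)]
    abel
  have h1 : S.g y (A w) w = 0 := by
    have := hg w w
    rw [S.g_symm y hy w] at this
    linarith
  have h2 : S.g y (A w) (S.J y w) = 0 := by
    have := hg w (S.J y w)
    rw [hAJ, map_neg] at this
    have e := S.g_J_left hy w (A w)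
    rw [S.g_symm y hy] at e
    linarith
  have := S.eq_zero_of_orthogonal hy hw h1 h2
  have h4 : fderiv ℝ S.J y v w + S.Γ y v (S.J y w) - S.J y (S.Γ y v w) = 0 := this
  rw [sub_eq_zero] at h4
  rw [← h4]
  abel

end Derivatives

/-- The curvature endomorphism `R(v, w) = [∇_v, ∇_w]` for coordinate vector fields `v, w`. -/
def R (y v w z : Plane) : Plane :=
  fderiv ℝ S.Γ y v w z - fderiv ℝ S.Γ y w v z + S.Γ y v (S.Γ y w z) - S.Γ y w (S.Γ y v z)

theorem g_R_self (hy : y ∈ Ω) (v w z : Plane) : S.g y (S.R y v w z) z = 0 := by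
  have hsm : ContDiffAt ℝ ∞ (fun x => S.g x z z) y :=
    ((S.g_smooth.contDiffAt (S.mem_nhds hy)).clm_apply contDiffAt_const).clm_apply contDiffAt_const
  have key : ∀ a b : Plane, fderiv ℝ (fderiv ℝ (fun x => S.g x z z)) y a b =
      2 * (S.g y (S.Γ y a (S.Γ y b z)) z + S.g y (S.Γ y b z) (S.Γ y a z)
        + S.g y (fderiv ℝ S.Γ y a b z) z) := by
    intro a b
    have e1 : (fun x => fderiv ℝ (fun x => S.g x z z) x b) =ᶠ[nhds y]
        fun x => 2 * S.g x (S.Γ x b z) z := by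
      filter_upwards [S.mem_nhds hy] with x hx
      have h := (((S.hasFDerivAt_g hx).clm_apply (hasFDerivAt_const z x)).clm_apply
        (hasFDerivAt_const z x)).fderiv
      rw [h]
      simp [S.compat x hx]
      rw [S.g_symm x hx z]
      ring
    have hd : DifferentiableAt ℝ (fderiv ℝ (fun x => S.g x z z)) y :=
      (hsm.fderiv_right (m := 1) (by rw [one_add_one_eq_two]; exact two_le_infty)).differentiableAt (by simp)
    have h1 := hd.hasFDerivAt.clm_apply (hasFDerivAt_const b y)
    have h2 := (((S.hasFDerivAt_g hy).clm_apply
      (((S.hasFDerivAt_Γ hy).clm_apply (hasFDerivAt_const b y)).clm_apply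
        (hasFDerivAt_const z y))).clm_apply (hasFDerivAt_const z y)).const_mul 2
    have h3 := h1.unique (h2.congr_of_eventuallyEq e1)
    have := congrArg (fun L => L a) h3
    simp [S.compat y hy] at this
    rw [this]
    ring
  have hs := hsm.isSymmSndFDerivAt (by simpa using two_le_infty)
  have := hs v w
  rw [key, key, S.g_symm y hy (S.Γ y w z)] at this
  simp only [R, map_add, map_sub, add_apply, sub_apply]
  linarith

theorem g_R_skew (hy : y ∈ Ω) (v w a b : Plane) :
    S.g y (S.R y v w a) b = -S.g y (S.R y v w b) a := by
  have h := S.g_R_self hy v w (a + b)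
  have e : S.R y v w (a + b) = S.R y v w a + S.R y v w b := by
    simp only [R, map_add]
    abel
  have h1 := S.g_R_self hy v w a
  have h2 := S.g_R_self hy v w b
  simp only [e, map_add, add_apply, h1, h2] at h
  linarith

theorem R_eq_smul (v w z : Plane) :
    S.R y v w z = (v 0 * w 1 - v 1 * w 0) • S.R y (stdVec 0) (stdVec 1) z := by
  conv_lhs => rw [eq_sum_stdVec v, eq_sum_stdVec w]
  simp only [R, map_add, map_smul, add_apply, smul_apply]
  module

/-- The Gaussian curvature. -/
def K (y : Plane) : ℝ :=
  S.g y (stdVec 0) (S.R y (stdVec 0) (stdVec 1) (stdVec 1)) / S.det y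

theorem R_self_J (hy : y ∈ Ω) (w : Plane) :
    S.R y w (S.J y w) w = -(S.K y * S.g y w w) • S.J y w := by
  by_cases hw : w = 0
  · subst hw
    simp [R]
  have hN := (S.g_pos y hy w hw).ne'
  have hd := (S.det_pos hy).ne'
  have ha : S.area y ≠ 0 := by
    intro h
    have := S.area_sq hy
    rw [h] at this
    exact hd (by rw [← this]; simp)
  have e0 : (stdVec 0 : Plane) ≠ 0 := by simp [stdVec]
  -- `g(R₀₁ w, J w) / g(w, w)` is the same for all `w`
  have hR : ∀ a b, S.g y (S.R y (stdVec 0) (stdVec 1) a) b * S.g y w w =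
      S.g y (S.R y (stdVec 0) (stdVec 1) w) (S.J y w) * S.g y (S.J y a) b := by
    intro a b
    have hRlin : ∀ (s t : ℝ) (p q : Plane), S.R y (stdVec 0) (stdVec 1) (s • p + t • q) =
        s • S.R y (stdVec 0) (stdVec 1) p + t • S.R y (stdVec 0) (stdVec 1) q := by
      intro s t p q
      simp only [R, map_add, map_smul]
      module
    have hexp := S.expand hy hw
    have h1 : S.g y w w • S.R y (stdVec 0) (stdVec 1) a =
        S.g y a w • S.R y (stdVec 0) (stdVec 1) w +
        S.g y a (S.J y w) • S.R y (stdVec 0) (stdVec 1) (S.J y w) := by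
      rw [← hRlin, ← hexp a]
      have := hRlin (S.g y w w) 0 a 0
      simpa using this.symm
    have h2 : ∀ c, S.g y w w * S.g y c b =
        S.g y b w * S.g y c w + S.g y b (S.J y w) * S.g y c (S.J y w) := by
      intro c
      have := congrArg (fun z => S.g y c z) (hexp b)
      simpa using this
    have h3 := congrArg (fun z => S.g y z b) h1
    simp only [map_add, map_smul, add_apply, smul_apply, smul_eq_mul] at h3
    have k1 := h2 (S.R y (stdVec 0) (stdVec 1) w)
    have k2 := h2 (S.R y (stdVec 0) (stdVec 1) (S.J y w))
    have k3 := h2 (S.J y a)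
    rw [S.g_R_self hy] at k1
    have k4 := S.g_R_skew hy (stdVec 0) (stdVec 1) (S.J y w) w
    rw [S.g_R_self hy] at k2
    rw [S.J_isometry y hy, S.g_J_left hy a w] at k3
    apply mul_left_cancel₀ hN
    linear_combination S.g y w w * h3 + S.g y a w * k1 + S.g y a (S.J y w) * k2 +
      S.g y a (S.J y w) * S.g y b w * k4
      - S.g y (S.R y (stdVec 0) (stdVec 1) w) (S.J y w) * k3
  have hK : S.K y * S.det y = S.g y (stdVec 0) (S.R y (stdVec 0) (stdVec 1) (stdVec 1)) := by
    rw [K, div_mul_cancel₀ _ hd]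
  have h1 := hR (stdVec 1) (stdVec 0)
  rw [S.g_symm y hy, ← hK, S.g_J_eq hy] at h1
  simp [stdVec] at h1
  have h2 := S.g_J_eq hy w (S.J y w)
  rw [S.J_isometry y hy] at h2
  have key : S.g y (S.R y (stdVec 0) (stdVec 1) w) (S.J y w) = -S.K y * S.area y * S.g y w w := by
    apply mul_right_cancel₀ ha
    rw [← S.area_sq hy] at h1
    simp only [stdVec] at *
    linear_combination h1
  rw [← sub_eq_zero]
  apply S.eq_zero_of_orthogonal hy hw
  · rw [R_eq_smul]
    simp [S.g_R_self hy, S.g_J_self hy]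
  · rw [R_eq_smul]
    simp only [map_sub, map_smul, sub_apply, smul_apply, smul_eq_mul, key, S.J_isometry y hy]
    linear_combination S.K y * S.g y w w * h2

end LocalSurface

/-! ### The geodesic spray and the structure equations in coordinates -/

namespace LocalSurface

variable {Ω : Set Plane} (S : LocalSurface Ω) {y : Plane} (hy : y ∈ Ω)

/-- The geodesic spray, as a vector field in the coordinates `(y, w)` of the tangent bundle. -/
def fieldX (z : Plane × Plane) : Plane × Plane := (z.2, -S.Γ z.1 z.2 z.2)

/-- The generator of the rotation of the fibres. -/
def fieldV (z : Plane × Plane) : Plane × Plane := (0, S.J z.1 z.2)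

/-- Minus the horizontal lift of `J w`. -/
def fieldH (z : Plane × Plane) : Plane × Plane := (-S.J z.1 z.2, S.Γ z.1 z.2 (S.J z.1 z.2))

theorem hasFDerivAt_fieldX (hy : y ∈ Ω) (w : Plane) : ∃ L : Plane × Plane →L[ℝ] Plane × Plane,
    HasFDerivAt S.fieldX L (y, w) ∧ ∀ v a, L (v, a) =
      (a, -(fderiv ℝ S.Γ y v w w + S.Γ y a w + S.Γ y w a)) := by
  have h1 : HasFDerivAt (fun z : Plane × Plane => z.1) (ContinuousLinearMap.fst ℝ Plane Plane)
    (y, w) := hasFDerivAt_fst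
  have h2 : HasFDerivAt (fun z : Plane × Plane => z.2) (ContinuousLinearMap.snd ℝ Plane Plane)
    (y, w) := hasFDerivAt_snd
  have hΓ := (S.hasFDerivAt_Γ hy).comp (y, w) h1
  refine ⟨_, h2.prodMk ((hΓ.clm_apply h2).clm_apply h2).neg, ?_⟩
  intro v a
  simp
  abel

theorem hasFDerivAt_fieldV (hy : y ∈ Ω) (w : Plane) : ∃ L : Plane × Plane →L[ℝ] Plane × Plane,
    HasFDerivAt S.fieldV L (y, w) ∧ ∀ v a, L (v, a) = (0, fderiv ℝ S.J y v w + S.J y a) := by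
  have h1 : HasFDerivAt (fun z : Plane × Plane => z.1) (ContinuousLinearMap.fst ℝ Plane Plane)
    (y, w) := hasFDerivAt_fst
  have h2 : HasFDerivAt (fun z : Plane × Plane => z.2) (ContinuousLinearMap.snd ℝ Plane Plane)
    (y, w) := hasFDerivAt_snd
  have hJ := (S.hasFDerivAt_J hy).comp (y, w) h1
  refine ⟨_, (hasFDerivAt_const (0 : Plane) (y, w)).prodMk (hJ.clm_apply h2), ?_⟩
  intro v a
  simp
  abel

theorem hasFDerivAt_fieldH (hy : y ∈ Ω) (w : Plane) : ∃ L : Plane × Plane →L[ℝ] Plane × Plane,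
    HasFDerivAt S.fieldH L (y, w) ∧ ∀ v a, L (v, a) =
      (-(fderiv ℝ S.J y v w + S.J y a), fderiv ℝ S.Γ y v w (S.J y w) + S.Γ y a (S.J y w) +
        S.Γ y w (fderiv ℝ S.J y v w + S.J y a)) := by
  have h1 : HasFDerivAt (fun z : Plane × Plane => z.1) (ContinuousLinearMap.fst ℝ Plane Plane)
    (y, w) := hasFDerivAt_fst
  have h2 : HasFDerivAt (fun z : Plane × Plane => z.2) (ContinuousLinearMap.snd ℝ Plane Plane)
    (y, w) := hasFDerivAt_snd
  have hJ := ((S.hasFDerivAt_J hy).comp (y, w) h1).clm_apply h2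
  have hΓ := (S.hasFDerivAt_Γ hy).comp (y, w) h1
  refine ⟨_, hJ.neg.prodMk ((hΓ.clm_apply h2).clm_apply hJ), ?_⟩
  intro v a
  simp
  refine ⟨?_, ?_⟩ <;> abel

theorem differentiableAt_fieldX (hy : y ∈ Ω) (w : Plane) : DifferentiableAt ℝ S.fieldX (y, w) :=
  let ⟨_, h, _⟩ := S.hasFDerivAt_fieldX hy w
  h.differentiableAt

theorem differentiableAt_fieldV (hy : y ∈ Ω) (w : Plane) : DifferentiableAt ℝ S.fieldV (y, w) :=
  let ⟨_, h, _⟩ := S.hasFDerivAt_fieldV hy w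
  h.differentiableAt

theorem differentiableAt_fieldH (hy : y ∈ Ω) (w : Plane) : DifferentiableAt ℝ S.fieldH (y, w) :=
  let ⟨_, h, _⟩ := S.hasFDerivAt_fieldH hy w
  h.differentiableAt

open VectorField in
theorem lieBracket_X_V (hy : y ∈ Ω) (w : Plane) :
    lieBracket ℝ S.fieldX S.fieldV (y, w) = S.fieldH (y, w) := by
  obtain ⟨LX, hX, hX'⟩ := S.hasFDerivAt_fieldX hy w
  obtain ⟨LV, hV, hV'⟩ := S.hasFDerivAt_fieldV hy w
  rw [lieBracket_eq]
  simp only [hX.fderiv, hV.fderiv]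
  simp only [fieldX, fieldV, fieldH, hX', hV', S.fderiv_J hy, map_zero, zero_apply, map_neg]
  ext1
  · simp
  · simp only [Prod.snd_sub]
    rw [S.Γ_symm y hy (S.J y w) w]
    abel

open VectorField in
theorem lieBracket_V_H (hy : y ∈ Ω) (w : Plane) :
    lieBracket ℝ S.fieldV S.fieldH (y, w) = S.fieldX (y, w) := by
  obtain ⟨LH, hH, hH'⟩ := S.hasFDerivAt_fieldH hy w
  obtain ⟨LV, hV, hV'⟩ := S.hasFDerivAt_fieldV hy w
  rw [lieBracket_eq]
  simp only [hH.fderiv, hV.fderiv]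
  simp only [fieldX, fieldV, fieldH, hH', hV', S.fderiv_J hy, map_zero, zero_apply, map_neg,
    S.J_sq y hy, neg_apply]
  ext1
  · simp
  · simp only [Prod.snd_sub, map_neg, zero_add]
    rw [S.Γ_symm y hy (S.J y w) w]
    abel

open VectorField in
theorem lieBracket_X_H (hy : y ∈ Ω) (w : Plane) :
    lieBracket ℝ S.fieldX S.fieldH (y, w) = -(S.K y * S.g y w w) • S.fieldV (y, w) := by
  obtain ⟨LH, hH, hH'⟩ := S.hasFDerivAt_fieldH hy w
  obtain ⟨LX, hX, hX'⟩ := S.hasFDerivAt_fieldX hy w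
  rw [lieBracket_eq]
  simp only [hH.fderiv, hX.fderiv]
  simp only [fieldX, fieldV, fieldH, hH', hX', S.fderiv_J hy, map_neg, neg_apply]
  ext1
  · simp
  · simp only [Prod.snd_sub, Prod.smul_snd]
    rw [← S.R_self_J hy, R, S.fderiv_Γ_symm hy w (S.J y w) w,
      S.Γ_symm y hy (S.Γ y w (S.J y w)) w, S.Γ_symm y hy (S.Γ y w w) (S.J y w), map_add, map_sub,
      map_neg]
    rw [S.Γ_symm y hy (S.J y w) w]
    abel

/-! Differentiation of functions of `(y, w)`, `w ≠ 0`, along the three fields. -/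

/-- The part of the tangent bundle over `Ω` off the zero section. -/
def domain (Ω : Set Plane) : Set (Plane × Plane) := Ω ×ˢ {0}ᶜ

/-- Differentiation along the geodesic spray. -/
def dX (U : Plane × Plane → ℂ) (z : Plane × Plane) : ℂ := fderiv ℝ U z (S.fieldX z)

/-- Differentiation along the vertical field. -/
def dV (U : Plane × Plane → ℂ) (z : Plane × Plane) : ℂ := fderiv ℝ U z (S.fieldV z)

/-- Differentiation along minus the horizontal lift of `J w`. -/
def dH (U : Plane × Plane → ℂ) (z : Plane × Plane) : ℂ := fderiv ℝ U z (S.fieldH z)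

include S in
theorem isOpen_domain : IsOpen (domain Ω) := S.isOpen.prod isOpen_compl_singleton

theorem contDiffOn_fieldX : ContDiffOn ℝ ∞ S.fieldX (domain Ω) := by
  have h1 : ContDiffOn ℝ ∞ (fun z : Plane × Plane => S.Γ z.1) (domain Ω) :=
    S.Γ_smooth.comp contDiff_fst.contDiffOn fun z hz => hz.1
  exact contDiff_snd.contDiffOn.prodMk
    (((h1.clm_apply contDiff_snd.contDiffOn).clm_apply contDiff_snd.contDiffOn).neg)

theorem contDiffOn_J : ContDiffOn ℝ ∞ (fun z : Plane × Plane => S.J z.1 z.2) (domain Ω) := by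
  have h1 : ContDiffOn ℝ ∞ (fun z : Plane × Plane => S.J z.1) (domain Ω) :=
    S.J_smooth.comp contDiff_fst.contDiffOn fun z hz => hz.1
  exact h1.clm_apply contDiff_snd.contDiffOn

theorem contDiffOn_fieldV : ContDiffOn ℝ ∞ S.fieldV (domain Ω) :=
  contDiffOn_const.prodMk S.contDiffOn_J

theorem contDiffOn_fieldH : ContDiffOn ℝ ∞ S.fieldH (domain Ω) := by
  have h1 : ContDiffOn ℝ ∞ (fun z : Plane × Plane => S.Γ z.1) (domain Ω) :=
    S.Γ_smooth.comp contDiff_fst.contDiffOn fun z hz => hz.1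
  exact S.contDiffOn_J.neg.prodMk
    ((h1.clm_apply contDiff_snd.contDiffOn).clm_apply S.contDiffOn_J)

section Smooth

variable {U : Plane × Plane → ℂ} (hU : ContDiffOn ℝ ∞ U (domain Ω))

include hU

include S in
theorem contDiffOn_fderiv : ContDiffOn ℝ ∞ (fderiv ℝ U) (domain Ω) :=
  hU.fderiv_of_isOpen S.isOpen_domain (by simp)

theorem contDiffOn_dX : ContDiffOn ℝ ∞ (S.dX U) (domain Ω) :=
  (S.contDiffOn_fderiv hU).clm_apply S.contDiffOn_fieldX

theorem contDiffOn_dV : ContDiffOn ℝ ∞ (S.dV U) (domain Ω) :=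
  (S.contDiffOn_fderiv hU).clm_apply S.contDiffOn_fieldV

theorem contDiffOn_dH : ContDiffOn ℝ ∞ (S.dH U) (domain Ω) :=
  (S.contDiffOn_fderiv hU).clm_apply S.contDiffOn_fieldH

include S in
theorem contDiffAt_of_mem {z : Plane × Plane} (hz : z ∈ domain Ω) : ContDiffAt ℝ ∞ U z :=
  hU.contDiffAt (S.isOpen_domain.mem_nhds hz)

theorem dX_dV {z : Plane × Plane} (hz : z ∈ domain Ω) :
    S.dX (S.dV U) z - S.dV (S.dX U) z = S.dH U z := by
  have h := VectorField.fderiv_apply_lieBracket (S.contDiffAt_of_mem hU hz)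
    (by simpa using two_le_infty) (S.differentiableAt_fieldV hz.1 z.2)
    (S.differentiableAt_fieldX hz.1 z.2)
  rw [S.lieBracket_X_V hz.1] at h
  exact h.symm

theorem dV_dH {z : Plane × Plane} (hz : z ∈ domain Ω) :
    S.dV (S.dH U) z - S.dH (S.dV U) z = S.dX U z := by
  have h := VectorField.fderiv_apply_lieBracket (S.contDiffAt_of_mem hU hz)
    (by simpa using two_le_infty) (S.differentiableAt_fieldH hz.1 z.2)
    (S.differentiableAt_fieldV hz.1 z.2)
  rw [S.lieBracket_V_H hz.1] at h
  exact h.symm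

theorem dX_dH {z : Plane × Plane} (hz : z ∈ domain Ω) :
    S.dX (S.dH U) z - S.dH (S.dX U) z = -(S.K z.1 * S.g z.1 z.2 z.2) • S.dV U z := by
  have h := VectorField.fderiv_apply_lieBracket (S.contDiffAt_of_mem hU hz)
    (by simpa using two_le_infty) (S.differentiableAt_fieldH hz.1 z.2)
    (S.differentiableAt_fieldX hz.1 z.2)
  rw [S.lieBracket_X_H hz.1, map_smul] at h
  exact h.symm

/-- The spray derivative of a function which is constant on rays is homogeneous of degree one. -/
theorem dX_smul (hhom : ∀ y ∈ Ω, ∀ w, w ≠ 0 → ∀ s : ℝ, 0 < s → U (y, s • w) = U (y, w))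
    {z : Plane × Plane} (hz : z ∈ domain Ω) {s : ℝ} (hs : 0 < s) :
    S.dX U (z.1, s • z.2) = s • S.dX U z := by
  have hz' : (z.1, s • z.2) ∈ domain Ω := ⟨hz.1, smul_ne_zero hs.ne' hz.2⟩
  let D : Plane × Plane →L[ℝ] Plane × Plane :=
    (ContinuousLinearMap.fst ℝ Plane Plane).prod (s • ContinuousLinearMap.snd ℝ Plane Plane)
  have h1 : HasFDerivAt (U ∘ D) ((fderiv ℝ U (z.1, s • z.2)).comp D) z :=
    HasFDerivAt.comp z
      ((S.contDiffAt_of_mem hU hz').differentiableAt (by simp)).hasFDerivAt D.hasFDerivAt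
  have h2 : U ∘ D =ᶠ[nhds z] U := by
    filter_upwards [S.isOpen_domain.mem_nhds hz] with x hx
    exact hhom x.1 hx.1 x.2 hx.2 s hs
  have h3 := (h1.congr_of_eventuallyEq h2.symm).fderiv
  rw [dX, dX, h3, fieldX, fieldX, ← map_smul]
  simp [D, smul_smul]

end Smooth

/-- The length of `w`. -/
def norm (z : Plane × Plane) : ℝ := √(S.g z.1 z.2 z.2)

theorem norm_pos {z : Plane × Plane} (hz : z ∈ domain Ω) : 0 < S.norm z :=
  Real.sqrt_pos.mpr (S.g_pos z.1 hz.1 z.2 hz.2)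

theorem contDiffOn_normSq : ContDiffOn ℝ ∞ (fun z : Plane × Plane => S.g z.1 z.2 z.2)
    (domain Ω) := by
  have h1 : ContDiffOn ℝ ∞ (fun z : Plane × Plane => S.g z.1) (domain Ω) :=
    S.g_smooth.comp contDiff_fst.contDiffOn fun z hz => hz.1
  exact (h1.clm_apply contDiff_snd.contDiffOn).clm_apply contDiff_snd.contDiffOn

theorem contDiffOn_norm : ContDiffOn ℝ ∞ S.norm (domain Ω) :=
  S.contDiffOn_normSq.sqrt fun z hz => (S.g_pos z.1 hz.1 z.2 hz.2).ne'

theorem hasFDerivAt_normSq {z : Plane × Plane} (hz : z ∈ domain Ω) :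
    ∃ L : Plane × Plane →L[ℝ] ℝ,
      HasFDerivAt (fun z : Plane × Plane => S.g z.1 z.2 z.2) L z ∧
      L (S.fieldX z) = 0 ∧ L (S.fieldV z) = 0 ∧ L (S.fieldH z) = 0 := by
  have h1 : HasFDerivAt (fun z : Plane × Plane => z.1) (ContinuousLinearMap.fst ℝ Plane Plane)
    z := hasFDerivAt_fst
  have h2 : HasFDerivAt (fun z : Plane × Plane => z.2) (ContinuousLinearMap.snd ℝ Plane Plane)
    z := hasFDerivAt_snd
  have hg := (S.hasFDerivAt_g hz.1).comp z h1
  refine ⟨_, (hg.clm_apply h2).clm_apply h2, ?_, ?_, ?_⟩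
  · simp [fieldX, S.compat z.1 hz.1]
  · simp [fieldV, S.g_self_J hz.1, S.g_J_self hz.1]
  · simp [fieldH, S.compat z.1 hz.1]
    rw [S.Γ_symm z.1 hz.1 (S.J z.1 z.2)]
    ring

theorem hasFDerivAt_norm_inv {z : Plane × Plane} (hz : z ∈ domain Ω) :
    ∃ L : Plane × Plane →L[ℝ] ℝ, HasFDerivAt (fun z => (S.norm z)⁻¹) L z ∧
      L (S.fieldX z) = 0 ∧ L (S.fieldV z) = 0 ∧ L (S.fieldH z) = 0 := by
  obtain ⟨L, hL, h1, h2, h3⟩ := S.hasFDerivAt_normSq hz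
  have h := (hasDerivAt_inv (S.norm_pos hz).ne').comp_hasFDerivAt z
    (hL.sqrt (S.g_pos z.1 hz.1 z.2 hz.2).ne')
  refine ⟨_, h, ?_, ?_, ?_⟩ <;> simp [h1, h2, h3]

section NormInv

variable {U : Plane × Plane → ℂ} (hU : ContDiffOn ℝ ∞ U (domain Ω))
  {z : Plane × Plane} (hz : z ∈ domain Ω)

include hU

theorem contDiffOn_norm_inv_smul :
    ContDiffOn ℝ ∞ (fun z => (S.norm z)⁻¹ • U z) (domain Ω) :=
  (S.contDiffOn_norm.inv fun _ hz => (S.norm_pos hz).ne').smul hU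

include hz

theorem dX_norm_inv : S.dX (fun z => (S.norm z)⁻¹ • U z) z = (S.norm z)⁻¹ • S.dX U z := by
  obtain ⟨L, hL, h1, h2, h3⟩ := S.hasFDerivAt_norm_inv hz
  have hU' := ((S.contDiffAt_of_mem hU hz).differentiableAt (by simp)).hasFDerivAt
  rw [dX, (hL.fun_smul hU').fderiv]
  simp [h1, dX]

theorem dV_norm_inv : S.dV (fun z => (S.norm z)⁻¹ • U z) z = (S.norm z)⁻¹ • S.dV U z := by
  obtain ⟨L, hL, h1, h2, h3⟩ := S.hasFDerivAt_norm_inv hz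
  have hU' := ((S.contDiffAt_of_mem hU hz).differentiableAt (by simp)).hasFDerivAt
  rw [dV, (hL.fun_smul hU').fderiv]
  simp [h2, dV]

theorem dH_norm_inv : S.dH (fun z => (S.norm z)⁻¹ • U z) z = (S.norm z)⁻¹ • S.dH U z := by
  obtain ⟨L, hL, h1, h2, h3⟩ := S.hasFDerivAt_norm_inv hz
  have hU' := ((S.contDiffAt_of_mem hU hz).differentiableAt (by simp)).hasFDerivAt
  rw [dH, (hL.fun_smul hU').fderiv]
  simp [h3, dH]

end NormInv

/-! ### The divergence in coordinates -/

/-- The divergence `tr ∇e` of a vector field. -/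
def divergence (e : Plane → Plane) (y : Plane) : ℝ :=
  ∑ i, (fderiv ℝ e y (stdVec i) + S.Γ y (stdVec i) (e y)) i

theorem hasFDerivAt_det (hy : y ∈ Ω) : ∃ L : Plane →L[ℝ] ℝ, HasFDerivAt S.det L y ∧
    ∀ v, L v = 2 * S.det y * ∑ k, S.Γ y v (stdVec k) k := by
  have h : ∀ a b : Plane, HasFDerivAt (fun x => S.g x a b)
      (((fderiv ℝ S.g y).flip a).flip b) y := by
    intro a b
    have := ((S.hasFDerivAt_g hy).clm_apply (hasFDerivAt_const a y)).clm_apply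
      (hasFDerivAt_const b y)
    refine this.congr_fderiv ?_
    ext; simp
  refine ⟨_, ((h (stdVec 0) (stdVec 0)).mul (h (stdVec 1) (stdVec 1))).sub
    ((h (stdVec 0) (stdVec 1)).pow 2), ?_⟩
  intro v
  simp only [Fin.sum_univ_two, S.compat y hy, det, ContinuousLinearMap.flip_apply, sub_apply,
    add_apply, smul_apply, smul_eq_mul]
  generalize hp : S.Γ y v (stdVec 0) = p
  generalize hq : S.Γ y v (stdVec 1) = q
  rw [eq_sum_stdVec p, eq_sum_stdVec q]
  have h01 := S.g_symm y hy (stdVec 1) (stdVec 0)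
  simp only [map_add, map_smul, add_apply, smul_apply, smul_eq_mul, h01]
  simp [stdVec]
  ring

theorem divergence_eq (hy : y ∈ Ω) {e : Plane → Plane} (he : ContDiffOn ℝ ∞ e Ω) :
    (∑ i, fderiv ℝ (fun x => √(S.det x) * e x i) y (stdVec i)) / √(S.det y) =
      S.divergence e y := by
  obtain ⟨L, hL, hL'⟩ := S.hasFDerivAt_det hy
  have hd := S.det_pos hy
  have he' := ((he.contDiffAt (S.mem_nhds hy)).differentiableAt (by simp)).hasFDerivAt
  have hi : ∀ i, HasFDerivAt (fun x => e x i)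
      ((EuclideanSpace.proj i : Plane →L[ℝ] ℝ).comp (fderiv ℝ e y)) y := fun i =>
    (EuclideanSpace.proj i : Plane →L[ℝ] ℝ).hasFDerivAt.comp y he'
  have hf : ∀ i v, fderiv ℝ (fun x => √(S.det x) * e x i) y v =
      √(S.det y) * (fderiv ℝ e y v i + e y i * ∑ k, S.Γ y v (stdVec k) k) := by
    intro i v
    rw [((hL.sqrt hd.ne').fun_mul (hi i)).fderiv]
    simp only [add_apply, smul_apply, hL', smul_eq_mul, ContinuousLinearMap.comp_apply]
    have : √(S.det y) ≠ 0 := (Real.sqrt_pos.mpr hd).ne'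
    have h2 : S.det y = √(S.det y) ^ 2 := (Real.sq_sqrt hd.le).symm
    field_simp
    rw [h2]
    simp
    ring
  have hs := (Real.sqrt_pos.mpr hd).ne'
  rw [div_eq_iff hs]
  simp only [hf, ← Finset.mul_sum]
  rw [mul_comm]
  congr 1
  simp only [divergence, Fin.sum_univ_two]
  conv_rhs => rw [eq_sum_stdVec (e y)]
  have h01 := S.Γ_symm y hy (stdVec 1) (stdVec 0)
  simp only [map_add, map_smul, PiLp.add_apply, PiLp.smul_apply, smul_eq_mul, h01]
  ring

/-- For `λ = g(e, J w)` one has `V λ = -g(e, w)` and `X V λ + H λ = -|w|² tr ∇e`. -/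
theorem dX_inner_add_dH_inner {e : Plane → Plane} (he : ContDiffOn ℝ ∞ e Ω)
    {z : Plane × Plane} (hz : z ∈ domain Ω) :
    S.dX (fun z => ((-S.g z.1 (e z.1) z.2 : ℝ) : ℂ)) z +
      S.dH (fun z => ((S.g z.1 (e z.1) (S.J z.1 z.2) : ℝ) : ℂ)) z =
      -((S.g z.1 z.2 z.2 * S.divergence e z.1 : ℝ) : ℂ) := by
  have h1 : HasFDerivAt (fun z : Plane × Plane => z.1) (ContinuousLinearMap.fst ℝ Plane Plane)
    z := hasFDerivAt_fst
  have h2 : HasFDerivAt (fun z : Plane × Plane => z.2) (ContinuousLinearMap.snd ℝ Plane Plane)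
    z := hasFDerivAt_snd
  have hg := (S.hasFDerivAt_g hz.1).comp z h1
  have hJ := ((S.hasFDerivAt_J hz.1).comp z h1).clm_apply h2
  have he' := ((he.contDiffAt (S.mem_nhds hz.1)).differentiableAt (by simp)).hasFDerivAt.comp z h1
  have hA := Complex.ofRealCLM.hasFDerivAt.comp z ((hg.clm_apply he').clm_apply h2).fun_neg
  have hL := Complex.ofRealCLM.hasFDerivAt.comp z ((hg.clm_apply he').clm_apply hJ)
  have e1 := hA.fderiv
  have e2 := hL.fderiv
  simp only [Function.comp_def, Complex.ofRealCLM_apply] at e1 e2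
  rw [dX, dH, e1, e2]
  obtain ⟨y, w⟩ := z
  set A : Plane →L[ℝ] Plane := fderiv ℝ e y + (S.Γ y).flip (e y) with hAdef
  have htr := S.trace_eq hz.1 A hz.2
  have hdiv : S.divergence e y = ∑ i, A (stdVec i) i := by
    simp [divergence, hAdef]
  rw [hdiv, ← htr, ← Complex.ofReal_neg]
  have hre : ∀ v, Complex.ofRealCLM v = (v : ℂ) := fun _ => rfl
  simp only [ContinuousLinearMap.comp_apply, hre]
  rw [← Complex.ofReal_add]
  congr 1
  simp only [fieldX, fieldH, add_apply, neg_apply, ContinuousLinearMap.flip_apply,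
    ContinuousLinearMap.comp_apply, ContinuousLinearMap.coe_fst',
    ContinuousLinearMap.coe_snd', S.compat y hz.1, S.fderiv_J hz.1, hAdef, map_add, map_neg,
    map_sub]
  rw [S.Γ_symm y hz.1 (S.J y w) w]
  ring

end LocalSurface

/-! ### The metric, the connection and the rotation in a chart -/

namespace GaussianThermostat

variable {M : Type*} [TopologicalSpace M] [ChartedSpace Plane M] [IsManifold (𝓡 2) ∞ M]

/-- The open subset of the plane covered by the chart at `c`. -/
abbrev chartTarget (c : M) : Set Plane := (extChartAt (𝓡 2) c).target

/-- The tangent vector with components `w` at the point with coordinates `y`, as an element of the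
tangent space. -/
def tangentVec (c : M) (y w : Plane) : TangentSpace (𝓡 2) ((extChartAt (𝓡 2) c).symm y) :=
  (ofCoord c y w).2

theorem ofCoord_eq (c : M) (y w : Plane) :
    ofCoord c y w = ⟨(extChartAt (𝓡 2) c).symm y, tangentVec c y w⟩ := rfl

theorem tangentVec_add (c : M) (y v w : Plane) :
    tangentVec c y (v + w) = tangentVec c y v + tangentVec c y w :=
  map_add (mfderiv 𝓘(ℝ, Plane) (𝓡 2) (extChartAt (𝓡 2) c).symm y) v w

theorem tangentVec_smul (c : M) (y : Plane) (s : ℝ) (w : Plane) :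
    tangentVec c y (s • w) = s • tangentVec c y w :=
  map_smul (mfderiv 𝓘(ℝ, Plane) (𝓡 2) (extChartAt (𝓡 2) c).symm y) s w

theorem components_add (c x : M) (v w : TangentSpace (𝓡 2) x) :
    components c x (v + w) = components c x v + components c x w :=
  map_add (mfderiv (𝓡 2) 𝓘(ℝ, Plane) (extChartAt (𝓡 2) c) x) v w

theorem components_smul (c x : M) (s : ℝ) (w : TangentSpace (𝓡 2) x) :
    components c x (s • w) = s • components c x w :=
  map_smul (mfderiv (𝓡 2) 𝓘(ℝ, Plane) (extChartAt (𝓡 2) c) x) s w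

theorem components_tangentVec {c : M} {y : Plane} (hy : y ∈ chartTarget c) (w : Plane) :
    components c ((extChartAt (𝓡 2) c).symm y) (tangentVec c y w) = w := by
  have h := mfderiv_extChartAt_comp_mfderivWithin_extChartAt_symm (I := 𝓡 2) hy
  rw [ModelWithCorners.range_eq_univ, mfderivWithin_univ] at h
  exact congrArg (fun L => L w) h

theorem extChartAt_ofCoord {c : M} {y : Plane} (hy : y ∈ chartTarget c) (w : Plane) :
    extChartAt (𝓡 2) c (ofCoord c y w).1 = y := (extChartAt (𝓡 2) c).right_inv hy

theorem ofCoord_mem_source {c : M} {y : Plane} (hy : y ∈ chartTarget c) (w : Plane) :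
    (ofCoord c y w).1 ∈ (extChartAt (𝓡 2) c).source := (extChartAt (𝓡 2) c).map_target hy

theorem tangentVec_components {c : M} {y : Plane} (hy : y ∈ chartTarget c)
    (v : TangentSpace (𝓡 2) ((extChartAt (𝓡 2) c).symm y)) :
    tangentVec c y (components c ((extChartAt (𝓡 2) c).symm y) v) = v := by
  have h := mfderivWithin_extChartAt_symm_comp_mfderiv_extChartAt (I := 𝓡 2) hy
  rw [ModelWithCorners.range_eq_univ, mfderivWithin_univ] at h
  exact congrArg (fun L => L v) h

theorem ofCoord_components {c : M} (p : TangentBundle (𝓡 2) M)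
    (hp : p.1 ∈ (extChartAt (𝓡 2) c).source) :
    ofCoord c (extChartAt (𝓡 2) c p.1) (components c p.1 p.2) = p := by
  obtain ⟨x, v⟩ := p
  obtain ⟨y, hy, rfl⟩ : ∃ y ∈ chartTarget c, (extChartAt (𝓡 2) c).symm y = x :=
    ⟨_, (extChartAt (𝓡 2) c).map_source hp, (extChartAt (𝓡 2) c).left_inv hp⟩
  dsimp only
  rw [(extChartAt (𝓡 2) c).right_inv hy, ofCoord_eq, tangentVec_components hy]

/-- The chart of the tangent bundle induced by the chart at `c`. -/
theorem extChartAt_tangent (c : M) (p : TangentBundle (𝓡 2) M)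
    (hp : p.1 ∈ (extChartAt (𝓡 2) c).source) :
    extChartAt (𝓡 2).tangent (⟨c, 0⟩ : TangentBundle (𝓡 2) M) p =
      (extChartAt (𝓡 2) c p.1, components c p.1 p.2) := by
  have hp' : p.1 ∈ (chartAt Plane c).source := by rwa [extChartAt_source] at hp
  have h := TangentBundle.continuousLinearMapAt_trivializationAt (𝕜 := ℝ) (I := 𝓡 2) hp'
  have h2 := congrArg (fun L => L p.2) h
  rw [Bundle.Trivialization.continuousLinearMapAt_apply,
    Bundle.Trivialization.coe_linearMapAt_of_mem _ hp'] at h2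
  rw [FiberBundle.extChartAt]
  exact Prod.ext rfl h2

theorem mem_extChartAt_tangent_source (c : M) (p : TangentBundle (𝓡 2) M) :
    p ∈ (extChartAt (𝓡 2).tangent (⟨c, 0⟩ : TangentBundle (𝓡 2) M)).source ↔
      p.1 ∈ (extChartAt (𝓡 2) c).source := by
  rw [extChartAt_source, extChartAt_source]
  exact TangentBundle.mem_chart_source_iff p ⟨c, 0⟩

theorem contMDiffOn_coord (c : M) : ContMDiffOn (𝓡 2).tangent 𝓘(ℝ, Plane × Plane) ∞
    (fun p : TangentBundle (𝓡 2) M => (extChartAt (𝓡 2) c p.1, components c p.1 p.2))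
    {p | p.1 ∈ (extChartAt (𝓡 2) c).source} := by
  have h := contMDiffOn_extChartAt (n := ∞) (I := (𝓡 2).tangent)
    (x := (⟨c, 0⟩ : TangentBundle (𝓡 2) M))
  rw [← extChartAt_source (𝓡 2).tangent] at h
  refine (h.mono fun p hp => (mem_extChartAt_tangent_source c p).2 hp).congr ?_
  intro p hp
  exact (extChartAt_tangent c p hp).symm

theorem extChartAt_tangent_symm (c : M) {y : Plane} (hy : y ∈ chartTarget c) (w : Plane) :
    (extChartAt (𝓡 2).tangent (⟨c, 0⟩ : TangentBundle (𝓡 2) M)).symm (y, w) = ofCoord c y w := by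
  have h := extChartAt_tangent c (ofCoord c y w) (ofCoord_mem_source hy w)
  rw [extChartAt_ofCoord hy, ofCoord_eq, components_tangentVec hy] at h
  rw [← h, PartialEquiv.left_inv]
  · rfl
  · exact (mem_extChartAt_tangent_source c _).2 (ofCoord_mem_source hy w)

theorem contMDiffOn_ofCoord (c : M) : ContMDiffOn 𝓘(ℝ, Plane × Plane) (𝓡 2).tangent ∞
    (fun z : Plane × Plane => ofCoord c z.1 z.2) (chartTarget c ×ˢ Set.univ) := by
  have h := contMDiffOn_extChartAt_symm (n := ∞) (I := (𝓡 2).tangent)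
    (⟨c, 0⟩ : TangentBundle (𝓡 2) M)
  refine (h.mono ?_).congr fun z hz => (extChartAt_tangent_symm c hz.1 z.2).symm
  rintro ⟨y, w⟩ ⟨hy, -⟩
  have h1 := (extChartAt (𝓡 2).tangent (⟨c, 0⟩ : TangentBundle (𝓡 2) M)).map_source
    ((mem_extChartAt_tangent_source c _).2 (ofCoord_mem_source hy w))
  rw [extChartAt_tangent c _ (ofCoord_mem_source hy w), extChartAt_ofCoord hy, ofCoord_eq,
    components_tangentVec hy] at h1
  exact h1

variable (T : GaussianThermostat M)

theorem contDiffOn_gram (c : M) (i j : Fin 2) :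
    ContDiffOn ℝ ∞ (fun y => T.gram c y i j) (chartTarget c) := by
  have hs : ∀ i : Fin 2, ContMDiffOn 𝓘(ℝ, Plane) (𝓡 2).tangent ∞
      (fun y => (⟨(extChartAt (𝓡 2) c).symm y, tangentVec c y (stdVec i)⟩ : TangentBundle (𝓡 2) M))
      (chartTarget c) := by
    intro i
    refine (contMDiffOn_ofCoord c).comp (f := fun y : Plane => (y, stdVec i)) ?_ ?_
    · exact (contDiff_id.prodMk contDiff_const).contMDiff.contMDiffOn
    · intro y hy
      exact ⟨hy, trivial⟩
  have hg := T.g.contMDiff.comp_contMDiffOn (contMDiffOn_extChartAt_symm (n := ∞) (I := 𝓡 2) c)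
  have h := ContMDiffOn.clm_bundle_apply₂ (F₁ := Plane) (F₂ := Plane) (F₃ := ℝ)
    (E₃ := Bundle.Trivial M ℝ) hg (hs i) (hs j)
  rw [← contMDiffOn_iff_contDiffOn]
  intro y hy
  exact (Bundle.contMDiffWithinAt_totalSpace.1 (h y hy)).2

/-- The bilinear form with matrix entries `a i j`. -/
def bilinOf (a : Fin 2 → Fin 2 → ℝ) : Plane →L[ℝ] Plane →L[ℝ] ℝ :=
  ∑ i, ∑ j, a i j • (EuclideanSpace.proj i : Plane →L[ℝ] ℝ).smulRight
    (EuclideanSpace.proj j : Plane →L[ℝ] ℝ)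

theorem bilinOf_apply (a : Fin 2 → Fin 2 → ℝ) (v w : Plane) :
    bilinOf a v w = ∑ i, ∑ j, a i j * v i * w j := by
  simp [bilinOf, mul_assoc]

/-- The vector-valued bilinear map with components `a k i j`. -/
def bilinVecOf (a : Fin 2 → Fin 2 → Fin 2 → ℝ) : Plane →L[ℝ] Plane →L[ℝ] Plane :=
  ∑ k, ∑ i, ∑ j, a k i j • (EuclideanSpace.proj i : Plane →L[ℝ] ℝ).smulRight
    ((EuclideanSpace.proj j : Plane →L[ℝ] ℝ).smulRight (stdVec k))

theorem bilinVecOf_apply (a : Fin 2 → Fin 2 → Fin 2 → ℝ) (v w : Plane) (k : Fin 2) :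
    bilinVecOf a v w k = ∑ i, ∑ j, a k i j * v i * w j := by
  fin_cases k <;> simp [bilinVecOf, stdVec] <;> ring

/-- The metric in the chart at `c`. -/
def chartG (c : M) (y : Plane) : Plane →L[ℝ] Plane →L[ℝ] ℝ := bilinOf fun i j => T.gram c y i j

/-- The Christoffel symbols in the chart at `c`. -/
def chartΓ (c : M) (y : Plane) : Plane →L[ℝ] Plane →L[ℝ] Plane :=
  bilinVecOf fun k i j => T.christoffel c k i j y

/-- The rotation by `π/2` in the chart at `c`. -/
def chartJ (c : M) (y : Plane) : Plane →L[ℝ] Plane :=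
  LinearMap.toContinuousLinearMap
    { toFun := fun w => components c _ (T.J _ (tangentVec c y w))
      map_add' := fun v w => by rw [tangentVec_add, map_add, components_add]
      map_smul' := fun s w => by rw [tangentVec_smul, map_smul, components_smul, RingHom.id_apply] }

theorem chartJ_apply (c : M) (y w : Plane) :
    T.chartJ c y w = components c _ (T.J _ (tangentVec c y w)) := rfl

theorem tangentVec_chartJ {c : M} {y : Plane} (hy : y ∈ chartTarget c) (w : Plane) :
    tangentVec c y (T.chartJ c y w) = T.J _ (tangentVec c y w) := by
  rw [chartJ_apply, tangentVec_components hy]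

theorem gram_eq (c : M) (y : Plane) (i j : Fin 2) : T.gram c y i j =
    T.g.inner _ (tangentVec c y (stdVec i)) (tangentVec c y (stdVec j)) := rfl

theorem chartG_apply (c : M) (y v w : Plane) :
    T.chartG c y v w = T.g.inner _ (tangentVec c y v) (tangentVec c y w) := by
  rw [chartG, bilinOf_apply]
  conv_rhs => rw [LocalSurface.eq_sum_stdVec v, LocalSurface.eq_sum_stdVec w]
  simp only [tangentVec_add, tangentVec_smul, map_add, map_smul, add_apply, smul_apply,
    smul_eq_mul, gram_eq, Fin.sum_univ_two]
  ring

theorem tangentVec_eq_zero {c : M} {y : Plane} (hy : y ∈ chartTarget c) {w : Plane}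
    (h : tangentVec c y w = 0) : w = 0 := by
  rw [← components_tangentVec hy w, h, ← zero_smul ℝ (0 : TangentSpace (𝓡 2) _),
    components_smul, zero_smul]

theorem gram_symm (c : M) (y : Plane) (i j : Fin 2) : T.gram c y i j = T.gram c y j i := by
  rw [gram_eq, gram_eq, T.g.symm]

theorem chartG_pos {c : M} {y : Plane} (hy : y ∈ chartTarget c) {v : Plane} (hv : v ≠ 0) :
    0 < T.chartG c y v v := by
  rw [chartG_apply]
  exact T.g.pos _ _ fun h => hv (tangentVec_eq_zero hy h)

theorem gram_det_pos {c : M} {y : Plane} (hy : y ∈ chartTarget c) : 0 < (T.gram c y).det := by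
  have h00 : 0 < T.gram c y 0 0 := by
    rw [gram_eq, ← chartG_apply]
    exact T.chartG_pos hy (stdVec_ne_zero 0)
  -- the vector orthogonal to the first basis vector
  have h := T.chartG_pos hy (v := T.gram c y 0 0 • stdVec 1 - T.gram c y 0 1 • stdVec 0) (by
    intro h
    have := congrArg (fun v : Plane => v 1) h
    simp [stdVec] at this
    exact h00.ne' this)
  rw [chartG, bilinOf_apply] at h
  simp [Fin.sum_univ_two, stdVec] at h
  rw [T.gram_symm c y 1 0] at h
  rw [Matrix.det_fin_two, T.gram_symm c y 1 0]
  by_contra hneg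
  push Not at hneg
  nlinarith

theorem contDiffOn_partialDeriv {s : Set Plane} (hs : IsOpen s) {f : Plane → ℝ}
    (hf : ContDiffOn ℝ ∞ f s) (i : Fin 2) : ContDiffOn ℝ ∞ (partialDeriv i f) s :=
  (hf.fderiv_of_isOpen hs (by simp)).clm_apply contDiffOn_const

theorem isOpen_chartTarget (c : M) : IsOpen (chartTarget c) := isOpen_extChartAt_target c

theorem gram_inv (c : M) (y : Plane) :
    (T.gram c y)⁻¹ = (T.gram c y).det⁻¹ • !![T.gram c y 1 1, -T.gram c y 0 1;
      -T.gram c y 1 0, T.gram c y 0 0] := by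
  rw [Matrix.inv_def, Matrix.adjugate_fin_two, Ring.inverse_eq_inv']

theorem contDiffOn_gram_inv (c : M) (i j : Fin 2) :
    ContDiffOn ℝ ∞ (fun y => (T.gram c y)⁻¹ i j) (chartTarget c) := by
  have hdet : ContDiffOn ℝ ∞ (fun y => (T.gram c y).det⁻¹) (chartTarget c) := by
    simp only [Matrix.det_fin_two]
    refine ContDiffOn.inv ?_ ?_
    · exact ((T.contDiffOn_gram c 0 0).mul (T.contDiffOn_gram c 1 1)).sub
        ((T.contDiffOn_gram c 0 1).mul (T.contDiffOn_gram c 1 0))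
    · intro y hy
      rw [← Matrix.det_fin_two]
      exact (T.gram_det_pos hy).ne'
  simp only [gram_inv]
  fin_cases i <;> fin_cases j <;> simp
  · exact hdet.mul (T.contDiffOn_gram c 1 1)
  · exact (hdet.mul (T.contDiffOn_gram c 0 1)).neg
  · exact (hdet.mul (T.contDiffOn_gram c 1 0)).neg
  · exact hdet.mul (T.contDiffOn_gram c 0 0)

theorem contDiffOn_christoffel (c : M) (k i j : Fin 2) :
    ContDiffOn ℝ ∞ (T.christoffel c k i j) (chartTarget c) := by
  have hp : ∀ i j l : Fin 2, ContDiffOn ℝ ∞ (partialDeriv i (fun z => T.gram c z j l))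
      (chartTarget c) := fun i j l =>
    contDiffOn_partialDeriv (isOpen_chartTarget c) (T.contDiffOn_gram c j l) i
  refine contDiffOn_const.mul (ContDiffOn.sum fun l _ => ?_)
  exact (T.contDiffOn_gram_inv c k l).mul (((hp i j l).add (hp j i l)).sub (hp l i j))

theorem christoffel_symm (c : M) (k i j : Fin 2) (y : Plane) :
    T.christoffel c k i j y = T.christoffel c k j i y := by
  have h : (fun z => T.gram c z i j) = fun z => T.gram c z j i := funext fun z => T.gram_symm c z i j
  simp only [christoffel, h]
  congr 1
  refine Finset.sum_congr rfl fun l _ => ?_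
  ring

/-- Lowering the index of the Christoffel symbols. -/
theorem sum_gram_christoffel {c : M} {y : Plane} (hy : y ∈ chartTarget c) (l i j : Fin 2) :
    ∑ k, T.gram c y l k * T.christoffel c k i j y =
      (1 / 2) * (partialDeriv i (fun z => T.gram c z j l) y +
        partialDeriv j (fun z => T.gram c z i l) y - partialDeriv l (fun z => T.gram c z i j) y) := by
  have hd := (T.gram_det_pos hy).ne'
  have h : ∀ b : Fin 2 → ℝ, ∑ k, T.gram c y l k * ((1 / 2) * ∑ n, (T.gram c y)⁻¹ k n * b n) =
      (1 / 2) * b l := by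
    intro b
    have h1 : T.gram c y * (T.gram c y)⁻¹ = 1 :=
      Matrix.mul_nonsing_inv _ (isUnit_iff_ne_zero.mpr hd)
    have h2 := congrFun (congrArg (fun A : Matrix (Fin 2) (Fin 2) ℝ => A *ᵥ b) h1) l
    simp only [← Matrix.mulVec_mulVec, Matrix.one_mulVec] at h2
    simp only [Matrix.mulVec, dotProduct] at h2
    rw [← h2, Finset.mul_sum]
    refine Finset.sum_congr rfl fun k _ => ?_
    ring
  exact h fun l => partialDeriv i (fun z => T.gram c z j l) y +
        partialDeriv j (fun z => T.gram c z i l) y - partialDeriv l (fun z => T.gram c z i j) y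

theorem contDiffOn_chartG (c : M) : ContDiffOn ℝ ∞ (T.chartG c) (chartTarget c) := by
  unfold chartG bilinOf
  refine ContDiffOn.sum fun i _ => ContDiffOn.sum fun j _ => ?_
  exact (T.contDiffOn_gram c i j).smul contDiffOn_const

theorem contDiffOn_chartΓ (c : M) : ContDiffOn ℝ ∞ (T.chartΓ c) (chartTarget c) := by
  unfold chartΓ bilinVecOf
  refine ContDiffOn.sum fun k _ => ContDiffOn.sum fun i _ => ContDiffOn.sum fun j _ => ?_
  exact (T.contDiffOn_christoffel c k i j).smul contDiffOn_const

theorem contDiffOn_chartJ (c : M) : ContDiffOn ℝ ∞ (T.chartJ c) (chartTarget c) := by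
  rw [contDiffOn_clm_apply]
  intro w
  have h1 : ContMDiffOn 𝓘(ℝ, Plane) (𝓡 2).tangent ∞ (fun y => ofCoord c y w) (chartTarget c) := by
    refine (contMDiffOn_ofCoord c).comp (f := fun y : Plane => (y, w)) ?_ ?_
    · exact (contDiff_id.prodMk contDiff_const).contMDiff.contMDiffOn
    · intro y hy
      exact ⟨hy, trivial⟩
  have h2 := (contMDiffOn_coord c).comp (T.J_smooth.comp_contMDiffOn h1)
    fun y hy => (extChartAt (𝓡 2) c).map_target hy
  exact (contMDiffOn_iff_contDiffOn.1 h2).snd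

theorem fderiv_chartG {c : M} {y : Plane} (hy : y ∈ chartTarget c) (v : Plane) :
    fderiv ℝ (T.chartG c) y v = bilinOf fun i j => fderiv ℝ (fun z => T.gram c z i j) y v := by
  have hij : ∀ i j, HasFDerivAt (fun z => T.gram c z i j) (fderiv ℝ (fun z => T.gram c z i j) y) y :=
    fun i j => (((T.contDiffOn_gram c i j).contDiffAt
      ((isOpen_chartTarget c).mem_nhds hy)).differentiableAt (by simp)).hasFDerivAt
  have h : HasFDerivAt (T.chartG c) (∑ i, ∑ j, (fderiv ℝ (fun z => T.gram c z i j) y).smulRight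
      ((EuclideanSpace.proj i : Plane →L[ℝ] ℝ).smulRight (EuclideanSpace.proj j : Plane →L[ℝ] ℝ)))
      y := by
    unfold chartG bilinOf
    exact HasFDerivAt.fun_sum fun i _ => HasFDerivAt.fun_sum fun j _ => (hij i j).smul_const _
  rw [h.fderiv]
  simp [bilinOf]

theorem fderiv_eq_partialDeriv (f : Plane → ℝ) (y v : Plane) :
    fderiv ℝ f y v = v 0 * partialDeriv 0 f y + v 1 * partialDeriv 1 f y := by
  conv_lhs => rw [LocalSurface.eq_sum_stdVec v]
  rw [map_add, map_smul, map_smul]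
  rfl

/-- The geometry of the thermostat in the chart at `c`. -/
def localSurface (c : M) : LocalSurface (chartTarget c) where
  g := T.chartG c
  Γ := T.chartΓ c
  J := T.chartJ c
  isOpen := isOpen_chartTarget c
  g_smooth := T.contDiffOn_chartG c
  Γ_smooth := T.contDiffOn_chartΓ c
  J_smooth := T.contDiffOn_chartJ c
  g_symm y _ v w := by rw [chartG_apply, chartG_apply, T.g.symm]
  g_pos y hy v hv := T.chartG_pos hy hv
  Γ_symm y _ v w := by
    ext k
    simp only [chartΓ, bilinVecOf_apply, Fin.sum_univ_two]
    rw [T.christoffel_symm c k 1 0]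
    ring
  compat y hy v w z := by
    have h := T.sum_gram_christoffel hy
    have e : ∀ l i j, partialDeriv l (fun z => T.gram c z j i) y =
        partialDeriv l (fun z => T.gram c z i j) y := by
      intro l i j
      have : (fun z => T.gram c z j i) = fun z => T.gram c z i j :=
        funext fun z => T.gram_symm c z j i
      rw [this]
    rw [T.fderiv_chartG hy]
    simp only [fderiv_eq_partialDeriv]
    simp only [chartG, bilinOf_apply, chartΓ, bilinVecOf_apply, Fin.sum_univ_two]
    have k000 := h 0 0 0
    have k001 := h 0 0 1
    have k011 := h 0 1 1
    have k100 := h 1 0 0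
    have k101 := h 1 0 1
    have k111 := h 1 1 1
    simp only [Fin.sum_univ_two, e _ 0 1, T.christoffel_symm c _ 1 0, T.gram_symm c y 1 0] at *
    linear_combination -(v 0 * (z 0 * w 0 + w 0 * z 0)) * k000 -
      (v 0 * (z 0 * w 1 + w 0 * z 1) + v 1 * (z 0 * w 0 + w 0 * z 0)) * k001 -
      (v 1 * (z 0 * w 1 + w 0 * z 1)) * k011 - (v 0 * (z 1 * w 0 + w 1 * z 0)) * k100 -
      (v 0 * (z 1 * w 1 + w 1 * z 1) + v 1 * (z 1 * w 0 + w 1 * z 0)) * k101 -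
      (v 1 * (z 1 * w 1 + w 1 * z 1)) * k111
  J_sq y hy v := by
    rw [chartJ_apply, tangentVec_chartJ T hy, T.J_sq, ← neg_one_smul ℝ, components_smul,
      components_tangentVec hy, neg_one_smul]
  J_isometry y hy v w := by
    rw [chartG_apply, chartG_apply, tangentVec_chartJ T hy, tangentVec_chartJ T hy, T.J_isometry]

end GaussianThermostat

namespace LocalSurface

variable {Ω : Set Plane} (S : LocalSurface Ω)

/-- The vertical derivative of a function which is constant on rays is constant on rays. -/
theorem dV_smul {U : Plane × Plane → ℂ} (hU : ContDiffOn ℝ ∞ U (domain Ω))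
    (hhom : ∀ y ∈ Ω, ∀ w, w ≠ 0 → ∀ s : ℝ, 0 < s → U (y, s • w) = U (y, w))
    {z : Plane × Plane} (hz : z ∈ domain Ω) {s : ℝ} (hs : 0 < s) :
    S.dV U (z.1, s • z.2) = S.dV U z := by
  have hz' : (z.1, s • z.2) ∈ domain Ω := ⟨hz.1, smul_ne_zero hs.ne' hz.2⟩
  let D : Plane × Plane →L[ℝ] Plane × Plane :=
    (ContinuousLinearMap.fst ℝ Plane Plane).prod (s • ContinuousLinearMap.snd ℝ Plane Plane)
  have h1 : HasFDerivAt (U ∘ D) ((fderiv ℝ U (z.1, s • z.2)).comp D) z :=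
    HasFDerivAt.comp z
      ((S.contDiffAt_of_mem hU hz').differentiableAt (by simp)).hasFDerivAt D.hasFDerivAt
  have h2 : U ∘ D =ᶠ[nhds z] U := by
    filter_upwards [S.isOpen_domain.mem_nhds hz] with x hx
    exact hhom x.1 hx.1 x.2 hx.2 s hs
  have h3 := (h1.congr_of_eventuallyEq h2.symm).fderiv
  rw [dV, dV, h3, fieldV, fieldV]
  simp [D]

/-- The Euler-Lagrange equation of the geodesics. -/
theorem g_Γ_self {y : Plane} (hy : y ∈ Ω) (w z : Plane) :
    S.g y (S.Γ y w w) z = fderiv ℝ S.g y w w z - (1 / 2) * fderiv ℝ S.g y z w w := by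
  rw [S.compat y hy, S.compat y hy, S.Γ_symm y hy z w, S.g_symm y hy w (S.Γ y w z)]
  ring

/-- The transformation law of the geodesic acceleration under a local isometry `ψ`. -/
theorem Γ_transform {Ω' : Set Plane} (S' : LocalSurface Ω') {ψ : Plane → Plane} {y : Plane}
    (hy : y ∈ Ω) (hy' : ψ y ∈ Ω') (hψ : ContDiffAt ℝ ∞ ψ y)
    (hiso : ∀ᶠ x in nhds y, ∀ v w, S.g x v w = S'.g (ψ x) (fderiv ℝ ψ x v) (fderiv ℝ ψ x w))
    (hsurj : Function.Surjective (fderiv ℝ ψ y)) (w : Plane) :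
    fderiv ℝ (fderiv ℝ ψ) y w w - fderiv ℝ ψ y (S.Γ y w w) =
      -S'.Γ (ψ y) (fderiv ℝ ψ y w) (fderiv ℝ ψ y w) := by
  have hψ1 := (hψ.differentiableAt (by simp)).hasFDerivAt
  have hψ2 : HasFDerivAt (fderiv ℝ ψ) (fderiv ℝ (fderiv ℝ ψ) y) y :=
    ((hψ.fderiv_right (m := 1) (by rw [one_add_one_eq_two]; exact two_le_infty)).differentiableAt
      (by simp)).hasFDerivAt
  have hsymm : ∀ a b, fderiv ℝ (fderiv ℝ ψ) y a b = fderiv ℝ (fderiv ℝ ψ) y b a := fun a b =>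
    hψ.isSymmSndFDerivAt (by simpa using two_le_infty) a b
  have hd : ∀ v a b, fderiv ℝ S.g y v a b =
      fderiv ℝ S'.g (ψ y) (fderiv ℝ ψ y v) (fderiv ℝ ψ y a) (fderiv ℝ ψ y b) +
      S'.g (ψ y) (fderiv ℝ (fderiv ℝ ψ) y v a) (fderiv ℝ ψ y b) +
      S'.g (ψ y) (fderiv ℝ ψ y a) (fderiv ℝ (fderiv ℝ ψ) y v b) := by
    intro v a b
    have h1 := ((S.hasFDerivAt_g hy).clm_apply (hasFDerivAt_const a y)).clm_apply
      (hasFDerivAt_const b y)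
    have h2 := (((S'.hasFDerivAt_g hy').comp y hψ1).clm_apply
      (hψ2.clm_apply (hasFDerivAt_const a y))).clm_apply (hψ2.clm_apply (hasFDerivAt_const b y))
    have h3 : (fun x => S.g x a b) =ᶠ[nhds y]
        fun x => (S'.g ∘ ψ) x (fderiv ℝ ψ x a) (fderiv ℝ ψ x b) := by
      filter_upwards [hiso] with x hx using hx a b
    have := congrArg (fun L => L v) (h1.unique (h2.congr_of_eventuallyEq h3))
    simp at this
    rw [this]
    ring
  set w' := fderiv ℝ ψ y w
  have key : ∀ z, S'.g (ψ y) (fderiv ℝ ψ y (S.Γ y w w) - fderiv ℝ (fderiv ℝ ψ) y w w -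
      S'.Γ (ψ y) w' w') (fderiv ℝ ψ y z) = 0 := by
    intro z
    have h1 := S.g_Γ_self hy w z
    have h2 := S'.g_Γ_self hy' w' (fderiv ℝ ψ y z)
    rw [hiso.self_of_nhds, hd, hd, hsymm z w] at h1
    simp only [map_sub, sub_apply]
    have h3 := S'.g_symm (ψ y) hy' w' (fderiv ℝ (fderiv ℝ ψ) y w z)
    change _ = _ + _ + S'.g (ψ y) w' _ - 1 / 2 * (_ + _ + S'.g (ψ y) w' _) at h1
    rw [h3] at h1
    linarith
  obtain ⟨z, hz⟩ := hsurj (fderiv ℝ ψ y (S.Γ y w w) - fderiv ℝ (fderiv ℝ ψ) y w w -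
      S'.Γ (ψ y) w' w')
  have h := key z
  rw [hz] at h
  have h0 : fderiv ℝ ψ y (S.Γ y w w) - fderiv ℝ (fderiv ℝ ψ) y w w - S'.Γ (ψ y) w' w' = 0 := by
    by_contra hne
    exact (S'.g_pos _ hy' _ hne).ne' h
  rw [sub_eq_zero] at h0
  rw [← h0]
  abel

end LocalSurface

/-! ### Functions on the unit sphere bundle in a chart -/

namespace GaussianThermostat

open LocalSurface

variable {M : Type*} [TopologicalSpace M] [ChartedSpace Plane M] [IsManifold (𝓡 2) ∞ M]
variable (T : GaussianThermostat M)

/-- The expression of a function on `SM`, extended to be constant on rays, in the chart at `c`. -/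
def coordFun (c : M) (u : T.SM → ℂ) (z : Plane × Plane) : ℂ := T.ext u (ofCoord c z.1 z.2)

theorem ext_of_ne {u : T.SM → ℂ} {p : TangentBundle (𝓡 2) M} (hp : p.2 ≠ 0) :
    T.ext u p = u (T.normalize p.1 p.2 hp) := dif_pos hp

theorem vec_ne_zero (p : T.SM) : p.vec ≠ 0 := by
  intro h
  have h1 : T.g.inner p.base p.vec p.vec = 1 := p.2
  rw [h] at h1
  simp at h1

theorem normalize_self (p : T.SM) (hp : p.1.2 ≠ 0) : T.normalize p.1.1 p.1.2 hp = p := by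
  apply Subtype.ext
  have h1 : T.g.inner p.1.1 p.1.2 p.1.2 = 1 := p.2
  change (⟨p.1.1, (√(T.g.inner p.1.1 p.1.2 p.1.2))⁻¹ • p.1.2⟩ : TangentBundle (𝓡 2) M) = p.1
  rw [h1]
  simp

theorem ext_coe (u : T.SM → ℂ) (p : T.SM) : T.ext u p.1 = u p := by
  exact (T.ext_of_ne (T.vec_ne_zero p)).trans (congrArg u (T.normalize_self p _))

theorem ext_smul (u : T.SM → ℂ) (x : M) (v : TangentSpace (𝓡 2) x) {s : ℝ} (hs : 0 < s) :
    T.ext u ⟨x, s • v⟩ = T.ext u ⟨x, v⟩ := by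
  by_cases hv : v = 0
  · rw [hv, smul_zero]
  have hsv : s • v ≠ 0 := smul_ne_zero hs.ne' hv
  rw [T.ext_of_ne (p := ⟨x, s • v⟩) hsv, T.ext_of_ne (p := ⟨x, v⟩) hv]
  congr 1
  apply Subtype.ext
  change (⟨x, (√(T.g.inner x (s • v) (s • v)))⁻¹ • s • v⟩ : TangentBundle (𝓡 2) M) =
    ⟨x, (√(T.g.inner x v v))⁻¹ • v⟩
  congr 1
  simp only [map_smul, smul_apply, smul_eq_mul]
  rw [← mul_assoc, Real.sqrt_mul (by positivity), Real.sqrt_mul_self hs.le, smul_smul]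
  congr 1
  field_simp

theorem tangentVec_ne_zero {c : M} {z : Plane × Plane} (hz : z ∈ domain (chartTarget c)) :
    tangentVec c z.1 z.2 ≠ 0 := fun h => hz.2 (tangentVec_eq_zero hz.1 h)

/-- The point of `SM` in the direction with coordinates `z = (y, w)`. -/
def ray {c : M} {z : Plane × Plane} (hz : z ∈ domain (chartTarget c)) : T.SM :=
  T.normalize _ (tangentVec c z.1 z.2) (tangentVec_ne_zero hz)

theorem coordFun_eq {c : M} {z : Plane × Plane} (hz : z ∈ domain (chartTarget c)) (u : T.SM → ℂ) :
    T.coordFun c u z = u (T.ray hz) := T.ext_of_ne (tangentVec_ne_zero hz)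

theorem ray_val {c : M} {z : Plane × Plane} (hz : z ∈ domain (chartTarget c)) :
    (T.ray hz).1 = ofCoord c z.1 (((T.localSurface c).norm z)⁻¹ • z.2) := by
  rw [ofCoord_eq, tangentVec_smul, LocalSurface.norm]
  change _ = (⟨_, (√(T.chartG c z.1 z.2 z.2))⁻¹ • _⟩ : TangentBundle (𝓡 2) M)
  rw [chartG_apply]
  rfl

/-- The coordinates of a point of `SM` in the chart at `c`. -/
def coord (c : M) (p : T.SM) : Plane × Plane :=
  (extChartAt (𝓡 2) c p.base, components c p.base p.vec)

theorem ofCoord_coord {c : M} {p : T.SM} (hp : p.base ∈ (extChartAt (𝓡 2) c).source) :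
    ofCoord c (T.coord c p).1 (T.coord c p).2 = p.1 := ofCoord_components p.1 hp

theorem coord_eq_of_val {c : M} {p : T.SM} {y w : Plane} (hy : y ∈ chartTarget c)
    (h : p.1 = ofCoord c y w) : T.coord c p = (y, w) := by
  have h1 : T.coord c p = (extChartAt (𝓡 2) c p.1.1, components c p.1.1 p.1.2) := rfl
  rw [h1, h, extChartAt_ofCoord hy, ofCoord_eq, components_tangentVec hy]

theorem coord_ray {c : M} {z : Plane × Plane} (hz : z ∈ domain (chartTarget c)) :
    T.coord c (T.ray hz) = (z.1, ((T.localSurface c).norm z)⁻¹ • z.2) :=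
  T.coord_eq_of_val hz.1 (T.ray_val hz)

theorem ray_base {c : M} {z : Plane × Plane} (hz : z ∈ domain (chartTarget c)) :
    (T.ray hz).base ∈ (extChartAt (𝓡 2) c).source := (extChartAt (𝓡 2) c).map_target hz.1

theorem coord_mem {c : M} {p : T.SM} (hp : p.base ∈ (extChartAt (𝓡 2) c).source) :
    T.coord c p ∈ domain (chartTarget c) := by
  refine ⟨(extChartAt (𝓡 2) c).map_source hp, fun h => T.vec_ne_zero p ?_⟩
  have h1 := T.ofCoord_coord hp
  rw [show (T.coord c p).2 = 0 from h, ofCoord_eq, ← zero_smul ℝ (0 : Plane), tangentVec_smul,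
    zero_smul] at h1
  have h2 : p.1.2 = 0 := by rw [← h1]
  exact h2

theorem coordFun_coord {c : M} {p : T.SM} (hp : p.base ∈ (extChartAt (𝓡 2) c).source)
    (u : T.SM → ℂ) : T.coordFun c u (T.coord c p) = u p := by
  rw [coordFun, T.ofCoord_coord hp, ext_coe]

theorem normSq_coord {c : M} {p : T.SM} (hp : p.base ∈ (extChartAt (𝓡 2) c).source) :
    (T.localSurface c).g (T.coord c p).1 (T.coord c p).2 (T.coord c p).2 = 1 := by
  have h : (T.localSurface c).g (T.coord c p).1 (T.coord c p).2 (T.coord c p).2 =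
      T.g.inner (ofCoord c (T.coord c p).1 (T.coord c p).2).1
        (ofCoord c (T.coord c p).1 (T.coord c p).2).2
        (ofCoord c (T.coord c p).1 (T.coord c p).2).2 := T.chartG_apply _ _ _ _
  rw [h, T.ofCoord_coord hp]
  exact p.2

theorem norm_coord {c : M} {p : T.SM} (hp : p.base ∈ (extChartAt (𝓡 2) c).source) :
    (T.localSurface c).norm (T.coord c p) = 1 := by
  rw [LocalSurface.norm, T.normSq_coord hp, Real.sqrt_one]

theorem coordFun_smul (c : M) (u : T.SM → ℂ) (y w : Plane) {s : ℝ} (hs : 0 < s) :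
    T.coordFun c u (y, s • w) = T.coordFun c u (y, w) := by
  rw [coordFun, coordFun, ofCoord_eq, tangentVec_smul, ext_smul _ _ _ _ hs]
  rfl

theorem isSmooth_iff (u : T.SM → ℂ) :
    T.IsSmooth u ↔ ∀ c, ContDiffOn ℝ ∞ (T.coordFun c u) (domain (chartTarget c)) := by
  constructor
  · intro h c
    rw [← contMDiffOn_iff_contDiffOn]
    refine ContMDiffOn.comp (t := {p : TangentBundle (𝓡 2) M | p.2 ≠ 0}) h ((contMDiffOn_ofCoord c).mono ?_) ?_
    · exact fun z hz => ⟨hz.1, trivial⟩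
    · exact fun z hz => tangentVec_ne_zero hz
  · intro h p hp
    have h1 := contMDiffOn_iff_contDiffOn.2 (h p.1)
    have h2 : ContMDiffOn (𝓡 2).tangent 𝓘(ℝ, Plane × Plane) ∞
        (fun q : TangentBundle (𝓡 2) M => (extChartAt (𝓡 2) p.1 q.1, components p.1 q.1 q.2))
        ({q : TangentBundle (𝓡 2) M | q.1 ∈ (extChartAt (𝓡 2) p.1).source} ∩ {q | q.2 ≠ 0}) :=
      (contMDiffOn_coord p.1).mono Set.inter_subset_left
    have hmaps : Set.MapsTo (fun q : TangentBundle (𝓡 2) M =>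
        (extChartAt (𝓡 2) p.1 q.1, components p.1 q.1 q.2))
        ({q : TangentBundle (𝓡 2) M | q.1 ∈ (extChartAt (𝓡 2) p.1).source} ∩ {q | q.2 ≠ 0})
        (domain (chartTarget p.1)) := by
      rintro q ⟨hq1, hq2⟩
      refine ⟨(extChartAt (𝓡 2) p.1).map_source hq1, fun h0 => hq2 ?_⟩
      have h3 := ofCoord_components q hq1
      rw [show components p.1 q.1 q.2 = 0 from h0, ofCoord_eq, ← zero_smul ℝ (0 : Plane),
        tangentVec_smul, zero_smul] at h3
      rw [← h3]
    have h3 := (h1.comp h2 hmaps).congr (f₁ := T.ext u) (by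
      rintro q ⟨hq1, hq2⟩
      change _ = T.ext u (ofCoord _ _ _)
      rw [ofCoord_components q hq1])
    have hopen : {q : TangentBundle (𝓡 2) M | q.1 ∈ (extChartAt (𝓡 2) p.1).source} ∈ nhds p := by
      refine IsOpen.mem_nhds ?_ (mem_extChartAt_source p.1)
      exact (isOpen_extChartAt_source p.1).preimage
        (FiberBundle.continuous_proj Plane (TangentSpace (𝓡 2) : M → Type _))
    have h4 := h3 p ⟨mem_extChartAt_source p.1, hp⟩
    rw [Set.inter_comm] at h4
    exact (contMDiffWithinAt_inter hopen).1 h4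

section Derivatives

variable {u : T.SM → ℂ} (hu : T.IsSmooth u)

theorem rot_val {c : M} {p : T.SM} (hp : p.base ∈ (extChartAt (𝓡 2) c).source) (t : ℝ) :
    (T.rot t p).1 = ofCoord c (T.coord c p).1
      (Real.cos t • (T.coord c p).2 +
        Real.sin t • T.chartJ c (T.coord c p).1 (T.coord c p).2) := by
  have key : ∀ q q' : TangentBundle (𝓡 2) M, q = q' →
      (⟨q.1, Real.cos t • q.2 + Real.sin t • T.J q.1 q.2⟩ : TangentBundle (𝓡 2) M) =
      ⟨q'.1, Real.cos t • q'.2 + Real.sin t • T.J q'.1 q'.2⟩ := by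
    rintro q _ rfl
    rfl
  have h := key _ _ (T.ofCoord_coord hp).symm
  refine Eq.trans h ?_
  rw [ofCoord_eq c _ (_ + _), tangentVec_add, tangentVec_smul, tangentVec_smul,
    tangentVec_chartJ T (T.coord_mem hp).1]
  rfl

theorem coord_rot {c : M} {p : T.SM} (hp : p.base ∈ (extChartAt (𝓡 2) c).source) (t : ℝ) :
    T.coord c (T.rot t p) = ((T.coord c p).1, Real.cos t • (T.coord c p).2 +
        Real.sin t • T.chartJ c (T.coord c p).1 (T.coord c p).2) :=
  T.coord_eq_of_val (T.coord_mem hp).1 (T.rot_val hp t)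

include hu

theorem contDiffOn_coordFun (c : M) :
    ContDiffOn ℝ ∞ (T.coordFun c u) (domain (chartTarget c)) := (T.isSmooth_iff u).1 hu c

theorem hasDerivAt_rot_zero {c : M} {p : T.SM} (hp : p.base ∈ (extChartAt (𝓡 2) c).source) :
    HasDerivAt (fun t => u (T.rot t p))
      ((T.localSurface c).dV (T.coordFun c u) (T.coord c p)) 0 := by
  have h1 : (fun t => u (T.rot t p)) = fun t => T.coordFun c u ((T.coord c p).1,
      Real.cos t • (T.coord c p).2 +
        Real.sin t • T.chartJ c (T.coord c p).1 (T.coord c p).2) := by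
    funext t
    rw [← T.coord_rot hp t, coordFun_coord]
    exact hp
  rw [h1]
  have hz := T.coord_mem hp
  have hU := (((T.localSurface c).contDiffAt_of_mem (T.contDiffOn_coordFun hu c)
    hz).differentiableAt (by simp)).hasFDerivAt
  have hcurve : HasDerivAt (fun t : ℝ => ((T.coord c p).1, Real.cos t • (T.coord c p).2 +
        Real.sin t • T.chartJ c (T.coord c p).1 (T.coord c p).2))
      ((T.localSurface c).fieldV (T.coord c p)) 0 := by
    have := (hasDerivAt_const (0 : ℝ) (T.coord c p).1).prodMk
      (((Real.hasDerivAt_cos 0).smul_const (T.coord c p).2).add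
        ((Real.hasDerivAt_sin 0).smul_const (T.chartJ c (T.coord c p).1 (T.coord c p).2)))
    refine this.congr_deriv ?_
    rw [show (T.localSurface c).fieldV (T.coord c p) =
      (0, T.chartJ c (T.coord c p).1 (T.coord c p).2) from rfl]
    simp
  have hU' : HasFDerivAt (T.coordFun c u) (fderiv ℝ (T.coordFun c u) (T.coord c p))
      ((T.coord c p).1, Real.cos 0 • (T.coord c p).2 +
        Real.sin 0 • T.chartJ c (T.coord c p).1 (T.coord c p).2) := by
    simpa using hU
  exact hU'.comp_hasDerivAt 0 hcurve

theorem V_eq {c : M} {p : T.SM} (hp : p.base ∈ (extChartAt (𝓡 2) c).source) :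
    T.V u p = (T.localSurface c).dV (T.coordFun c u) (T.coord c p) :=
  (T.hasDerivAt_rot_zero hu hp).deriv

theorem coordFun_V {c : M} {z : Plane × Plane} (hz : z ∈ domain (chartTarget c)) :
    T.coordFun c (T.V u) z = (T.localSurface c).dV (T.coordFun c u) z := by
  rw [T.coordFun_eq hz, T.V_eq hu (T.ray_base hz), T.coord_ray,
    (T.localSurface c).dV_smul (T.contDiffOn_coordFun hu c) _ hz
      (inv_pos.2 ((T.localSurface c).norm_pos hz))]
  exact fun y _ w _ s hs => T.coordFun_smul c u y w hs

theorem isSmooth_V : T.IsSmooth (T.V u) := (T.isSmooth_iff _).2 fun c =>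
  ((T.localSurface c).contDiffOn_dV (T.contDiffOn_coordFun hu c)).congr
    fun _ hz => T.coordFun_V hu hz

theorem X_eq_base (p : T.SM) :
    T.X u p = (T.localSurface p.base).dX (T.coordFun p.base u) (T.coord p.base p) := by
  rw [dX, X]
  congr 1
  refine Prod.ext rfl ?_
  ext k
  simp [fieldX, localSurface, chartΓ, geodesicAcceleration, bilinVecOf_apply, coord]

end Derivatives

section ChartChange

variable {c c' : M}

/-- The transition map from the chart at `c` to the chart at `c'`. -/
def transition (c c' : M) (y : Plane) : Plane :=
  extChartAt (𝓡 2) c' ((extChartAt (𝓡 2) c).symm y)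

/-- The points of the chart at `c` which are covered by the chart at `c'`. -/
def overlap (c c' : M) : Set Plane :=
  chartTarget c ∩ (extChartAt (𝓡 2) c).symm ⁻¹' (extChartAt (𝓡 2) c').source

theorem isOpen_overlap (c c' : M) : IsOpen (overlap c c') :=
  (continuousOn_extChartAt_symm c).isOpen_inter_preimage (isOpen_chartTarget c)
    (isOpen_extChartAt_source c')

theorem contDiffOn_transition (c c' : M) : ContDiffOn ℝ ∞ (transition c c') (overlap c c') := by
  have h1 : ContMDiffOn (𝓡 2) 𝓘(ℝ, Plane) ∞ (extChartAt (𝓡 2) c')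
      (extChartAt (𝓡 2) c').source := by
    rw [extChartAt_source]
    exact contMDiffOn_extChartAt
  exact contMDiffOn_iff_contDiffOn.1
    (h1.comp ((contMDiffOn_extChartAt_symm c).mono Set.inter_subset_left) fun y hy => hy.2)

theorem transition_mem {y : Plane} (hy : y ∈ overlap c c') : transition c c' y ∈ chartTarget c' :=
  (extChartAt (𝓡 2) c').map_source hy.2

theorem components_tangentVec_overlap {y : Plane} (hy : y ∈ overlap c c') (w : Plane) :
    components c' ((extChartAt (𝓡 2) c).symm y) (tangentVec c y w) =
      fderiv ℝ (transition c c') y w := by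
  have h2 : y ∈ chartTarget c := hy.1
  have h1 : (extChartAt (𝓡 2) c).symm y ∈ (chartAt Plane c').source := by
    have := hy.2
    rwa [Set.mem_preimage, extChartAt_source] at this
  have hd1 := mdifferentiableAt_extChartAt (I := 𝓡 2) h1
  have hd2 := mdifferentiableWithinAt_extChartAt_symm (I := 𝓡 2) h2
  rw [ModelWithCorners.range_eq_univ, mdifferentiableWithinAt_univ] at hd2
  have h := mfderiv_comp y hd1 hd2
  have h3 : fderiv ℝ (transition c c') y = mfderiv 𝓘(ℝ, Plane) 𝓘(ℝ, Plane)
    (extChartAt (𝓡 2) c' ∘ (extChartAt (𝓡 2) c).symm) y := mfderiv_eq_fderiv.symm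
  rw [h3, h]
  rfl

theorem ofCoord_transition {y : Plane} (hy : y ∈ overlap c c') (w : Plane) :
    ofCoord c' (transition c c' y) (fderiv ℝ (transition c c') y w) = ofCoord c y w := by
  rw [← components_tangentVec_overlap hy]
  exact ofCoord_components (ofCoord c y w) hy.2

theorem chartG_transition {y : Plane} (hy : y ∈ overlap c c') (v w : Plane) :
    T.chartG c y v w = T.chartG c' (transition c c' y) (fderiv ℝ (transition c c') y v)
      (fderiv ℝ (transition c c') y w) := by
  have key : ∀ (x x' : M) (h : x = x') (a b : TangentSpace (𝓡 2) x)
      (a' b' : TangentSpace (𝓡 2) x'), (⟨x, a⟩ : TangentBundle (𝓡 2) M) = ⟨x', a'⟩ →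
      (⟨x, b⟩ : TangentBundle (𝓡 2) M) = ⟨x', b'⟩ → T.g.inner x a b = T.g.inner x' a' b' := by
    rintro x _ rfl a b a' b' h1 h2
    obtain rfl := eq_of_heq (Bundle.TotalSpace.mk.inj h1).2
    obtain rfl := eq_of_heq (Bundle.TotalSpace.mk.inj h2).2
    rfl
  rw [chartG_apply, chartG_apply]
  refine key _ _ ?_ _ _ _ _ (ofCoord_transition hy v).symm (ofCoord_transition hy w).symm
  exact ((extChartAt (𝓡 2) c').left_inv hy.2).symm

include T in
theorem fderiv_transition_surjective {y : Plane} (hy : y ∈ overlap c c') :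
    Function.Surjective (fderiv ℝ (transition c c') y) := by
  have hinj : Function.Injective (fderiv ℝ (transition c c') y).toLinearMap := by
    rw [injective_iff_map_eq_zero]
    intro w hw
    by_contra hne
    have h := T.chartG_transition hy w w
    have h2 := T.chartG_pos hy.1 hne
    rw [h, show fderiv ℝ (transition c c') y w = 0 from hw] at h2
    simp at h2
  exact LinearMap.injective_iff_surjective.1 hinj

theorem coordFun_transition (u : T.SM → ℂ) {z : Plane × Plane} (hy : z.1 ∈ overlap c c') :
    T.coordFun c u z = T.coordFun c' u
      (transition c c' z.1, fderiv ℝ (transition c c') z.1 z.2) := by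
  rw [coordFun, coordFun, ofCoord_transition hy]

/-- The geodesic spray does not depend on the chart. -/
theorem dX_transition {u : T.SM → ℂ} (hu : T.IsSmooth u) {z : Plane × Plane}
    (hy : z.1 ∈ overlap c c') (hz : z.2 ≠ 0) :
    (T.localSurface c).dX (T.coordFun c u) z = (T.localSurface c').dX (T.coordFun c' u)
      (transition c c' z.1, fderiv ℝ (transition c c') z.1 z.2) := by
  have hψ := (contDiffOn_transition c c').contDiffAt ((isOpen_overlap c c').mem_nhds hy)
  have hψ1 := (hψ.differentiableAt (by simp)).hasFDerivAt
  have hψ2 : HasFDerivAt (fderiv ℝ (transition c c')) _ z.1 :=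
    ((hψ.fderiv_right (m := 1) (by rw [one_add_one_eq_two]; exact two_le_infty)).differentiableAt
      (by simp)).hasFDerivAt
  have h1 : HasFDerivAt (fun z : Plane × Plane => z.1) (ContinuousLinearMap.fst ℝ Plane Plane)
    z := hasFDerivAt_fst
  have h2 : HasFDerivAt (fun z : Plane × Plane => z.2) (ContinuousLinearMap.snd ℝ Plane Plane)
    z := hasFDerivAt_snd
  have hlift := (hψ1.comp z h1).prodMk ((hψ2.comp z h1).clm_apply h2)
  have hne : fderiv ℝ (transition c c') z.1 z.2 ≠ 0 := by
    intro h
    have h3 := T.chartG_pos hy.1 hz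
    rw [T.chartG_transition hy, h] at h3
    simp at h3
  have hU' := (((T.localSurface c').contDiffAt_of_mem (T.contDiffOn_coordFun hu c')
    (z := (transition c c' z.1, fderiv ℝ (transition c c') z.1 z.2))
    ⟨transition_mem hy, hne⟩).differentiableAt (by simp)).hasFDerivAt
  have hcomp := hU'.comp z hlift
  have heq : T.coordFun c u =ᶠ[nhds z] T.coordFun c' u ∘ fun z =>
      ((transition c c' ∘ fun z => z.1) z, (fderiv ℝ (transition c c') ∘ fun z => z.1) z z.2) := by
    filter_upwards [((isOpen_overlap c c').preimage continuous_fst).mem_nhds hy] with x hx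
    exact T.coordFun_transition u hx
  rw [dX, (hcomp.congr_of_eventuallyEq heq).fderiv, dX, ContinuousLinearMap.comp_apply]
  congr 1
  have hΓ := (T.localSurface c).Γ_transform (T.localSurface c') hy.1 (transition_mem hy) hψ
    (by
      filter_upwards [(isOpen_overlap c c').mem_nhds hy] with x hx v w
      exact T.chartG_transition hx v w) (T.fderiv_transition_surjective hy) z.2
  refine Prod.ext ?_ ?_
  · simp [fieldX]
  · simp only [fieldX]
    rw [← hΓ]
    simp
    abel

theorem X_eq {u : T.SM → ℂ} (hu : T.IsSmooth u) {p : T.SM}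
    (hp : p.base ∈ (extChartAt (𝓡 2) c).source) :
    T.X u p = (T.localSurface c).dX (T.coordFun c u) (T.coord c p) := by
  rw [T.X_eq_base hu]
  have hb := mem_extChartAt_source (I := 𝓡 2) p.base
  have hy : (T.coord p.base p).1 ∈ overlap p.base c := by
    refine ⟨(T.coord_mem hb).1, ?_⟩
    rw [Set.mem_preimage, coord, (extChartAt (𝓡 2) p.base).left_inv hb]
    exact hp
  rw [T.dX_transition hu hy (T.coord_mem hb).2]
  congr 1
  refine (T.coord_eq_of_val (transition_mem hy) ?_).symm
  rw [ofCoord_transition hy, T.ofCoord_coord hb]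

end ChartChange

section Frame

variable {c : M} {u : T.SM → ℂ} (hu : T.IsSmooth u) {z : Plane × Plane}
  (hz : z ∈ domain (chartTarget c))

include hu

theorem coordFun_X (hz : z ∈ domain (chartTarget c)) : T.coordFun c (T.X u) z =
    ((T.localSurface c).norm z)⁻¹ • (T.localSurface c).dX (T.coordFun c u) z := by
  rw [T.coordFun_eq hz, T.X_eq hu (T.ray_base hz), T.coord_ray,
    (T.localSurface c).dX_smul (T.contDiffOn_coordFun hu c) _ hz
      (inv_pos.2 ((T.localSurface c).norm_pos hz))]
  exact fun y _ w _ s hs => T.coordFun_smul c u y w hs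

theorem isSmooth_X : T.IsSmooth (T.X u) := (T.isSmooth_iff _).2 fun c =>
  ((T.localSurface c).contDiffOn_norm_inv_smul
    ((T.localSurface c).contDiffOn_dX (T.contDiffOn_coordFun hu c))).congr
    fun _ hz => T.coordFun_X hu hz

omit hu in
theorem fderiv_coordFun_congr {f : T.SM → ℂ} {F : Plane × Plane → ℂ}
    (h : ∀ z ∈ domain (chartTarget c), T.coordFun c f z = F z)
    (hz : z ∈ domain (chartTarget c)) : fderiv ℝ (T.coordFun c f) z = fderiv ℝ F z := by
  apply Filter.EventuallyEq.fderiv_eq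
  filter_upwards [(T.localSurface c).isOpen_domain.mem_nhds hz] with x hx using h x hx

theorem coordFun_Xperp (hz : z ∈ domain (chartTarget c)) : T.coordFun c (T.Xperp u) z =
    ((T.localSurface c).norm z)⁻¹ • (T.localSurface c).dH (T.coordFun c u) z := by
  have hU := T.contDiffOn_coordFun hu c
  have h1 : T.coordFun c (T.Xperp u) z =
      T.coordFun c (T.X (T.V u)) z - T.coordFun c (T.V (T.X u)) z := by
    rw [T.coordFun_eq hz, T.coordFun_eq hz, T.coordFun_eq hz]
    rfl
  rw [h1, T.coordFun_X (T.isSmooth_V hu) hz, T.coordFun_V (T.isSmooth_X hu) hz, dX,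
    T.fderiv_coordFun_congr (fun z hz => T.coordFun_V hu hz) hz, dV,
    T.fderiv_coordFun_congr (fun z hz => T.coordFun_X hu hz) hz]
  change _ • (T.localSurface c).dX ((T.localSurface c).dV (T.coordFun c u)) z -
    (T.localSurface c).dV (fun z => _) z = _
  rw [(T.localSurface c).dV_norm_inv ((T.localSurface c).contDiffOn_dX hU) hz, ← smul_sub,
    (T.localSurface c).dX_dV hU hz]

theorem isSmooth_Xperp : T.IsSmooth (T.Xperp u) := (T.isSmooth_iff _).2 fun c =>
  ((T.localSurface c).contDiffOn_norm_inv_smul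
    ((T.localSurface c).contDiffOn_dH (T.contDiffOn_coordFun hu c))).congr
    fun _ hz => T.coordFun_Xperp hu hz

theorem Xperp_eq {p : T.SM} (hp : p.base ∈ (extChartAt (𝓡 2) c).source) :
    T.Xperp u p = (T.localSurface c).dH (T.coordFun c u) (T.coord c p) := by
  have h := T.coordFun_Xperp hu (T.coord_mem hp)
  rwa [T.coordFun_coord hp, T.norm_coord hp, inv_one, one_smul] at h

/-- The structure equation `[V, X_⊥] = X`. -/
theorem V_Xperp (p : T.SM) : T.V (T.Xperp u) p = T.Xperp (T.V u) p + T.X u p := by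
  have hp := mem_extChartAt_source (I := 𝓡 2) p.base
  have hU := T.contDiffOn_coordFun hu p.base
  have hz := T.coord_mem hp
  rw [T.V_eq (T.isSmooth_Xperp hu) hp, T.Xperp_eq (T.isSmooth_V hu) hp, T.X_eq hu hp, dV,
    T.fderiv_coordFun_congr (fun z hz => T.coordFun_Xperp hu hz) hz, dH,
    T.fderiv_coordFun_congr (fun z hz => T.coordFun_V hu hz) hz]
  change (T.localSurface p.base).dV (fun z => _) _ = (T.localSurface p.base).dH
    ((T.localSurface p.base).dV (T.coordFun p.base u)) _ + _
  rw [(T.localSurface p.base).dV_norm_inv ((T.localSurface p.base).contDiffOn_dH hU) hz,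
    T.norm_coord hp, inv_one, one_smul, ← (T.localSurface p.base).dV_dH hU hz]
  abel

theorem X_Xperp_local (p : T.SM) : T.X (T.Xperp u) p = T.Xperp (T.X u) p -
    ((T.localSurface p.base).K (extChartAt (𝓡 2) p.base p.base) : ℂ) * T.V u p := by
  have hp := mem_extChartAt_source (I := 𝓡 2) p.base
  have hU := T.contDiffOn_coordFun hu p.base
  have hz := T.coord_mem hp
  rw [T.X_eq (T.isSmooth_Xperp hu) hp, T.Xperp_eq (T.isSmooth_X hu) hp, T.V_eq hu hp, dX,
    T.fderiv_coordFun_congr (fun z hz => T.coordFun_Xperp hu hz) hz, dH,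
    T.fderiv_coordFun_congr (fun z hz => T.coordFun_X hu hz) hz]
  change (T.localSurface p.base).dX (fun z => _) _ = (T.localSurface p.base).dH (fun z => _) _ - _
  have h := (T.localSurface p.base).dX_dH hU hz
  rw [T.normSq_coord hp, mul_one, sub_eq_iff_eq_add] at h
  rw [(T.localSurface p.base).dX_norm_inv ((T.localSurface p.base).contDiffOn_dH hU) hz,
    (T.localSurface p.base).dH_norm_inv ((T.localSurface p.base).contDiffOn_dX hU) hz,
    T.norm_coord hp, inv_one, one_smul, one_smul, h, neg_smul, Complex.real_smul]
  rw [show (T.coord p.base p).1 = extChartAt (𝓡 2) p.base p.base from rfl]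
  ring

end Frame

end GaussianThermostat

/-! ### The curvature and the external field -/

namespace GaussianThermostat

open LocalSurface

variable {M : Type*} [TopologicalSpace M] [ChartedSpace Plane M] [IsManifold (𝓡 2) ∞ M]
variable (T : GaussianThermostat M)

theorem chartG_stdVec (c : M) (y : Plane) (i j : Fin 2) :
    T.chartG c y (stdVec i) (stdVec j) = T.gram c y i j := by
  rw [chartG_apply, gram_eq]

theorem det_eq (c : M) (y : Plane) : (T.localSurface c).det y = (T.gram c y).det := by
  change T.chartG c y _ _ * T.chartG c y _ _ - T.chartG c y _ _ ^ 2 = _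
  rw [chartG_stdVec, chartG_stdVec, chartG_stdVec, Matrix.det_fin_two, T.gram_symm c y 1 0]
  ring

theorem chartΓ_stdVec (c : M) (y : Plane) (i j k : Fin 2) :
    T.chartΓ c y (stdVec i) (stdVec j) k = T.christoffel c k i j y := by
  rw [chartΓ, bilinVecOf_apply]
  fin_cases i <;> fin_cases j <;> simp [stdVec]

theorem fderiv_chartΓ_stdVec {c : M} {y : Plane} (hy : y ∈ chartTarget c) (n i j k : Fin 2) :
    fderiv ℝ (T.chartΓ c) y (stdVec n) (stdVec i) (stdVec j) k =
      partialDeriv n (T.christoffel c k i j) y := by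
  have h := (((T.localSurface c).hasFDerivAt_Γ hy).clm_apply
    (hasFDerivAt_const (stdVec i) y)).clm_apply (hasFDerivAt_const (stdVec j) y)
  have h2 := (EuclideanSpace.proj k : Plane →L[ℝ] ℝ).hasFDerivAt.comp y h
  have h3 : (EuclideanSpace.proj k : Plane →L[ℝ] ℝ) ∘
      (fun y => (T.localSurface c).Γ y (stdVec i) (stdVec j)) = T.christoffel c k i j :=
    funext fun x => T.chartΓ_stdVec c x i j k
  rw [h3] at h2
  rw [partialDeriv, h2.fderiv]
  simp
  rfl

theorem K_eq (x : M) :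
    (T.localSurface x).K (extChartAt (𝓡 2) x x) = T.gaussCurvature x := by
  have hy : extChartAt (𝓡 2) x x ∈ chartTarget x := mem_extChartAt_target x
  have hR : ∀ l, (T.localSurface x).R (extChartAt (𝓡 2) x x) (stdVec 0) (stdVec 1) (stdVec 1) l =
      T.riemann x l (extChartAt (𝓡 2) x x) := by
    intro l
    change (fderiv ℝ (T.chartΓ x) _ (stdVec 0) (stdVec 1) (stdVec 1) -
      fderiv ℝ (T.chartΓ x) _ (stdVec 1) (stdVec 0) (stdVec 1) +
      T.chartΓ x _ (stdVec 0) (T.chartΓ x _ (stdVec 1) (stdVec 1)) -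
      T.chartΓ x _ (stdVec 1) (T.chartΓ x _ (stdVec 0) (stdVec 1))) l = _
    rw [LocalSurface.eq_sum_stdVec (T.chartΓ x _ (stdVec 1) (stdVec 1)),
      LocalSurface.eq_sum_stdVec (T.chartΓ x _ (stdVec 0) (stdVec 1))]
    simp only [PiLp.sub_apply, PiLp.add_apply, map_add, map_smul, PiLp.smul_apply, smul_eq_mul,
      chartΓ_stdVec, T.fderiv_chartΓ_stdVec hy, riemann, Fin.sum_univ_two]
    ring
  rw [gaussCurvature, K, det_eq]
  congr 1
  simp only [← hR, ← chartG_stdVec]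
  conv_lhs => rw [LocalSurface.eq_sum_stdVec ((T.localSurface x).R _ _ _ _)]
  simp only [map_add, map_smul, smul_eq_mul, Fin.sum_univ_two]
  change _ * T.chartG x _ _ _ + _ * T.chartG x _ _ _ = _
  ring

theorem X_Xperp {u : T.SM → ℂ} (hu : T.IsSmooth u) (p : T.SM) :
    T.X (T.Xperp u) p = T.Xperp (T.X u) p - (T.gaussCurvature p.base : ℂ) * T.V u p := by
  rw [T.X_Xperp_local hu, K_eq]

/-- The components of the external field in the chart at `c`. -/
def chartE (c : M) (y : Plane) : Plane := components c _ (T.E ((extChartAt (𝓡 2) c).symm y))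

theorem contDiffOn_chartE (c : M) : ContDiffOn ℝ ∞ (T.chartE c) (chartTarget c) := by
  have h1 := T.E_smooth.comp_contMDiffOn (contMDiffOn_extChartAt_symm (n := ∞) (I := 𝓡 2) c)
  have h2 := (contMDiffOn_coord c).comp h1 fun y hy => (extChartAt (𝓡 2) c).map_target hy
  exact (contMDiffOn_iff_contDiffOn.1 h2).snd

theorem divergence_chartE (x : M) :
    (T.localSurface x).divergence (T.chartE x) (extChartAt (𝓡 2) x x) = T.divE x := by
  rw [← (T.localSurface x).divergence_eq (mem_extChartAt_target x) (T.contDiffOn_chartE x), divE]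
  simp only [det_eq]
  rfl

/-- The function `λ` in a chart, as a function which is linear in the fibres. -/
def chartLam (c : M) (z : Plane × Plane) : ℂ :=
  ((T.chartG c z.1 (T.chartE c z.1) (T.chartJ c z.1 z.2) : ℝ) : ℂ)

/-- The function `V λ` in a chart, as a function which is linear in the fibres. -/
def chartVLam (c : M) (z : Plane × Plane) : ℂ :=
  ((-T.chartG c z.1 (T.chartE c z.1) z.2 : ℝ) : ℂ)

theorem contDiffOn_chartLam (c : M) : ContDiffOn ℝ ∞ (T.chartLam c) (domain (chartTarget c)) := by
  have h1 : ContDiffOn ℝ ∞ (fun z : Plane × Plane => T.chartG c z.1) (domain (chartTarget c)) :=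
    (T.contDiffOn_chartG c).comp contDiff_fst.contDiffOn fun z hz => hz.1
  have h2 : ContDiffOn ℝ ∞ (fun z : Plane × Plane => T.chartE c z.1) (domain (chartTarget c)) :=
    (T.contDiffOn_chartE c).comp contDiff_fst.contDiffOn fun z hz => hz.1
  exact Complex.ofRealCLM.contDiff.comp_contDiffOn
    ((h1.clm_apply h2).clm_apply (T.localSurface c).contDiffOn_J)

theorem contDiffOn_chartVLam (c : M) :
    ContDiffOn ℝ ∞ (T.chartVLam c) (domain (chartTarget c)) := by
  have h1 : ContDiffOn ℝ ∞ (fun z : Plane × Plane => T.chartG c z.1) (domain (chartTarget c)) :=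
    (T.contDiffOn_chartG c).comp contDiff_fst.contDiffOn fun z hz => hz.1
  have h2 : ContDiffOn ℝ ∞ (fun z : Plane × Plane => T.chartE c z.1) (domain (chartTarget c)) :=
    (T.contDiffOn_chartE c).comp contDiff_fst.contDiffOn fun z hz => hz.1
  exact Complex.ofRealCLM.contDiff.comp_contDiffOn
    ((h1.clm_apply h2).clm_apply contDiff_snd.contDiffOn).neg

theorem coordFun_lam {c : M} {z : Plane × Plane} (hz : z ∈ domain (chartTarget c)) :
    T.coordFun c T.lam z = ((T.localSurface c).norm z)⁻¹ • T.chartLam c z := by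
  rw [T.coordFun_eq hz, chartLam, Complex.real_smul, ← Complex.ofReal_mul, chartG_apply,
    tangentVec_chartJ T hz.1, chartE, tangentVec_components hz.1, LocalSurface.norm]
  change ((T.g.inner _ (T.E _) (T.J _ ((√(T.g.inner _ _ _))⁻¹ • tangentVec c z.1 z.2)) : ℝ) : ℂ) = _
  rw [map_smul, map_smul, smul_eq_mul, ← chartG_apply]
  rfl

theorem isSmooth_lam : T.IsSmooth T.lam := (T.isSmooth_iff _).2 fun c =>
  ((T.localSurface c).contDiffOn_norm_inv_smul (T.contDiffOn_chartLam c)).congr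
    fun _ hz => T.coordFun_lam hz

theorem dV_linear {c : M} {z : Plane × Plane}
    {U : Plane × Plane → ℂ} (L : Plane →L[ℝ] ℝ) (hU : ∀ w, U (z.1, w) = (L w : ℂ))
    (hd : DifferentiableAt ℝ U z) : (T.localSurface c).dV U z = (L (T.chartJ c z.1 z.2) : ℂ) := by
  have h1 : HasFDerivAt (fun w : Plane => ((z.1, w) : Plane × Plane))
      (ContinuousLinearMap.inr ℝ Plane Plane) z.2 := hasFDerivAt_prodMk_right z.1 z.2
  have h2 := HasFDerivAt.comp z.2 (f := fun w : Plane => ((z.1, w) : Plane × Plane))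
    hd.hasFDerivAt h1
  have h3 : U ∘ (fun w : Plane => ((z.1, w) : Plane × Plane)) = fun w => (L w : ℂ) := funext hU
  rw [h3] at h2
  have h4 := h2.unique (Complex.ofRealCLM.hasFDerivAt.comp z.2 L.hasFDerivAt)
  have h5 := congrArg (fun A => A (T.chartJ c z.1 z.2)) h4
  simpa [dV, fieldV, localSurface] using h5

theorem dV_chartLam {c : M} {z : Plane × Plane} (hz : z ∈ domain (chartTarget c)) :
    (T.localSurface c).dV (T.chartLam c) z = T.chartVLam c z := by
  rw [T.dV_linear ((T.chartG c z.1 (T.chartE c z.1)).comp (T.chartJ c z.1)) (fun w => rfl)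
    (((T.localSurface c).contDiffAt_of_mem (T.contDiffOn_chartLam c) hz).differentiableAt
      (by simp)), chartVLam]
  congr 1
  rw [ContinuousLinearMap.comp_apply]
  have := (T.localSurface c).J_sq z.1 hz.1 z.2
  change T.chartJ c z.1 (T.chartJ c z.1 z.2) = _ at this
  rw [this, map_neg]

theorem dV_chartVLam {c : M} {z : Plane × Plane} (hz : z ∈ domain (chartTarget c)) :
    (T.localSurface c).dV (T.chartVLam c) z = -T.chartLam c z := by
  rw [T.dV_linear (-(T.chartG c z.1 (T.chartE c z.1))) (fun w => rfl)
    (((T.localSurface c).contDiffAt_of_mem (T.contDiffOn_chartVLam c) hz).differentiableAt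
      (by simp)), chartLam, ← Complex.ofReal_neg]
  rfl

theorem coordFun_V_lam {c : M} {z : Plane × Plane} (hz : z ∈ domain (chartTarget c)) :
    T.coordFun c (T.V T.lam) z = ((T.localSurface c).norm z)⁻¹ • T.chartVLam c z := by
  rw [T.coordFun_V T.isSmooth_lam hz, dV,
    T.fderiv_coordFun_congr (fun z hz => T.coordFun_lam hz) hz]
  change (T.localSurface c).dV (fun z => _) z = _
  rw [(T.localSurface c).dV_norm_inv (T.contDiffOn_chartLam c) hz, T.dV_chartLam hz]

theorem V_V_lam (p : T.SM) : T.V (T.V T.lam) p = -T.lam p := by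
  have hp := mem_extChartAt_source (I := 𝓡 2) p.base
  have hz := T.coord_mem hp
  rw [T.V_eq (T.isSmooth_V T.isSmooth_lam) hp, dV,
    T.fderiv_coordFun_congr (fun z hz => T.coordFun_V_lam hz) hz]
  change (T.localSurface _).dV (fun z => _) _ = _
  rw [(T.localSurface _).dV_norm_inv (T.contDiffOn_chartVLam _) hz, T.dV_chartVLam hz, smul_neg,
    ← T.coordFun_lam hz, T.coordFun_coord hp]

/-- The identity `X V f + X_⊥ f = -div e` for a function `f = ⟨e, iv⟩` which is linear on the fibres
of `SM` over a chart; `h` stands for `V f = -⟨e, v⟩`. -/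
theorem X_add_Xperp_of_linear {c : M} {f h : T.SM → ℂ} (hf : T.IsSmooth f) (hh : T.IsSmooth h)
    {e : Plane → Plane} (he : ContDiffOn ℝ ∞ e (chartTarget c))
    (hfe : ∀ z ∈ domain (chartTarget c), T.coordFun c f z = ((T.localSurface c).norm z)⁻¹ •
      (((T.localSurface c).g z.1 (e z.1) ((T.localSurface c).J z.1 z.2) : ℝ) : ℂ))
    (hhe : ∀ z ∈ domain (chartTarget c), T.coordFun c h z = ((T.localSurface c).norm z)⁻¹ •
      ((-(T.localSurface c).g z.1 (e z.1) z.2 : ℝ) : ℂ))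
    {p : T.SM} (hp : p.base ∈ (extChartAt (𝓡 2) c).source) :
    T.X h p + T.Xperp f p =
      -(((T.localSurface c).divergence e (extChartAt (𝓡 2) c p.base) : ℝ) : ℂ) := by
  have hz := T.coord_mem hp
  set S := T.localSurface c with hS
  have h1 : ContDiffOn ℝ ∞ (fun z : Plane × Plane => S.g z.1) (domain (chartTarget c)) :=
    S.g_smooth.comp contDiff_fst.contDiffOn fun z hz => hz.1
  have h2 : ContDiffOn ℝ ∞ (fun z : Plane × Plane => e z.1) (domain (chartTarget c)) :=
    he.comp contDiff_fst.contDiffOn fun z hz => hz.1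
  have hA : ContDiffOn ℝ ∞ (fun z : Plane × Plane => ((S.g z.1 (e z.1) (S.J z.1 z.2) : ℝ) : ℂ))
      (domain (chartTarget c)) :=
    Complex.ofRealCLM.contDiff.comp_contDiffOn ((h1.clm_apply h2).clm_apply S.contDiffOn_J)
  have hB : ContDiffOn ℝ ∞ (fun z : Plane × Plane => ((-S.g z.1 (e z.1) z.2 : ℝ) : ℂ))
      (domain (chartTarget c)) :=
    Complex.ofRealCLM.contDiff.comp_contDiffOn
      ((h1.clm_apply h2).clm_apply contDiff_snd.contDiffOn).neg
  rw [T.X_eq hh hp, T.Xperp_eq hf hp, dX, dH, T.fderiv_coordFun_congr hhe hz,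
    T.fderiv_coordFun_congr hfe hz]
  change S.dX (fun z => _) _ + S.dH (fun z => _) _ = _
  rw [S.dX_norm_inv hB hz, S.dH_norm_inv hA hz, T.norm_coord hp, inv_one, one_smul, one_smul]
  refine (S.dX_inner_add_dH_inner he hz).trans ?_
  rw [T.normSq_coord hp, one_mul]
  rfl

/-- The divergence of `E` in terms of `λ`: `X V λ + X_⊥ λ = -div E`. -/
theorem X_V_lam_add_Xperp_lam (p : T.SM) :
    T.X (T.V T.lam) p + T.Xperp T.lam p = -(T.divE p.base : ℂ) := by
  rw [T.X_add_Xperp_of_linear T.isSmooth_lam (T.isSmooth_V T.isSmooth_lam)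
    (T.contDiffOn_chartE p.base) (fun z hz => T.coordFun_lam hz) (fun z hz => T.coordFun_V_lam hz)
    (mem_extChartAt_source p.base), T.divergence_chartE]

/-! ### The algebra of smooth functions -/

section Algebra

variable {T} {u v : T.SM → ℂ}

theorem coordFun_comp_eq {c : M} {z : Plane × Plane} (hz : z ∈ domain (chartTarget c))
    (φ : ℂ → ℂ → ℂ) (u v : T.SM → ℂ) : T.coordFun c (fun p => φ (u p) (v p)) z =
      φ (T.coordFun c u z) (T.coordFun c v z) := by
  rw [T.coordFun_eq hz, T.coordFun_eq hz, T.coordFun_eq hz]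

theorem IsSmooth.add (hu : T.IsSmooth u) (hv : T.IsSmooth v) :
    T.IsSmooth (fun p => u p + v p) := (T.isSmooth_iff _).2 fun c =>
  ((T.contDiffOn_coordFun hu c).add (T.contDiffOn_coordFun hv c)).congr
    fun _ hz => coordFun_comp_eq hz (· + ·) u v

theorem IsSmooth.sub (hu : T.IsSmooth u) (hv : T.IsSmooth v) :
    T.IsSmooth (fun p => u p - v p) := (T.isSmooth_iff _).2 fun c =>
  ((T.contDiffOn_coordFun hu c).sub (T.contDiffOn_coordFun hv c)).congr
    fun _ hz => coordFun_comp_eq hz (· - ·) u v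

theorem IsSmooth.mul (hu : T.IsSmooth u) (hv : T.IsSmooth v) :
    T.IsSmooth (fun p => u p * v p) := (T.isSmooth_iff _).2 fun c =>
  ((T.contDiffOn_coordFun hu c).mul (T.contDiffOn_coordFun hv c)).congr
    fun _ hz => coordFun_comp_eq hz (· * ·) u v

theorem IsSmooth.conj (hu : T.IsSmooth u) :
    T.IsSmooth (fun p => (starRingEnd ℂ) (u p)) := (T.isSmooth_iff _).2 fun c =>
  (Complex.conjCLE.contDiff.comp_contDiffOn (T.contDiffOn_coordFun hu c)).congr
    fun _ hz => coordFun_comp_eq hz (fun a _ => (starRingEnd ℂ) a) u u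

theorem isSmooth_const (a : ℂ) : T.IsSmooth (fun _ => a) := (T.isSmooth_iff _).2 fun c =>
  (contDiffOn_const (c := a)).congr fun z hz => by rw [T.coordFun_eq hz]

theorem IsSmooth.const_mul (a : ℂ) (hu : T.IsSmooth u) : T.IsSmooth (fun p => a * u p) :=
  (isSmooth_const a).mul hu

theorem IsSmooth.sum {ι : Type*} (s : Finset ι) {f : ι → T.SM → ℂ}
    (hf : ∀ i ∈ s, T.IsSmooth (f i)) : T.IsSmooth (fun p => ∑ i ∈ s, f i p) := by
  classical
  induction s using Finset.induction_on with
  | empty => simpa using isSmooth_const (T := T) 0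
  | insert a s ha ih =>
    simp only [Finset.sum_insert ha]
    exact (hf a (Finset.mem_insert_self a s)).add
      (ih fun i hi => hf i (Finset.mem_insert_of_mem hi))

/-- A function of the base point is smooth on `SM` if it is smooth in all charts. -/
theorem isSmooth_comp_base {f : M → ℂ}
    (hf : ∀ c : M, ContDiffOn ℝ ∞ (fun y => f ((extChartAt (𝓡 2) c).symm y)) (chartTarget c)) :
    T.IsSmooth (fun p => f p.base) := (T.isSmooth_iff _).2 fun c =>
  ((hf c).comp (contDiff_fst (E := Plane) (F := Plane)).contDiffOn fun _ hz => hz.1).congr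
    fun z hz => by
      rw [T.coordFun_eq hz]
      rfl

theorem differentiableAt_coordFun (hu : T.IsSmooth u) (p : T.SM) :
    DifferentiableAt ℝ (T.coordFun p.base u) (T.coord p.base p) :=
  ((T.localSurface _).contDiffAt_of_mem (T.contDiffOn_coordFun hu _)
    (T.coord_mem (mem_extChartAt_source p.base))).differentiableAt (by simp)

theorem X_add (hu : T.IsSmooth u) (hv : T.IsSmooth v) (p : T.SM) :
    T.X (fun p => u p + v p) p = T.X u p + T.X v p := by
  have hz := T.coord_mem (mem_extChartAt_source (I := 𝓡 2) p.base)
  rw [T.X_eq_base (hu.add hv), T.X_eq_base hu, T.X_eq_base hv, dX, dX, dX,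
    T.fderiv_coordFun_congr (fun z hz => coordFun_comp_eq hz (· + ·) u v) hz,
    fderiv_fun_add (differentiableAt_coordFun hu p) (differentiableAt_coordFun hv p)]
  rfl

theorem X_mul (hu : T.IsSmooth u) (hv : T.IsSmooth v) (p : T.SM) :
    T.X (fun p => u p * v p) p = T.X u p * v p + u p * T.X v p := by
  have hp := mem_extChartAt_source (I := 𝓡 2) p.base
  have hz := T.coord_mem hp
  rw [T.X_eq_base (hu.mul hv), T.X_eq_base hu, T.X_eq_base hv, dX, dX, dX,
    T.fderiv_coordFun_congr (fun z hz => coordFun_comp_eq hz (· * ·) u v) hz,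
    fderiv_fun_mul (differentiableAt_coordFun hu p) (differentiableAt_coordFun hv p),
    T.coordFun_coord hp, T.coordFun_coord hp]
  simp
  ring

theorem X_conj (hu : T.IsSmooth u) (p : T.SM) :
    T.X (fun p => (starRingEnd ℂ) (u p)) p = (starRingEnd ℂ) (T.X u p) := by
  have hz := T.coord_mem (mem_extChartAt_source (I := 𝓡 2) p.base)
  have h := Complex.conjCLE.toContinuousLinearMap.hasFDerivAt.comp _
    (differentiableAt_coordFun hu p).hasFDerivAt
  rw [T.X_eq_base hu.conj, T.X_eq_base hu, dX, dX,
    T.fderiv_coordFun_congr (fun z hz => coordFun_comp_eq hz (fun a _ => (starRingEnd ℂ) a) u u) hz]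
  refine Eq.trans (congrArg (fun A : Plane × Plane →L[ℝ] ℂ =>
    A ((T.localSurface p.base).fieldX (T.coord p.base p))) h.fderiv) ?_
  simp

theorem X_const (a : ℂ) (p : T.SM) : T.X (fun _ => a) p = 0 := by
  have hz := T.coord_mem (mem_extChartAt_source (I := 𝓡 2) p.base)
  rw [T.X_eq_base (isSmooth_const a), dX, T.fderiv_coordFun_congr (F := fun _ => a)
    (fun z hz => by rw [T.coordFun_eq hz]) hz]
  simp

theorem hasDerivAt_rot (hu : T.IsSmooth u) (p : T.SM) :
    HasDerivAt (fun t => u (T.rot t p)) (T.V u p) 0 := by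
  rw [T.V_eq hu (mem_extChartAt_source p.base)]
  exact T.hasDerivAt_rot_zero hu (mem_extChartAt_source p.base)

theorem rot_zero (p : T.SM) : T.rot 0 p = p := by
  apply Subtype.ext
  change (⟨p.base, Real.cos 0 • p.vec + Real.sin 0 • T.J p.base p.vec⟩ : TangentBundle (𝓡 2) M) = _
  rw [Real.cos_zero, Real.sin_zero, one_smul, zero_smul, add_zero]
  rfl

theorem rot_add (s t : ℝ) (p : T.SM) : T.rot (s + t) p = T.rot s (T.rot t p) := by
  apply Subtype.ext
  change (⟨p.base, _⟩ : TangentBundle (𝓡 2) M) = ⟨p.base, _⟩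
  congr 1
  change Real.cos (s + t) • p.vec + Real.sin (s + t) • T.J p.base p.vec =
    Real.cos s • (Real.cos t • p.vec + Real.sin t • T.J p.base p.vec) +
    Real.sin s • T.J p.base (Real.cos t • p.vec + Real.sin t • T.J p.base p.vec)
  rw [Real.cos_add, Real.sin_add, map_add, map_smul, map_smul, T.J_sq]
  module

theorem V_add (hu : T.IsSmooth u) (hv : T.IsSmooth v) (p : T.SM) :
    T.V (fun p => u p + v p) p = T.V u p + T.V v p :=
  ((hasDerivAt_rot hu p).add (hasDerivAt_rot hv p)).deriv

theorem V_mul (hu : T.IsSmooth u) (hv : T.IsSmooth v) (p : T.SM) :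
    T.V (fun p => u p * v p) p = T.V u p * v p + u p * T.V v p := by
  have h := ((hasDerivAt_rot hu p).mul (hasDerivAt_rot hv p)).deriv
  simp only [rot_zero] at h
  exact h

theorem V_conj (hu : T.IsSmooth u) (p : T.SM) :
    T.V (fun p => (starRingEnd ℂ) (u p)) p = (starRingEnd ℂ) (T.V u p) :=
  (Complex.conjCLE.toContinuousLinearMap.hasFDerivAt.comp_hasDerivAt 0
    (hasDerivAt_rot hu p)).deriv

theorem V_const (a : ℂ) (p : T.SM) : T.V (fun _ => a) p = 0 := deriv_const 0 a

end Algebra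

end GaussianThermostat

/-! ### Fourier analysis in the fibres -/

namespace GaussianThermostat

open LocalSurface MeasureTheory

variable {M : Type*} [TopologicalSpace M] [ChartedSpace Plane M] [IsManifold (𝓡 2) ∞ M]
variable {T : GaussianThermostat M} {u v : T.SM → ℂ}

theorem hasDerivAt_rot_apply (hu : T.IsSmooth u) (p : T.SM) (t : ℝ) :
    HasDerivAt (fun t => u (T.rot t p)) (T.V u (T.rot t p)) t := by
  have h := hasDerivAt_rot hu (T.rot t p)
  simp only [← rot_add] at h
  have h' : HasDerivAt (fun s => u (T.rot (s + t) p)) (T.V u (T.rot t p)) (t - t) := by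
    rwa [sub_self]
  simpa using h'.comp_sub_const t t

theorem continuous_rot (hu : T.IsSmooth u) (p : T.SM) : Continuous fun t => u (T.rot t p) :=
  continuous_iff_continuousAt.2 fun t => (hasDerivAt_rot_apply hu p t).continuousAt

theorem rot_periodic (u : T.SM → ℂ) (p : T.SM) :
    Function.Periodic (fun t => u (T.rot t p)) (2 * Real.pi) := by
  intro t
  have h : T.rot (t + 2 * Real.pi) p = T.rot t p := by
    apply Subtype.ext
    change (⟨p.base, Real.cos _ • _ + Real.sin _ • _⟩ : TangentBundle (𝓡 2) M) = ⟨p.base, _⟩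
    rw [Real.cos_add_two_pi, Real.sin_add_two_pi]
  exact congrArg u h

theorem rot_two_pi (u : T.SM → ℂ) (p : T.SM) : u (T.rot (2 * Real.pi) p) = u p := by
  have h := rot_periodic u p 0
  simpa [rot_zero] using h

/-- The average of `u` over the fibres with weight `κ`. -/
def fibreConv (κ : ℝ → ℂ) (u : T.SM → ℂ) (p : T.SM) : ℂ :=
  ∫ t in (0 : ℝ)..(2 * Real.pi), κ t * u (T.rot t p)

theorem fibreConv_rot (κ : ℝ → ℂ) (u : T.SM → ℂ) (s : ℝ) (p : T.SM) :
    fibreConv κ u (T.rot s p) = ∫ t in (0 : ℝ)..(2 * Real.pi), κ t * u (T.rot (t + s) p) := by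
  simp only [fibreConv, rot_add]

/-- The vector `w` rotated by the angle `t`, in a chart. -/
def chartRot (T : GaussianThermostat M) (c : M) (t : ℝ) (z : Plane × Plane) : Plane :=
  Real.cos t • z.2 + Real.sin t • T.chartJ c z.1 z.2

theorem chartRot_ne_zero {c : M} {z : Plane × Plane} (hz : z ∈ domain (chartTarget c)) (t : ℝ) :
    T.chartRot c t z ≠ 0 := by
  intro h
  have h1 := congrArg (fun v => T.chartG c z.1 v (T.chartRot c t z)) h
  have hJ : T.chartG c z.1 (T.chartJ c z.1 z.2) (T.chartJ c z.1 z.2) = T.chartG c z.1 z.2 z.2 :=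
    (T.localSurface c).J_isometry z.1 hz.1 _ _
  have e1 : T.chartG c z.1 z.2 (T.chartJ c z.1 z.2) = 0 := (T.localSurface c).g_self_J hz.1 _
  have e2 : T.chartG c z.1 (T.chartJ c z.1 z.2) z.2 = 0 := (T.localSurface c).g_J_self hz.1 _
  simp only [chartRot, map_add, map_smul, add_apply, smul_apply, smul_eq_mul, e1, e2, hJ, map_zero,
    zero_apply] at h1
  have h2 := T.chartG_pos hz.1 hz.2
  have h3 : T.chartG c z.1 z.2 z.2 * (Real.sin t ^ 2 + Real.cos t ^ 2) = 0 := by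
    linear_combination h1
  rw [Real.sin_sq_add_cos_sq, mul_one] at h3
  exact h2.ne' h3

theorem coordFun_rot {c : M} {z : Plane × Plane} (hz : z ∈ domain (chartTarget c))
    (u : T.SM → ℂ) (t : ℝ) :
    u (T.rot t (T.ray hz)) = T.coordFun c u (z.1, T.chartRot c t z) := by
  have hN := inv_pos.2 ((T.localSurface c).norm_pos hz)
  rw [← T.coordFun_coord (u := u) (p := T.rot t (T.ray hz)) (T.ray_base hz), T.coord_rot (T.ray_base hz),
    T.coord_ray hz, ← T.coordFun_smul c u z.1 (T.chartRot c t z) hN]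
  congr 2
  simp only [chartRot, map_smul]
  module

theorem contDiffOn_chartRot (c : M) : ContDiffOn ℝ ∞
    (fun q : (Plane × Plane) × ℝ => ((q.1.1, T.chartRot c q.2 q.1) : Plane × Plane))
    (domain (chartTarget c) ×ˢ Set.univ) := by
  have h1 : ContDiffOn ℝ ∞ (fun q : (Plane × Plane) × ℝ => T.chartJ c q.1.1 q.1.2)
      (domain (chartTarget c) ×ˢ Set.univ) :=
    (T.localSurface c).contDiffOn_J.comp contDiff_fst.contDiffOn fun q hq => hq.1
  refine contDiff_fst.fst.contDiffOn.prodMk (ContDiffOn.add ?_ ?_)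
  · exact ((Real.contDiff_cos.comp contDiff_snd).smul contDiff_fst.snd).contDiffOn
  · exact (Real.contDiff_sin.comp contDiff_snd).contDiffOn.smul h1

/-- Weighted averages of smooth functions over the fibres are smooth. -/
theorem isSmooth_fibreConv {κ : ℝ → ℂ} (hκ : Continuous κ) (hu : T.IsSmooth u) :
    T.IsSmooth (fibreConv κ u) := by
  rw [isSmooth_iff]
  intro c
  -- a cutoff function which equals one where the integration takes place
  let χ : ContDiffBump (-Real.pi) := ⟨4, 5, by norm_num, by norm_num⟩
  let f : ℝ → ℂ := (Set.Ioc 0 (2 * Real.pi)).indicator κ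
  let G : Plane × Plane → ℝ → ℂ := fun z s => (χ s : ℂ) * T.coordFun c u (z.1, T.chartRot c (-s) z)
  have hf : LocallyIntegrable f volume :=
    hκ.locallyIntegrable.indicator measurableSet_Ioc
  have hG : ContDiffOn ℝ ∞ ↿G (domain (chartTarget c) ×ˢ Set.univ) := by
    have h1 : ContDiffOn ℝ ∞ (fun q : (Plane × Plane) × ℝ => (χ q.2 : ℂ))
        (domain (chartTarget c) ×ˢ Set.univ) :=
      (Complex.ofRealCLM.contDiff.comp (χ.contDiff.comp contDiff_snd)).contDiffOn
    have h2 : ContDiffOn ℝ ∞ (fun q : (Plane × Plane) × ℝ => (q.1, -q.2))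
        (domain (chartTarget c) ×ˢ Set.univ) :=
      (contDiff_fst.prodMk contDiff_snd.neg).contDiffOn
    have h3 := (contDiffOn_chartRot (T := T) c).comp h2 fun q hq => ⟨hq.1, trivial⟩
    have h4 := (T.contDiffOn_coordFun hu c).comp h3 fun q hq =>
      ⟨hq.1.1, chartRot_ne_zero hq.1 _⟩
    exact h1.mul h4
  have h := contDiffOn_convolution_right_with_param (μ := volume) (n := ⊤)
    (ContinuousLinearMap.mul ℝ ℂ) (T.localSurface c).isOpen_domain
    (isCompact_closedBall (-Real.pi) 5) (g := G) (f := f) (by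
      intro z s _ hs
      have : χ s = 0 := χ.zero_of_le_dist (by
        rw [Metric.mem_closedBall, not_le] at hs
        exact hs.le)
      simp [G, this]) hf hG
  have h' := h.comp (contDiff_id.prodMk contDiff_const).contDiffOn
    (fun z (hz : z ∈ domain (chartTarget c)) => (⟨hz, trivial⟩ : (z, (0 : ℝ)) ∈ _ ×ˢ Set.univ))
  refine h'.congr fun z hz => ?_
  rw [T.coordFun_eq hz, fibreConv, intervalIntegral.integral_of_le Real.two_pi_pos.le,
    ← integral_indicator measurableSet_Ioc]
  simp only [Function.comp_def, id, convolution_def, zero_sub]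
  congr 1
  funext t
  by_cases ht : t ∈ Set.Ioc 0 (2 * Real.pi)
  · have hχ : χ (-t) = 1 := χ.one_of_mem_closedBall (by
      rw [Metric.mem_closedBall, Real.dist_eq, abs_le]
      have := Real.pi_lt_four
      change -(4 : ℝ) ≤ _ ∧ _ ≤ (4 : ℝ)
      constructor <;> linarith [ht.1, ht.2])
    simp [f, G, ht, hχ, coordFun_rot hz]
  · simp [f, ht]

theorem intervalIntegrable_mul_rot {κ : ℝ → ℂ} (hκ : Continuous κ) (hu : T.IsSmooth u) (p : T.SM)
    (a b : ℝ) : IntervalIntegrable (fun t => κ t * u (T.rot t p)) volume a b :=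
  (hκ.mul (continuous_rot hu p)).intervalIntegrable a b

/-- The rotation of the fibres commutes with weighted averages. -/
theorem V_fibreConv {κ : ℝ → ℂ} (hκ : Continuous κ) (hu : T.IsSmooth u) (p : T.SM) :
    T.V (fibreConv κ u) p = fibreConv κ (T.V u) p := by
  have hV := T.isSmooth_V hu
  obtain ⟨C, hC⟩ : ∃ C, ∀ t, ‖T.V u (T.rot t p)‖ ≤ C := by
    obtain ⟨C, hC⟩ := (isCompact_Icc (a := (0 : ℝ)) (b := 2 * Real.pi)).exists_bound_of_continuousOn
      (continuous_rot hV p).continuousOn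
    refine ⟨C, fun t => ?_⟩
    obtain ⟨s, hs, hst⟩ := (rot_periodic (T.V u) p).exists_mem_Ico₀ Real.two_pi_pos t
    rw [hst]
    exact hC s ⟨hs.1, hs.2.le⟩
  have h := (intervalIntegral.hasDerivAt_integral_of_dominated_loc_of_deriv_le (𝕜 := ℝ)
    (μ := volume) (a := 0) (b := 2 * Real.pi) (x₀ := (0 : ℝ)) (s := Set.univ)
    (F := fun s t => κ t * u (T.rot (t + s) p)) (F' := fun s t => κ t * T.V u (T.rot (t + s) p))
    (bound := fun t => ‖κ t‖ * C) Filter.univ_mem ?_ ?_ ?_ ?_ ?_ ?_).2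
  · simp only [add_zero] at h
    rw [V]
    simp only [fibreConv_rot]
    exact h.deriv
  · refine Filter.Eventually.of_forall fun s => Continuous.aestronglyMeasurable ?_
    exact hκ.mul ((continuous_rot hu p).comp (continuous_id.add continuous_const))
  · simpa using intervalIntegrable_mul_rot hκ hu p _ _
  · refine Continuous.aestronglyMeasurable ?_
    exact hκ.mul ((continuous_rot hV p).comp (continuous_id.add continuous_const))
  · refine Filter.Eventually.of_forall fun t _ s _ => ?_
    rw [norm_mul]
    exact mul_le_mul_of_nonneg_left (hC _) (norm_nonneg _)
  · exact (hκ.norm.mul continuous_const).intervalIntegrable _ _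
  · refine Filter.Eventually.of_forall fun t _ s _ => ?_
    exact (HasDerivAt.comp_const_add t s (hasDerivAt_rot_apply hu p (t + s))).const_mul (κ t)

/-! The Fourier components. -/

/-- The character `e^{ikt}`. -/
def character (k : ℤ) (t : ℝ) : ℂ := Complex.exp (Complex.I * k * t)

theorem continuous_character (k : ℤ) : Continuous (character k) := by
  unfold character
  fun_prop

theorem character_add (k : ℤ) (s t : ℝ) : character k (s + t) = character k s * character k t := by
  rw [character, character, character, ← Complex.exp_add]
  push_cast
  ring_nf

theorem character_mul (j k : ℤ) (t : ℝ) : character j t * character k t = character (j + k) t := by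
  rw [character, character, character, ← Complex.exp_add]
  push_cast
  ring_nf

theorem character_zero_left (t : ℝ) : character 0 t = 1 := by simp [character]

theorem character_zero (k : ℤ) : character k 0 = 1 := by simp [character]

theorem conj_character (k : ℤ) (t : ℝ) : (starRingEnd ℂ) (character k t) = character (-k) t := by
  rw [character, character, ← Complex.exp_conj]
  simp

theorem character_two_pi (k : ℤ) : character k (2 * Real.pi) = 1 := by
  rw [character, Complex.exp_eq_one_iff]
  exact ⟨k, by push_cast; ring⟩

theorem character_periodic (k : ℤ) : Function.Periodic (character k) (2 * Real.pi) := fun t => by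
  rw [character_add, character_two_pi, mul_one]

theorem hasDerivAt_character (k : ℤ) (t : ℝ) :
    HasDerivAt (character k) (Complex.I * k * character k t) t := by
  have h1 : HasDerivAt (fun t : ℝ => (t : ℂ)) 1 t := Complex.ofRealCLM.hasDerivAt
  have h := (h1.const_mul (Complex.I * k)).cexp
  refine h.congr_deriv ?_
  rw [character]
  ring

theorem integral_character (k : ℤ) :
    ∫ t in (0 : ℝ)..(2 * Real.pi), character k t = if k = 0 then (2 * Real.pi : ℂ) else 0 := by
  split_ifs with hk
  · subst hk
    simp [character_zero_left]
  · have hne : Complex.I * (k : ℂ) ≠ 0 := mul_ne_zero Complex.I_ne_zero (by exact_mod_cast hk)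
    have h := intervalIntegral.integral_eq_sub_of_hasDerivAt (a := 0) (b := 2 * Real.pi)
      (fun t _ => hasDerivAt_character k t)
      ((continuous_const.mul (continuous_character k)).intervalIntegrable _ _)
    rw [intervalIntegral.integral_const_mul, character_two_pi, character_zero, sub_self] at h
    exact (mul_eq_zero.1 h).resolve_left hne

theorem fourier_eq (k : ℤ) (u : T.SM → ℂ) (p : T.SM) : T.fourier k u p =
    (1 / (2 * Real.pi) : ℂ) *
      ∫ t in (0 : ℝ)..(2 * Real.pi), character (-k) t * u (T.rot t p) := by
  rw [fourier]
  congr 2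
  funext t
  rw [character, mul_comm]
  congr 2
  push_cast
  ring

theorem fourier_eq_fibreConv (k : ℤ) (u : T.SM → ℂ) : T.fourier k u =
    fibreConv (fun t => (1 / (2 * Real.pi) : ℂ) * character (-k) t) u := by
  funext p
  rw [fourier_eq, fibreConv, ← intervalIntegral.integral_const_mul]
  simp only [mul_assoc]

theorem isSmooth_fourier (k : ℤ) (hu : T.IsSmooth u) : T.IsSmooth (T.fourier k u) := by
  rw [fourier_eq_fibreConv]
  exact isSmooth_fibreConv (continuous_const.mul (continuous_character _)) hu

theorem fourier_rot (k : ℤ) (u : T.SM → ℂ) (s : ℝ) (p : T.SM) :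
    T.fourier k u (T.rot s p) = character k s * T.fourier k u p := by
  rw [fourier_eq, fourier_eq]
  have h1 : ∀ t, character (-k) t * u (T.rot t (T.rot s p)) =
      character k s * (character (-k) (t + s) * u (T.rot (t + s) p)) := by
    intro t
    rw [← rot_add, character_add, mul_comm (character (-k) t) (character (-k) s), ← mul_assoc,
      ← mul_assoc, character_mul, add_neg_cancel, character_zero_left, one_mul]
  simp only [h1, intervalIntegral.integral_const_mul]
  have h2 : Function.Periodic (fun t => character (-k) t * u (T.rot t p)) (2 * Real.pi) :=
    (character_periodic _).mul (rot_periodic u p)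
  have h3 := h2.intervalIntegral_add_eq s 0
  rw [intervalIntegral.integral_comp_add_right (fun t => character (-k) t * u (T.rot t p)),
    zero_add, add_comm (2 * Real.pi) s, h3, zero_add]
  ring

theorem V_fourier (k : ℤ) (u : T.SM → ℂ) (p : T.SM) :
    T.V (T.fourier k u) p = Complex.I * k * T.fourier k u p := by
  rw [V]
  simp only [fourier_rot]
  have h := (hasDerivAt_character k 0).mul_const (T.fourier k u p)
  rw [h.deriv, character_zero, mul_one]

theorem fourier_V (k : ℤ) (hu : T.IsSmooth u) (p : T.SM) :
    T.fourier k (T.V u) p = Complex.I * k * T.fourier k u p := by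
  rw [← V_fourier, fourier_eq_fibreConv, fourier_eq_fibreConv]
  exact (V_fibreConv (continuous_const.mul (continuous_character _)) hu p).symm

theorem fourier_add (k : ℤ) (hu : T.IsSmooth u) (hv : T.IsSmooth v) (p : T.SM) :
    T.fourier k (fun p => u p + v p) p = T.fourier k u p + T.fourier k v p := by
  simp only [fourier_eq, mul_add (character _ _)]
  rw [intervalIntegral.integral_add (intervalIntegrable_mul_rot (continuous_character _) hu p _ _)
    (intervalIntegrable_mul_rot (continuous_character _) hv p _ _), mul_add]

theorem fourier_sub (k : ℤ) (hu : T.IsSmooth u) (hv : T.IsSmooth v) (p : T.SM) :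
    T.fourier k (fun p => u p - v p) p = T.fourier k u p - T.fourier k v p := by
  simp only [fourier_eq, mul_sub (character _ _)]
  rw [intervalIntegral.integral_sub (intervalIntegrable_mul_rot (continuous_character _) hu p _ _)
    (intervalIntegrable_mul_rot (continuous_character _) hv p _ _), mul_sub]

theorem fourier_const_mul (k : ℤ) (a : ℂ) (u : T.SM → ℂ) (p : T.SM) :
    T.fourier k (fun p => a * u p) p = a * T.fourier k u p := by
  simp only [fourier_eq, mul_left_comm (character _ _) a, intervalIntegral.integral_const_mul]
  ring

theorem fourier_conj (k : ℤ) (u : T.SM → ℂ) (p : T.SM) :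
    T.fourier k (fun p => (starRingEnd ℂ) (u p)) p = (starRingEnd ℂ) (T.fourier (-k) u p) := by
  rw [fourier_eq, fourier_eq, map_mul, neg_neg, intervalIntegral.integral_of_le Real.two_pi_pos.le,
    intervalIntegral.integral_of_le Real.two_pi_pos.le, ← integral_conj]
  simp [conj_character]
  exact Or.inl (map_ofNat (starRingEnd ℂ) 2).symm

/-- A function with `V f = ikf` is homogeneous of frequency `k` along the fibres. -/
theorem rot_of_V_eq {k : ℤ} {f : T.SM → ℂ} (hf : T.IsSmooth f)
    (h : ∀ p, T.V f p = Complex.I * k * f p) (t : ℝ) (p : T.SM) :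
    f (T.rot t p) = character k t * f p := by
  have hd : ∀ s, HasDerivAt (fun s => character (-k) s * f (T.rot s p)) 0 s := by
    intro s
    refine ((hasDerivAt_character (-k) s).mul (hasDerivAt_rot_apply hf p s)).congr_deriv ?_
    rw [h]
    push_cast
    ring
  have hc := is_const_of_deriv_eq_zero (fun s => (hd s).differentiableAt) (fun s => (hd s).deriv)
    t 0
  simp only [character_zero, rot_zero, one_mul] at hc
  rw [← hc, ← mul_assoc, character_mul, add_neg_cancel, character_zero_left, one_mul]

theorem fourier_of_V_eq {k : ℤ} {f : T.SM → ℂ} (hf : T.IsSmooth f)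
    (h : ∀ p, T.V f p = Complex.I * k * f p) (j : ℤ) (p : T.SM) :
    T.fourier j f p = if j = k then f p else 0 := by
  rw [fourier_eq]
  simp only [rot_of_V_eq hf h, ← mul_assoc, character_mul]
  rw [intervalIntegral.integral_mul_const, integral_character]
  have hpi : (Real.pi : ℂ) ≠ 0 := by exact_mod_cast Real.pi_ne_zero
  by_cases hj : j = k
  · subst hj
    simp
    field_simp
  · rw [if_neg, if_neg hj]
    · simp
    · omega

theorem fourier_fourier (j k : ℤ) (hu : T.IsSmooth u) (p : T.SM) :
    T.fourier j (T.fourier k u) p = if j = k then T.fourier k u p else 0 :=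
  fourier_of_V_eq (isSmooth_fourier k hu) (V_fourier k u) j p

/-- The Fourier components of a weighted average. -/
theorem fourier_fibreConv {κ : ℝ → ℂ} (hκ : Continuous κ) (hu : T.IsSmooth u) (j : ℤ) (p : T.SM) :
    T.fourier j (fibreConv κ u) p =
      (∫ t in (0 : ℝ)..(2 * Real.pi), κ t * character j t) * T.fourier j u p := by
  have hcont : Continuous (Function.uncurry fun s t : ℝ =>
      character (-j) s * (κ t * u (T.rot (t + s) p))) := by
    refine ((continuous_character _).comp continuous_fst).mul
      ((hκ.comp continuous_snd).mul ((continuous_rot hu p).comp ?_))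
    exact continuous_snd.add continuous_fst
  have h1 : ∀ s, character (-j) s * fibreConv κ u (T.rot s p) =
      ∫ t in (0 : ℝ)..(2 * Real.pi), character (-j) s * (κ t * u (T.rot (t + s) p)) := by
    intro s
    rw [fibreConv_rot, intervalIntegral.integral_const_mul]
  have h2 : ∀ t, ∫ s in (0 : ℝ)..(2 * Real.pi), character (-j) s * (κ t * u (T.rot (t + s) p)) =
      κ t * ((2 * Real.pi) * (character j t * T.fourier j u p)) := by
    intro t
    have hpi : (Real.pi : ℂ) ≠ 0 := by exact_mod_cast Real.pi_ne_zero
    rw [← fourier_rot, fourier_eq, ← mul_assoc (2 * (Real.pi : ℂ)),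
      mul_one_div_cancel (by simp [hpi]), one_mul, ← intervalIntegral.integral_const_mul]
    congr 1
    funext s
    rw [← rot_add, add_comm t s]
    ring
  rw [fourier_eq]
  simp only [h1]
  rw [intervalIntegral_intervalIntegral_swap]
  · simp only [h2]
    have hpi : (Real.pi : ℂ) ≠ 0 := by exact_mod_cast Real.pi_ne_zero
    rw [← intervalIntegral.integral_const_mul, ← intervalIntegral.integral_mul_const]
    congr 1
    funext t
    field_simp
  · exact (hcont.continuousOn.integrableOn_compact (isCompact_uIcc.prod isCompact_uIcc)).mono_set
      (Set.prod_mono Set.uIoc_subset_uIcc Set.uIoc_subset_uIcc)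

/-! Operators which shift frequencies. -/

/-- The operator which inverts `V - ik` off the frequency `k`, up to a factor `2π`. -/
theorem V_fibreConv_mul_character (k : ℤ) (hu : T.IsSmooth u) (p : T.SM) :
    T.V (fibreConv (fun t => (t : ℂ) * character (-k) t) u) p =
      Complex.I * k * fibreConv (fun t => (t : ℂ) * character (-k) t) u p +
        2 * Real.pi * (u p - T.fourier k u p) := by
  have hκ : Continuous fun t : ℝ => (t : ℂ) * character (-k) t :=
    Complex.continuous_ofReal.mul (continuous_character _)
  rw [V_fibreConv hκ hu]
  have hd : ∀ t : ℝ, HasDerivAt (fun t : ℝ => (t : ℂ) * character (-k) t)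
      (character (-k) t - Complex.I * k * (t * character (-k) t)) t := by
    intro t
    have h1 : HasDerivAt (fun t : ℝ => (t : ℂ)) 1 t := Complex.ofRealCLM.hasDerivAt
    refine (h1.mul (hasDerivAt_character (-k) t)).congr_deriv ?_
    push_cast
    ring
  have hcont : Continuous fun t : ℝ => character (-k) t - Complex.I * k * (t * character (-k) t) :=
    (continuous_character _).sub (continuous_const.mul hκ)
  have h := intervalIntegral.integral_mul_deriv_eq_deriv_mul (a := 0) (b := 2 * Real.pi)
    (fun t _ => hd t) (fun t _ => hasDerivAt_rot_apply hu p t)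
    (hcont.intervalIntegrable _ _) ((continuous_rot (T.isSmooth_V hu) p).intervalIntegrable _ _)
  rw [fibreConv, h, rot_two_pi u p, character_two_pi]
  simp only [sub_mul, mul_assoc (Complex.I * (k : ℂ))]
  rw [intervalIntegral.integral_sub (intervalIntegrable_mul_rot (continuous_character _) hu p _ _)
    (show IntervalIntegrable (fun t : ℝ => Complex.I * k * (t * character (-k) t * u (T.rot t p)))
      volume _ _ from
      (continuous_const.mul (hκ.mul (continuous_rot hu p))).intervalIntegrable _ _),
    intervalIntegral.integral_const_mul, fourier_eq, fibreConv]
  have hpi : (Real.pi : ℂ) ≠ 0 := by exact_mod_cast Real.pi_ne_zero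
  push_cast
  field_simp
  simp
  ring

/-- A first order operator `D` with `[V, D] = inD` shifts frequencies by `n`. -/
theorem fourier_of_commutator {D : (T.SM → ℂ) → T.SM → ℂ} {n : ℤ}
    (hD : ∀ u, T.IsSmooth u → T.IsSmooth (D u))
    (hsub : ∀ u v, T.IsSmooth u → T.IsSmooth v → ∀ p, D (fun p => u p - v p) p = D u p - D v p)
    (hmul : ∀ (a : ℂ) u, T.IsSmooth u → ∀ p, D (fun p => a * u p) p = a * D u p)
    (hcomm : ∀ u, T.IsSmooth u → ∀ p, T.V (D u) p = D (T.V u) p + Complex.I * n * D u p)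
    (hu : T.IsSmooth u) (k : ℤ) (p : T.SM) :
    T.fourier (k + n) (D u) p = D (T.fourier k u) p := by
  have hκ : Continuous fun t : ℝ => (t : ℂ) * character (-k) t :=
    Complex.continuous_ofReal.mul (continuous_character _)
  set z := fibreConv (fun t : ℝ => (t : ℂ) * character (-k) t) u with hzdef
  have hz : T.IsSmooth z := isSmooth_fibreConv hκ hu
  have hpi : (2 * Real.pi : ℂ) ≠ 0 := by
    have : (Real.pi : ℂ) ≠ 0 := by exact_mod_cast Real.pi_ne_zero
    simp [this]
  have hk := isSmooth_fourier k hu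
  -- `u - u_k` is in the range of `V - ik`
  have h1 : (fun p => u p - T.fourier k u p) =
      fun p => (2 * Real.pi : ℂ)⁻¹ * (T.V z p - Complex.I * k * z p) := by
    funext p
    rw [hzdef, V_fibreConv_mul_character k hu p, add_sub_cancel_left, inv_mul_cancel_left₀ hpi]
  have h2 : ∀ p, D u p - D (T.fourier k u) p =
      (2 * Real.pi : ℂ)⁻¹ * (T.V (D z) p - Complex.I * ((k + n : ℤ) : ℂ) * D z p) := by
    intro p
    rw [← hsub u _ hu hk, h1, hmul _ _ ((T.isSmooth_V hz).sub (hz.const_mul _)),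
      hsub _ _ (T.isSmooth_V hz) (hz.const_mul _), hmul _ _ hz, hcomm z hz]
    push_cast
    ring
  have h3 : T.fourier (k + n) (fun p => D u p - D (T.fourier k u) p) p = 0 := by
    rw [funext h2, fourier_const_mul, fourier_sub _ (T.isSmooth_V (hD z hz))
      ((hD z hz).const_mul _), fourier_const_mul, fourier_V _ (hD z hz), sub_self, mul_zero]
  rw [fourier_sub _ (hD u hu) (hD _ hk), sub_eq_zero] at h3
  rw [h3, fourier_of_V_eq (hD _ hk) (k := k + n), if_pos rfl]
  intro q
  have h4 : T.V (T.fourier k u) = fun p => Complex.I * k * T.fourier k u p :=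
    funext fun p => V_fourier k u p
  rw [hcomm _ hk, h4, hmul _ _ hk]
  push_cast
  ring

/-! Orthogonality of different frequencies. -/

theorem fourierCoeffOn_rot (k : ℤ) (u : T.SM → ℂ) (p : T.SM) :
    fourierCoeffOn Real.two_pi_pos (fun t => u (T.rot t p)) k = T.fourier k u p := by
  rw [fourierCoeffOn_eq_integral, fourier_eq, Complex.real_smul]
  push_cast
  rw [sub_zero]
  congr 2
  funext t
  rw [fourier_coe_apply, smul_eq_mul, character]
  congr 2
  have hpi : (Real.pi : ℂ) ≠ 0 := by exact_mod_cast Real.pi_ne_zero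
  push_cast
  field_simp
  simp
  ring

theorem hasSum_fourier (hu : T.IsSmooth u) (p : T.SM) :
    HasSum (fun k : ℤ => ‖T.fourier k u p‖ ^ 2)
      ((2 * Real.pi)⁻¹ * ∫ t in (0 : ℝ)..(2 * Real.pi), ‖u (T.rot t p)‖ ^ 2) := by
  obtain ⟨C, hC⟩ := (isCompact_Icc (a := (0 : ℝ)) (b := 2 * Real.pi)).exists_bound_of_continuousOn
    (continuous_rot hu p).continuousOn
  have h := hasSum_sq_fourierCoeffOn (f := fun t => u (T.rot t p)) Real.two_pi_pos
    (MemLp.of_bound (continuous_rot hu p).aestronglyMeasurable C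
      ((ae_restrict_iff' measurableSet_Ioc).2 (Filter.Eventually.of_forall fun t ht =>
        hC t (Set.Ioc_subset_Icc_self ht))))
  simpa [fourierCoeffOn_rot] using h

/-- Functions without common frequencies are orthogonal on the fibres. -/
theorem integral_norm_sq_add (hu : T.IsSmooth u) (hv : T.IsSmooth v)
    (h : ∀ k, T.fourier k u = 0 ∨ T.fourier k v = 0) (p : T.SM) :
    ∫ t in (0 : ℝ)..(2 * Real.pi), ‖u (T.rot t p) + v (T.rot t p)‖ ^ 2 =
      (∫ t in (0 : ℝ)..(2 * Real.pi), ‖u (T.rot t p)‖ ^ 2) +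
        ∫ t in (0 : ℝ)..(2 * Real.pi), ‖v (T.rot t p)‖ ^ 2 := by
  have h1 := (hasSum_fourier hu p).add (hasSum_fourier hv p)
  have h2 := hasSum_fourier (hu.add hv) p
  have h3 : (fun k : ℤ => ‖T.fourier k (fun p => u p + v p) p‖ ^ 2) =
      fun k => ‖T.fourier k u p‖ ^ 2 + ‖T.fourier k v p‖ ^ 2 := by
    funext k
    rw [fourier_add k hu hv]
    rcases h k with h | h <;> simp [h]
  rw [h3] at h2
  have h4 := h2.unique h1
  rw [← mul_add] at h4
  exact mul_left_cancel₀ (inv_ne_zero Real.two_pi_pos.ne') h4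

/-! The projection to positive frequencies. -/

theorem norm_character (k : ℤ) (t : ℝ) : ‖character k t‖ = 1 := by
  have h : Complex.I * k * t = ((k * t : ℝ) : ℂ) * Complex.I := by push_cast; ring
  rw [character, h, Complex.norm_exp_ofReal_mul_I]

/-- The kernel `-(2π)⁻¹ ∑_{k ≥ m} k⁻² e^{-ikt}`. Averaging `V²u` with this weight is the projection
of `u` to the frequencies `k ≥ m`; passing through `V²u` makes the kernel continuous. -/
def positiveKernel (m : ℕ) (t : ℝ) : ℂ :=
  ∑' n : ℕ, (-(1 / (2 * Real.pi) * (1 / ((m + n : ℕ) : ℂ) ^ 2))) * character (-((m + n : ℕ) : ℤ)) t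

theorem summable_positiveKernel (m : ℕ) :
    Summable fun n : ℕ => ‖(-(1 / (2 * Real.pi) * (1 / ((m + n : ℕ) : ℂ) ^ 2)) : ℂ)‖ := by
  have h1 : Summable fun n : ℕ => 1 / ((n : ℝ) ^ 2) :=
    Real.summable_one_div_nat_pow.2 one_lt_two
  have h2 := ((summable_nat_add_iff m).2 h1).mul_left ‖(1 / (2 * Real.pi) : ℂ)‖
  refine h2.congr fun n => ?_
  rw [norm_neg, norm_mul, norm_div, norm_div 1 (_ ^ 2), norm_pow, Complex.norm_natCast, norm_one,
    add_comm m n]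

theorem continuous_positiveKernel (m : ℕ) : Continuous (positiveKernel m) := by
  refine continuous_tsum (fun n => continuous_const.mul (continuous_character _))
    (summable_positiveKernel m) fun n t => ?_
  rw [norm_mul, norm_character, mul_one]

theorem integral_positiveKernel {m : ℕ} (hm : 1 ≤ m) (j : ℤ) :
    (∫ t in (0 : ℝ)..(2 * Real.pi), positiveKernel m t * character j t) =
      if (m : ℤ) ≤ j then -(1 / (j : ℂ) ^ 2) else 0 := by
  set a : ℕ → ℂ := fun n => -(1 / (2 * Real.pi) * (1 / ((m + n : ℕ) : ℂ) ^ 2)) with ha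
  have hpi : (Real.pi : ℂ) ≠ 0 := by exact_mod_cast Real.pi_ne_zero
  have hs := summable_positiveKernel m
  have h := intervalIntegral.hasSum_integral_of_dominated_convergence (μ := volume)
    (a := 0) (b := 2 * Real.pi) (F := fun n t => a n * character (j - ((m + n : ℕ) : ℤ)) t)
    (f := fun t => positiveKernel m t * character j t) (fun n _ => ‖a n‖)
    (fun n => (continuous_const.mul (continuous_character _)).aestronglyMeasurable)
    (fun n => Filter.Eventually.of_forall fun t _ => by
      rw [norm_mul, norm_character, mul_one])
    (Filter.Eventually.of_forall fun t _ => hs)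
    (continuous_const.intervalIntegrable _ _)
    (Filter.Eventually.of_forall fun t _ => by
      have h1 : Summable fun n => a n * character (-((m + n : ℕ) : ℤ)) t :=
        Summable.of_norm (hs.congr fun n => by rw [norm_mul, norm_character, mul_one])
      refine (h1.hasSum.mul_right (character j t)).congr_fun fun n => ?_
      rw [mul_assoc, character_mul]
      congr 2
      ring)
  simp only [intervalIntegral.integral_const_mul, integral_character] at h
  refine h.unique ?_
  split_ifs with hj
  · obtain ⟨n, rfl⟩ : ∃ n : ℕ, j = ((m + n : ℕ) : ℤ) := ⟨(j - m).toNat, by omega⟩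
    have hne : ((m + n : ℕ) : ℂ) ≠ 0 := by
      rw [Nat.cast_ne_zero]
      omega
    refine (hasSum_ite_eq n (-(1 / (((m + n : ℕ) : ℤ) : ℂ) ^ 2))).congr_fun fun k => ?_
    by_cases hk : k = n
    · subst hk
      simp only [sub_self, if_true, ha, Int.cast_natCast]
      field_simp
    · rw [if_neg (by omega), if_neg hk, mul_zero]
  · refine hasSum_zero.congr_fun fun k => ?_
    rw [if_neg (by omega), mul_zero]

/-- The projection to the frequencies `k ≥ m`. -/
def positivePart (m : ℕ) (u : T.SM → ℂ) : T.SM → ℂ := fibreConv (positiveKernel m) (T.V (T.V u))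

theorem isSmooth_positivePart (m : ℕ) (hu : T.IsSmooth u) : T.IsSmooth (positivePart m u) :=
  isSmooth_fibreConv (continuous_positiveKernel m) (T.isSmooth_V (T.isSmooth_V hu))

theorem fourier_positivePart {m : ℕ} (hm : 1 ≤ m) (hu : T.IsSmooth u) (j : ℤ) (p : T.SM) :
    T.fourier j (positivePart m u) p = if (m : ℤ) ≤ j then T.fourier j u p else 0 := by
  rw [positivePart, fourier_fibreConv (continuous_positiveKernel m) (T.isSmooth_V (T.isSmooth_V hu)),
    fourier_V _ (T.isSmooth_V hu), fourier_V _ hu, integral_positiveKernel hm]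
  split_ifs with hj
  · have hne : (j : ℂ) ≠ 0 := by
      rw [Int.cast_ne_zero]
      omega
    field_simp
    rw [Complex.I_sq]
    ring
  · rw [zero_mul]

end GaussianThermostat

/-! ### The operators `X`, `X_⊥`, `η_±` and `μ_±` -/

namespace GaussianThermostat

variable {M : Type*} [TopologicalSpace M] [ChartedSpace Plane M] [IsManifold (𝓡 2) ∞ M]
variable {T : GaussianThermostat M} {u v : T.SM → ℂ}

theorem X_const_mul (a : ℂ) (hu : T.IsSmooth u) (p : T.SM) :
    T.X (fun p => a * u p) p = a * T.X u p := by
  rw [X_mul (isSmooth_const a) hu, X_const, zero_mul, zero_add]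

theorem V_const_mul (a : ℂ) (hu : T.IsSmooth u) (p : T.SM) :
    T.V (fun p => a * u p) p = a * T.V u p := by
  rw [V_mul (isSmooth_const a) hu, V_const, zero_mul, zero_add]

theorem sub_eq_add_neg_one_mul (u v : T.SM → ℂ) :
    (fun p => u p - v p) = fun p => u p + (-1) * v p := by
  funext p
  ring

theorem X_sub (hu : T.IsSmooth u) (hv : T.IsSmooth v) (p : T.SM) :
    T.X (fun p => u p - v p) p = T.X u p - T.X v p := by
  rw [sub_eq_add_neg_one_mul, X_add hu (hv.const_mul _), X_const_mul _ hv]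
  ring

theorem V_sub (hu : T.IsSmooth u) (hv : T.IsSmooth v) (p : T.SM) :
    T.V (fun p => u p - v p) p = T.V u p - T.V v p := by
  rw [sub_eq_add_neg_one_mul, V_add hu (hv.const_mul _), V_const_mul _ hv]
  ring

theorem Xperp_add (hu : T.IsSmooth u) (hv : T.IsSmooth v) (p : T.SM) :
    T.Xperp (fun p => u p + v p) p = T.Xperp u p + T.Xperp v p := by
  rw [Xperp, funext (V_add hu hv), funext (X_add hu hv), X_add (T.isSmooth_V hu) (T.isSmooth_V hv),
    V_add (T.isSmooth_X hu) (T.isSmooth_X hv), Xperp, Xperp]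
  ring

theorem Xperp_mul (hu : T.IsSmooth u) (hv : T.IsSmooth v) (p : T.SM) :
    T.Xperp (fun p => u p * v p) p = T.Xperp u p * v p + u p * T.Xperp v p := by
  have hXu := T.isSmooth_X hu
  have hXv := T.isSmooth_X hv
  have hVu := T.isSmooth_V hu
  have hVv := T.isSmooth_V hv
  rw [Xperp, funext (V_mul hu hv), funext (X_mul hu hv), X_add (hVu.mul hv) (hu.mul hVv),
    V_add (hXu.mul hv) (hu.mul hXv), X_mul hVu hv, X_mul hu hVv, V_mul hXu hv, V_mul hu hXv,
    Xperp, Xperp]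
  ring

theorem Xperp_const_mul (a : ℂ) (hu : T.IsSmooth u) (p : T.SM) :
    T.Xperp (fun p => a * u p) p = a * T.Xperp u p := by
  rw [Xperp, funext (V_const_mul a hu), funext (X_const_mul a hu),
    X_const_mul _ (T.isSmooth_V hu), V_const_mul _ (T.isSmooth_X hu), Xperp]
  ring

theorem Xperp_sub (hu : T.IsSmooth u) (hv : T.IsSmooth v) (p : T.SM) :
    T.Xperp (fun p => u p - v p) p = T.Xperp u p - T.Xperp v p := by
  rw [sub_eq_add_neg_one_mul, Xperp_add hu (hv.const_mul _), Xperp_const_mul _ hv]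
  ring

theorem Xperp_conj (hu : T.IsSmooth u) (p : T.SM) :
    T.Xperp (fun p => (starRingEnd ℂ) (u p)) p = (starRingEnd ℂ) (T.Xperp u p) := by
  rw [Xperp, funext (V_conj hu), funext (X_conj hu), X_conj (T.isSmooth_V hu),
    V_conj (T.isSmooth_X hu), Xperp, map_sub]

theorem V_X (p : T.SM) (u : T.SM → ℂ) : T.V (T.X u) p = T.X (T.V u) p - T.Xperp u p := by
  rw [Xperp]
  ring

/-! The operators `η_±` -/

theorem isSmooth_etaPlus (hu : T.IsSmooth u) : T.IsSmooth (T.etaPlus u) := by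
  have h := ((T.isSmooth_X hu).add ((T.isSmooth_Xperp hu).const_mul Complex.I)).const_mul (1 / 2)
  refine (congrArg T.IsSmooth (funext fun p => ?_)).mp h
  rw [etaPlus]
  ring

theorem etaMinus_conj (hu : T.IsSmooth u) (p : T.SM) :
    T.etaMinus (fun p => (starRingEnd ℂ) (u p)) p = (starRingEnd ℂ) (T.etaPlus u p) := by
  rw [etaMinus, etaPlus, X_conj hu, Xperp_conj hu, map_div₀, map_ofNat]
  simp [sub_eq_add_neg]

theorem etaPlus_conj (hu : T.IsSmooth u) (p : T.SM) :
    T.etaPlus (fun p => (starRingEnd ℂ) (u p)) p = (starRingEnd ℂ) (T.etaMinus u p) := by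
  rw [etaMinus, etaPlus, X_conj hu, Xperp_conj hu, map_div₀, map_ofNat]
  simp [sub_eq_add_neg]

theorem etaPlus_sub (hu : T.IsSmooth u) (hv : T.IsSmooth v) (p : T.SM) :
    T.etaPlus (fun p => u p - v p) p = T.etaPlus u p - T.etaPlus v p := by
  simp only [etaPlus, X_sub hu hv, Xperp_sub hu hv]
  ring

theorem etaPlus_const_mul (a : ℂ) (hu : T.IsSmooth u) (p : T.SM) :
    T.etaPlus (fun p => a * u p) p = a * T.etaPlus u p := by
  simp only [etaPlus, X_const_mul a hu, Xperp_const_mul a hu]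
  ring

theorem etaPlus_add_etaMinus (u : T.SM → ℂ) (p : T.SM) :
    T.etaPlus u p + T.etaMinus u p = T.X u p := by
  rw [etaPlus, etaMinus]
  ring

/-- The commutator `[V, η_+] = iη_+`. -/
theorem V_etaPlus (hu : T.IsSmooth u) (p : T.SM) :
    T.V (T.etaPlus u) p = T.etaPlus (T.V u) p + Complex.I * T.etaPlus u p := by
  have h : T.etaPlus u = fun p => (1 / 2) * (T.X u p + Complex.I * T.Xperp u p) := by
    funext p
    rw [etaPlus]
    ring
  rw [h, V_const_mul _ ((T.isSmooth_X hu).add ((T.isSmooth_Xperp hu).const_mul _)),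
    V_add (T.isSmooth_X hu) ((T.isSmooth_Xperp hu).const_mul _),
    V_const_mul _ (T.isSmooth_Xperp hu), V_X, T.V_Xperp hu, etaPlus]
  linear_combination (-1 / 2) * T.Xperp u p * Complex.I_sq

/-! The field `λ` and the operators `μ_±` -/

theorem conj_lam (p : T.SM) : (starRingEnd ℂ) (T.lam p) = T.lam p := Complex.conj_ofReal _

theorem conj_V_lam (p : T.SM) : (starRingEnd ℂ) (T.V T.lam p) = T.V T.lam p := by
  rw [← V_conj T.isSmooth_lam, funext conj_lam]

/-- Since `V²λ = -λ`, only the frequencies `±1` occur in `λ`. -/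
theorem fourier_one_lam (p : T.SM) :
    T.fourier 1 T.lam p = (T.lam p - Complex.I * T.V T.lam p) / 2 := by
  have hl := T.isSmooth_lam
  have hV := T.isSmooth_V hl
  have h2 : T.fourier 1 (fun p => T.lam p + Complex.I * T.V T.lam p) p = 0 := by
    rw [fourier_of_V_eq (k := -1) (hl.add (hV.const_mul _)), if_neg (by norm_num)]
    intro q
    rw [V_add hl (hV.const_mul _), V_const_mul _ hV, T.V_V_lam]
    push_cast
    linear_combination T.V T.lam q * Complex.I_sq
  have h1 : T.fourier 1 (fun p => T.lam p - Complex.I * T.V T.lam p) p =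
      T.lam p - Complex.I * T.V T.lam p := by
    rw [fourier_of_V_eq (k := 1) (hl.sub (hV.const_mul _)), if_pos rfl]
    intro q
    rw [V_sub hl (hV.const_mul _), V_const_mul _ hV, T.V_V_lam]
    push_cast
    linear_combination T.V T.lam q * Complex.I_sq
  rw [fourier_add _ hl (hV.const_mul _)] at h2
  rw [fourier_sub _ hl (hV.const_mul _)] at h1
  linear_combination (1 / 2) * h1 + (1 / 2) * h2

theorem conj_fourier_one_lam (p : T.SM) :
    (starRingEnd ℂ) (T.fourier 1 T.lam p) = T.fourier (-1) T.lam p := by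
  have h := fourier_conj (-1) T.lam p
  rw [funext conj_lam, neg_neg] at h
  exact h.symm

theorem fourier_neg_one_lam (p : T.SM) :
    T.fourier (-1) T.lam p = (T.lam p + Complex.I * T.V T.lam p) / 2 := by
  rw [← conj_fourier_one_lam, fourier_one_lam, map_div₀, map_ofNat]
  simp [conj_lam, conj_V_lam]

theorem isSmooth_muPlus (hu : T.IsSmooth u) : T.IsSmooth (T.muPlus u) :=
  (isSmooth_etaPlus hu).add ((isSmooth_fourier 1 T.isSmooth_lam).mul (T.isSmooth_V hu))

theorem muMinus_conj (hu : T.IsSmooth u) (p : T.SM) :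
    T.muMinus (fun p => (starRingEnd ℂ) (u p)) p = (starRingEnd ℂ) (T.muPlus u p) := by
  rw [muMinus, muPlus, etaMinus_conj hu, V_conj hu, map_add, map_mul, conj_fourier_one_lam]

theorem muPlus_conj (hu : T.IsSmooth u) (p : T.SM) :
    T.muPlus (fun p => (starRingEnd ℂ) (u p)) p = (starRingEnd ℂ) (T.muMinus u p) := by
  rw [muMinus, muPlus, etaPlus_conj hu, V_conj hu, map_add, map_mul, ← conj_fourier_one_lam,
    Complex.conj_conj]

theorem muPlus_add_muMinus (u : T.SM → ℂ) (p : T.SM) :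
    T.muPlus u p + T.muMinus u p = T.G u p := by
  rw [muPlus, muMinus, G, ← etaPlus_add_etaMinus, fourier_one_lam, fourier_neg_one_lam]
  ring

theorem muPlus_sub (hu : T.IsSmooth u) (hv : T.IsSmooth v) (p : T.SM) :
    T.muPlus (fun p => u p - v p) p = T.muPlus u p - T.muPlus v p := by
  simp only [muPlus, etaPlus_sub hu hv, V_sub hu hv]
  ring

theorem muPlus_const_mul (a : ℂ) (hu : T.IsSmooth u) (p : T.SM) :
    T.muPlus (fun p => a * u p) p = a * T.muPlus u p := by
  simp only [muPlus, etaPlus_const_mul a hu, V_const_mul a hu]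
  ring

theorem muMinus_const_mul (a : ℂ) (hu : T.IsSmooth u) (p : T.SM) :
    T.muMinus (fun p => a * u p) p = a * T.muMinus u p := by
  simp only [muMinus, etaMinus, X_const_mul a hu, Xperp_const_mul a hu, V_const_mul a hu]
  ring

/-- The commutator `[V, μ_+] = iμ_+`. -/
theorem V_muPlus (hu : T.IsSmooth u) (p : T.SM) :
    T.V (T.muPlus u) p = T.muPlus (T.V u) p + Complex.I * T.muPlus u p := by
  have hl := isSmooth_fourier 1 T.isSmooth_lam
  have h : T.muPlus u = fun p => T.etaPlus u p + T.fourier 1 T.lam p * T.V u p := rfl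
  rw [h, V_add (isSmooth_etaPlus hu) (hl.mul (T.isSmooth_V hu)), V_mul hl (T.isSmooth_V hu),
    V_etaPlus hu, V_fourier, muPlus]
  push_cast
  ring

/-- The operators `η_+` and `μ_+` raise frequencies by one. -/
theorem fourier_etaPlus (hu : T.IsSmooth u) (k : ℤ) (p : T.SM) :
    T.fourier (k + 1) (T.etaPlus u) p = T.etaPlus (T.fourier k u) p :=
  fourier_of_commutator (fun _ => isSmooth_etaPlus) (fun _ _ => etaPlus_sub)
    (fun a _ => etaPlus_const_mul a) (fun u hu p => by rw [V_etaPlus hu]; push_cast; ring) hu k p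

theorem fourier_muPlus (hu : T.IsSmooth u) (k : ℤ) (p : T.SM) :
    T.fourier (k + 1) (T.muPlus u) p = T.muPlus (T.fourier k u) p :=
  fourier_of_commutator (fun _ => isSmooth_muPlus) (fun _ _ => muPlus_sub)
    (fun a _ => muPlus_const_mul a) (fun u hu p => by rw [V_muPlus hu]; push_cast; ring) hu k p

theorem conj_conj_fun (u : T.SM → ℂ) :
    (fun p => (starRingEnd ℂ) ((fun p => (starRingEnd ℂ) (u p)) p)) = u :=
  funext fun p => Complex.conj_conj (u p)

theorem isSmooth_etaMinus (hu : T.IsSmooth u) : T.IsSmooth (T.etaMinus u) := by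
  have h := (isSmooth_etaPlus hu.conj).conj
  rwa [← funext (etaMinus_conj hu.conj), conj_conj_fun] at h

theorem isSmooth_muMinus (hu : T.IsSmooth u) : T.IsSmooth (T.muMinus u) := by
  have h := (isSmooth_muPlus hu.conj).conj
  rwa [← funext (muMinus_conj hu.conj), conj_conj_fun] at h

/-- The operators `η_-` and `μ_-` lower frequencies by one. -/
theorem fourier_etaMinus (hu : T.IsSmooth u) (k : ℤ) (p : T.SM) :
    T.fourier (k - 1) (T.etaMinus u) p = T.etaMinus (T.fourier k u) p := by
  have h := fourier_etaPlus hu.conj (-k) p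
  rw [funext (etaPlus_conj hu), fourier_conj, funext (fourier_conj (-k) u), neg_neg,
    etaPlus_conj (isSmooth_fourier k hu), neg_add, neg_neg] at h
  simpa [← sub_eq_add_neg] using congrArg (starRingEnd ℂ) h

theorem fourier_muMinus (hu : T.IsSmooth u) (k : ℤ) (p : T.SM) :
    T.fourier (k - 1) (T.muMinus u) p = T.muMinus (T.fourier k u) p := by
  have h := fourier_muPlus hu.conj (-k) p
  rw [funext (muPlus_conj hu), fourier_conj, funext (fourier_conj (-k) u), neg_neg,
    muPlus_conj (isSmooth_fourier k hu), neg_add, neg_neg] at h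
  simpa [← sub_eq_add_neg] using congrArg (starRingEnd ℂ) h

end GaussianThermostat

/-! ### Integration in charts -/

namespace LocalSurface

open MeasureTheory

variable {Ω : Set Plane} (S : LocalSurface Ω)

theorem contDiffOn_sqrt_det : ContDiffOn ℝ ∞ (fun y => √(S.det y)) Ω := by
  have h : ∀ a b : Plane, ContDiffOn ℝ ∞ (fun y => S.g y a b) Ω := fun a b =>
    (S.g_smooth.clm_apply contDiffOn_const).clm_apply contDiffOn_const
  exact (((h _ _).mul (h _ _)).sub ((h _ _).pow 2)).sqrt fun y hy => (S.det_pos hy).ne'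

/-- The divergence theorem for vector fields with compact support in the domain of a chart. -/
theorem integral_divergence {e : Plane → Plane} (he : ContDiffOn ℝ ∞ e Ω) {K : Set Plane}
    (hK : IsCompact K) (hKΩ : K ⊆ Ω) (heK : ∀ y ∈ Ω, y ∉ K → e y = 0) :
    ∫ y in Ω, √(S.det y) * S.divergence e y = 0 := by
  let F : Fin 2 → Plane → ℝ := fun i => Ω.indicator fun y => √(S.det y) * e y i
  have hF0 : ∀ i y, y ∉ K → F i y = 0 := by
    intro i y hy
    by_cases hyΩ : y ∈ Ω
    · simp [F, hyΩ, heK y hyΩ hy]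
    · simp [F, hyΩ]
  have hFeq : ∀ i, ∀ y ∈ Ω, F i =ᶠ[nhds y] fun y => √(S.det y) * e y i := by
    intro i y hy
    filter_upwards [S.isOpen.mem_nhds hy] with z hz
    simp [F, hz]
  have hFK : ∀ i, ∀ y ∉ Ω, F i =ᶠ[nhds y] fun _ => 0 := by
    intro i y hy
    filter_upwards [hK.isClosed.isOpen_compl.mem_nhds fun h => hy (hKΩ h)] with z hz
    exact hF0 i z hz
  have hF : ∀ i, ContDiff ℝ ∞ (F i) := by
    intro i
    rw [contDiff_iff_contDiffAt]
    intro y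
    by_cases hy : y ∈ Ω
    · refine ContDiffAt.congr_of_eventuallyEq ?_ (hFeq i y hy)
      have h1 : ContDiffOn ℝ ∞ (fun y => e y i) Ω :=
        (EuclideanSpace.proj i : Plane →L[ℝ] ℝ).contDiff.comp_contDiffOn he
      exact (S.contDiffOn_sqrt_det.mul h1).contDiffAt (S.isOpen.mem_nhds hy)
    · exact contDiffAt_const.congr_of_eventuallyEq (hFK i y hy)
  have hcs : ∀ i, HasCompactSupport (F i) := fun i =>
    HasCompactSupport.intro hK fun y hy => hF0 i y hy
  have hint : ∀ i, Integrable (F i) := fun i =>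
    (hF i).continuous.integrable_of_hasCompactSupport (hcs i)
  have hint' : ∀ i, Integrable fun y => fderiv ℝ (F i) y (stdVec i) := by
    intro i
    refine Continuous.integrable_of_hasCompactSupport ?_ ?_
    · exact ((hF i).continuous_fderiv (by simp)).clm_apply continuous_const
    · exact (hcs i).fderiv_apply (𝕜 := ℝ) (stdVec i)
  have hzero : ∀ i, ∫ y, fderiv ℝ (F i) y (stdVec i) = 0 := by
    intro i
    have h := integral_mul_fderiv_eq_neg_fderiv_mul_of_integrable (μ := volume) (𝕜 := ℝ)
      (f := fun _ : Plane => (1 : ℝ)) (g := F i) (v := stdVec i) (by simp)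
      (by simpa using hint' i) (by simpa using hint i) (fun _ _ => differentiableAt_const _)
      (fun y _ => (hF i).differentiable (by simp) y)
    simpa using h
  have hkey : ∀ y ∈ Ω, √(S.det y) * S.divergence e y = ∑ i, fderiv ℝ (F i) y (stdVec i) := by
    intro y hy
    rw [← S.divergence_eq hy he, mul_div_cancel₀ _ (Real.sqrt_pos.2 (S.det_pos hy)).ne']
    exact Finset.sum_congr rfl fun i _ => by rw [(hFeq i y hy).fderiv_eq]
  rw [setIntegral_congr_fun S.isOpen.measurableSet hkey,
    setIntegral_eq_integral_of_forall_compl_eq_zero, integral_finsetSum _ fun i _ => hint' i]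
  · exact Finset.sum_eq_zero fun i _ => hzero i
  · intro y hy
    refine Finset.sum_eq_zero fun i _ => ?_
    rw [(hFK i y hy).fderiv_eq]
    simp

end LocalSurface

namespace GaussianThermostat

open LocalSurface MeasureTheory

variable {M : Type*} [TopologicalSpace M] [ChartedSpace Plane M] [IsManifold (𝓡 2) ∞ M]
variable (T : GaussianThermostat M) {c c' : M} {f h : M → ℂ}

/-- The area integral of a function over the domain of the chart at `c`. -/
def chartIntegral (c : M) (f : M → ℂ) : ℂ :=
  ∫ y in chartTarget c, √(T.gram c y).det • f ((extChartAt (𝓡 2) c).symm y)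

theorem continuousOn_sqrt_det (c : M) : ContinuousOn (fun y => √(T.gram c y).det) (chartTarget c) := by
  simp only [← det_eq]
  exact (T.localSurface c).contDiffOn_sqrt_det.continuousOn

section

variable [CompactSpace M]

/-- A compact set of coordinates which contains the support of a function. -/
theorem exists_compact_support (hf : tsupport f ⊆ (extChartAt (𝓡 2) c).source) :
    ∃ K : Set Plane, IsCompact K ∧ K ⊆ chartTarget c ∧
      ∀ y ∈ chartTarget c, y ∉ K → f ((extChartAt (𝓡 2) c).symm y) = 0 := by
  refine ⟨extChartAt (𝓡 2) c '' tsupport f, ?_, ?_, ?_⟩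
  · exact (isClosed_tsupport f).isCompact.image_of_continuousOn
      ((continuousOn_extChartAt c).mono hf)
  · rintro _ ⟨x, hx, rfl⟩
    exact (extChartAt (𝓡 2) c).map_source (hf hx)
  · intro y hy hyK
    by_contra hne
    exact hyK ⟨_, subset_tsupport f hne, (extChartAt (𝓡 2) c).right_inv hy⟩

theorem integrableOn_chart (hf : Continuous f) (hs : tsupport f ⊆ (extChartAt (𝓡 2) c).source) :
    IntegrableOn (fun y => √(T.gram c y).det • f ((extChartAt (𝓡 2) c).symm y))
      (chartTarget c) := by
  obtain ⟨K, hK, hKc, hK0⟩ := exists_compact_support hs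
  have h1 : IntegrableOn (fun y => √(T.gram c y).det • f ((extChartAt (𝓡 2) c).symm y)) K := by
    refine ContinuousOn.integrableOn_compact hK ?_
    exact ((T.continuousOn_sqrt_det c).mono hKc).smul
      (hf.comp_continuousOn ((continuousOn_extChartAt_symm c).mono hKc))
  refine h1.of_forall_sdiff_eq_zero (isOpen_chartTarget c).measurableSet fun y hy => ?_
  rw [hK0 y hy.1 hy.2, smul_zero]

theorem chartIntegral_add (hf : Continuous f) (hs : tsupport f ⊆ (extChartAt (𝓡 2) c).source)
    (hh : Continuous h) (hs' : tsupport h ⊆ (extChartAt (𝓡 2) c).source) :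
    T.chartIntegral c (fun x => f x + h x) = T.chartIntegral c f + T.chartIntegral c h := by
  rw [chartIntegral, chartIntegral, chartIntegral, ← integral_add (T.integrableOn_chart hf hs)
    (T.integrableOn_chart hh hs')]
  simp only [smul_add]

theorem chartIntegral_sum {ι : Type*} (s : Finset ι) {f : ι → M → ℂ} (hf : ∀ i, Continuous (f i))
    (hs : ∀ i, tsupport (f i) ⊆ (extChartAt (𝓡 2) c).source) :
    T.chartIntegral c (fun x => ∑ i ∈ s, f i x) = ∑ i ∈ s, T.chartIntegral c (f i) := by
  simp only [chartIntegral, Finset.smul_sum]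
  exact integral_finsetSum s fun i _ => T.integrableOn_chart (hf i) (hs i)

end

theorem chartIntegral_const_mul (a : ℂ) (f : M → ℂ) :
    T.chartIntegral c (fun x => a * f x) = a * T.chartIntegral c f := by
  rw [chartIntegral, chartIntegral, ← integral_const_mul]
  simp only [mul_smul_comm]

/-! Change of charts -/

theorem transition_injOn : Set.InjOn (transition c c') (overlap c c') := by
  intro y hy z hz h
  have h1 := (extChartAt (𝓡 2) c').injOn hy.2 hz.2 h
  rw [← (extChartAt (𝓡 2) c).right_inv hy.1, h1, (extChartAt (𝓡 2) c).right_inv hz.1]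

theorem transition_symm {y : Plane} (hy : y ∈ overlap c c') :
    (extChartAt (𝓡 2) c').symm (transition c c' y) = (extChartAt (𝓡 2) c).symm y :=
  (extChartAt (𝓡 2) c').left_inv hy.2

theorem transition_image : transition c c' '' overlap c c' = overlap c' c := by
  ext z
  constructor
  · rintro ⟨y, hy, rfl⟩
    refine ⟨transition_mem hy, ?_⟩
    rw [Set.mem_preimage, transition_symm hy]
    exact (extChartAt (𝓡 2) c).map_target hy.1
  · intro hz
    refine ⟨transition c' c z, ⟨transition_mem hz, ?_⟩, ?_⟩
    · rw [Set.mem_preimage, transition_symm hz]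
      exact (extChartAt (𝓡 2) c').map_target hz.1
    · rw [transition, transition_symm hz]
      exact (extChartAt (𝓡 2) c').right_inv hz.1

theorem sqrt_det_transition {y : Plane} (hy : y ∈ overlap c c') :
    √(T.gram c y).det =
      |(fderiv ℝ (transition c c') y).det| * √(T.gram c' (transition c c' y)).det := by
  set L := fderiv ℝ (transition c c') y with hL
  have h : (T.gram c y).det = L.det ^ 2 * (T.gram c' (transition c c' y)).det := by
    have hA : ∀ i, L (stdVec i) = L (stdVec i) 0 • stdVec 0 + L (stdVec i) 1 • stdVec 1 := fun i =>
      LocalSurface.eq_sum_stdVec _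
    have hdet : L.det = L (stdVec 0) 0 * L (stdVec 1) 1 - L (stdVec 1) 0 * L (stdVec 0) 1 := by
      have h1 := LinearMap.det_toMatrix (EuclideanSpace.basisFun (Fin 2) ℝ).toBasis L.toLinearMap
      rw [Matrix.det_fin_two] at h1
      simp only [LinearMap.toMatrix_apply] at h1
      rw [ContinuousLinearMap.det]
      refine h1.symm.trans ?_
      simp [stdVec]
    have hg : ∀ i j, T.gram c y i j = T.chartG c' (transition c c' y) (L (stdVec i)) (L (stdVec j)) :=
      fun i j => by rw [← chartG_stdVec, T.chartG_transition hy]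
    rw [Matrix.det_fin_two, Matrix.det_fin_two, hg, hg, hg, hg, hA 0, hA 1, hdet]
    simp only [map_add, map_smul, add_apply, smul_apply, smul_eq_mul, chartG_stdVec]
    rw [T.gram_symm c' _ 1 0]
    simp [stdVec]
    ring
  rw [h, Real.sqrt_mul (sq_nonneg _), Real.sqrt_sq_eq_abs]

/-- The area integral of a function supported in two charts is the same in both charts. -/
theorem chartIntegral_eq (hc : ∀ x, x ∉ (extChartAt (𝓡 2) c).source → f x = 0)
    (hc' : ∀ x, x ∉ (extChartAt (𝓡 2) c').source → f x = 0) :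
    T.chartIntegral c f = T.chartIntegral c' f := by
  have key : ∀ c c' : M, (∀ x, x ∉ (extChartAt (𝓡 2) c').source → f x = 0) →
      T.chartIntegral c f =
        ∫ y in overlap c c', √(T.gram c y).det • f ((extChartAt (𝓡 2) c).symm y) := by
    intro c c' hc'
    refine (setIntegral_eq_of_subset_of_forall_sdiff_eq_zero
      (isOpen_chartTarget c).measurableSet Set.inter_subset_left fun y hy => ?_)
    rw [hc', smul_zero]
    exact fun h => hy.2 ⟨hy.1, h⟩
  rw [key c c' hc', key c' c hc, ← transition_image (c := c) (c' := c'),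
    integral_image_eq_integral_abs_det_fderiv_smul volume (isOpen_overlap c c').measurableSet
      (f' := fun y => fderiv ℝ (transition c c') y) _ transition_injOn]
  · refine setIntegral_congr_fun (isOpen_overlap c c').measurableSet fun y hy => ?_
    rw [transition_symm hy, T.sqrt_det_transition hy, mul_smul]
  · intro y hy
    exact (((contDiffOn_transition c c').contDiffAt ((isOpen_overlap c c').mem_nhds hy)).differentiableAt
      (by simp)).hasFDerivAt.hasFDerivWithinAt

/-! The integral over the surface -/

section

variable [CompactSpace M] [T2Space M]

/-- The functions of the partition of unity which do not vanish identically. -/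
theorem finite_partition : {c : M | (Function.support (partitionOfUnity M c)).Nonempty}.Finite :=
  (partitionOfUnity M).locallyFinite.finite_nonempty_of_compact

variable (M) in
/-- The centres of the charts which are used in the definition of the integral. -/
def centres : Finset M := (finite_partition (M := M)).toFinset

theorem partition_eq_zero (hc : c ∉ centres M) (x : M) : partitionOfUnity M c x = 0 := by
  by_contra h
  exact hc ((finite_partition (M := M)).mem_toFinset.2 ⟨x, h⟩)

theorem sum_partition (x : M) : ∑ c ∈ centres M, partitionOfUnity M c x = 1 := by
  rw [← (partitionOfUnity M).sum_eq_one (Set.mem_univ x)]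
  refine (finsum_eq_sum_of_support_subset _ fun c hc => ?_).symm
  by_contra h
  exact hc (partition_eq_zero h x)

theorem continuous_partition (c : M) : Continuous fun x => ((partitionOfUnity M c x : ℝ) : ℂ) :=
  Complex.continuous_ofReal.comp (partitionOfUnity M c).contMDiff.continuous

theorem tsupport_partition_mul (c : M) (f : M → ℂ) :
    tsupport (fun x => ((partitionOfUnity M c x : ℝ) : ℂ) * f x) ⊆
      (extChartAt (𝓡 2) c).source := by
  have h := (SmoothPartitionOfUnity.exists_isSubordinate_chartAt_source (𝓡 2) M).choose_spec c
  rw [extChartAt_source]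
  refine Set.Subset.trans (closure_mono fun x hx => ?_) h
  intro h0
  apply hx
  change ((partitionOfUnity M c x : ℝ) : ℂ) * f x = 0
  rw [show partitionOfUnity M c x = 0 from h0, Complex.ofReal_zero, zero_mul]

theorem areaIntegral_eq (f : M → ℂ) : T.areaIntegral f =
    ∑ c ∈ centres M, T.chartIntegral c fun x => ((partitionOfUnity M c x : ℝ) : ℂ) * f x := by
  rw [areaIntegral, finsum_eq_sum_of_support_subset (s := centres M)]
  · refine Finset.sum_congr rfl fun c _ => ?_
    rw [chartIntegral]
    congr 1
    funext y
    rw [mul_comm, mul_smul, ← Complex.real_smul]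
  · intro c hc
    by_contra h
    apply hc
    simp [partition_eq_zero h]

theorem areaIntegral_add (hf : Continuous f) (hh : Continuous h) :
    T.areaIntegral (fun x => f x + h x) = T.areaIntegral f + T.areaIntegral h := by
  simp only [areaIntegral_eq, ← Finset.sum_add_distrib, mul_add]
  refine Finset.sum_congr rfl fun c _ => ?_
  exact T.chartIntegral_add ((continuous_partition c).mul hf) (tsupport_partition_mul c f)
    ((continuous_partition c).mul hh) (tsupport_partition_mul c h)

theorem areaIntegral_const_mul (a : ℂ) (f : M → ℂ) :
    T.areaIntegral (fun x => a * f x) = a * T.areaIntegral f := by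
  simp only [areaIntegral_eq, Finset.mul_sum, mul_left_comm _ a, chartIntegral_const_mul]

/-- The integral of a function supported in a chart. -/
theorem areaIntegral_eq_chartIntegral (hf : Continuous f)
    (hs : tsupport f ⊆ (extChartAt (𝓡 2) c).source) : T.areaIntegral f = T.chartIntegral c f := by
  have h0 : ∀ x, x ∉ (extChartAt (𝓡 2) c).source → f x = 0 := fun x hx =>
    image_eq_zero_of_notMem_tsupport fun h => hx (hs h)
  have hs' : ∀ c', tsupport (fun x => ((partitionOfUnity M c' x : ℝ) : ℂ) * f x) ⊆
      (extChartAt (𝓡 2) c).source := fun c' => (tsupport_mul_subset_right).trans hs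
  rw [areaIntegral_eq]
  have h1 : ∀ c' : M, T.chartIntegral c' (fun x => ((partitionOfUnity M c' x : ℝ) : ℂ) * f x) =
      T.chartIntegral c (fun x => ((partitionOfUnity M c' x : ℝ) : ℂ) * f x) := by
    intro c'
    refine T.chartIntegral_eq (fun x hx => ?_) fun x hx => by rw [h0 x hx, mul_zero]
    exact image_eq_zero_of_notMem_tsupport
      (f := fun x => ((partitionOfUnity M c' x : ℝ) : ℂ) * f x)
      fun h => hx (tsupport_partition_mul c' f h)
  rw [Finset.sum_congr rfl fun c' _ => h1 c', ← T.chartIntegral_sum _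
    (f := fun c' x => ((partitionOfUnity M c' x : ℝ) : ℂ) * f x) (fun c' => (continuous_partition c').mul hf) hs']
  congr 1
  funext x
  rw [← Finset.sum_mul, ← Complex.ofReal_sum, sum_partition, Complex.ofReal_one, one_mul]

theorem areaIntegral_ofReal (f : M → ℝ) :
    ((T.areaIntegral f : ℝ) : ℂ) = T.areaIntegral fun x => (f x : ℂ) := by
  have h := AddMonoidHom.map_finsum_of_injective Complex.ofRealHom.toAddMonoidHom
    Complex.ofReal_injective fun c : M => ∫ y in (extChartAt (𝓡 2) c).target,
    (partitionOfUnity M c ((extChartAt (𝓡 2) c).symm y) * √(T.gram c y).det) •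
      f ((extChartAt (𝓡 2) c).symm y)
  refine h.trans (finsum_congr fun c => ?_)
  refine integral_ofReal.symm.trans ?_
  congr 1
  funext y
  rw [Complex.real_smul, smul_eq_mul, ← Complex.ofReal_mul]
  rfl

theorem areaIntegral_nonneg {f : M → ℝ} (hf : ∀ x, 0 ≤ f x) : 0 ≤ T.areaIntegral f :=
  finsum_nonneg fun c => integral_nonneg fun _ =>
    mul_nonneg (mul_nonneg ((partitionOfUnity M).nonneg c _) (Real.sqrt_nonneg _)) (hf _)

end

end GaussianThermostat

/-! ### Integration over the unit circle bundle -/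

namespace GaussianThermostat

open LocalSurface MeasureTheory

variable {M : Type*} [TopologicalSpace M] [ChartedSpace Plane M] [IsManifold (𝓡 2) ∞ M]
variable {T : GaussianThermostat M} {u v : T.SM → ℂ} {c : M}

/-- The circle action is transitive on the fibres. -/
theorem exists_rot_eq {p q : T.SM} (h : p.base = q.base) : ∃ s, T.rot s q = p := by
  have hq := mem_extChartAt_source (I := 𝓡 2) q.base
  have hp : p.base ∈ (extChartAt (𝓡 2) q.base).source := h ▸ hq
  obtain ⟨y, w, hqw⟩ : ∃ y w, T.coord q.base q = (y, w) := ⟨_, _, rfl⟩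
  have hpw : T.coord q.base p = (y, (T.coord q.base p).2) := by
    refine Prod.ext ?_ rfl
    have h1 : (T.coord q.base q).1 = y := congrArg Prod.fst hqw
    rw [← h1]
    exact congrArg (extChartAt (𝓡 2) q.base) h
  set z := (T.coord q.base p).2 with hz
  have hdom := T.coord_mem hq
  have hNq := T.normSq_coord hq
  have hNp := T.normSq_coord hp
  rw [hqw] at hdom hNq
  rw [hpw] at hNp
  simp only at hNq hNp
  set S := T.localSurface q.base
  have hexp := S.expand hdom.1 hdom.2 z
  simp only at hexp
  rw [hNq, one_smul] at hexp
  set a := S.g y z w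
  set b := S.g y z (S.J y w)
  have hab : a ^ 2 + b ^ 2 = 1 := by
    have hJ : S.g y (S.J y w) (S.J y w) = 1 := (S.J_isometry y hdom.1 w w).trans hNq
    rw [hexp] at hNp
    simp only [map_add, map_smul, add_apply, smul_apply, smul_eq_mul, hNq, hJ,
      S.g_self_J hdom.1 w, S.g_J_self hdom.1 w] at hNp
    linear_combination hNp
  obtain ⟨s, hs⟩ := (Complex.norm_eq_one_iff (a + b * Complex.I)).1 (by
    rw [Complex.norm_add_mul_I, hab, Real.sqrt_one])
  have hsa : Real.cos s = a := by
    have := congrArg Complex.re hs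
    simpa [Complex.exp_ofReal_mul_I_re] using this
  have hsb : Real.sin s = b := by
    have := congrArg Complex.im hs
    simpa [Complex.exp_ofReal_mul_I_im] using this
  refine ⟨s, Subtype.ext ?_⟩
  rw [T.rot_val hq, hqw, ← T.ofCoord_coord hp, hpw]
  simp only
  rw [hsa, hsb]
  exact congrArg (ofCoord q.base y) hexp.symm

theorem fibreIntegral_eq (u : T.SM → ℂ) (p : T.SM) :
    T.fibreIntegral u p.base = fibreConv (fun _ => 1) u p := by
  obtain ⟨s, hs⟩ := exists_rot_eq (p := p) (q := T.unitAt p.base) rfl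
  have h3 := (rot_periodic u (T.unitAt p.base)).intervalIntegral_add_eq s 0
  have h4 : fibreConv (fun _ => 1) u p =
      ∫ t in (0 : ℝ)..(2 * Real.pi), u (T.rot (t + s) (T.unitAt p.base)) := by
    conv_lhs => rw [← hs, fibreConv_rot]
    simp only [one_mul]
  rw [h4, intervalIntegral.integral_comp_add_right (fun t => u (T.rot t (T.unitAt p.base))),
    zero_add, add_comm (2 * Real.pi) s, h3, zero_add]
  rfl

theorem fibreIntegral_eq_fourier (u : T.SM → ℂ) (p : T.SM) :
    T.fibreIntegral u p.base = 2 * Real.pi * T.fourier 0 u p := by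
  have hpi : (Real.pi : ℂ) ≠ 0 := by exact_mod_cast Real.pi_ne_zero
  rw [fibreIntegral_eq, fourier_eq, fibreConv, ← mul_assoc, mul_one_div_cancel (by simp [hpi])]
  simp [character_zero_left]

theorem fibreIntegral_symm {y : Plane} (hy : y ∈ chartTarget c) (u : T.SM → ℂ) :
    T.fibreIntegral u ((extChartAt (𝓡 2) c).symm y) =
      T.coordFun c (fibreConv (fun _ => 1) u) (y, stdVec 0) := by
  have hz : (y, stdVec 0) ∈ domain (chartTarget c) := ⟨hy, stdVec_ne_zero 0⟩
  rw [T.coordFun_eq hz, ← fibreIntegral_eq]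
  rfl

theorem continuous_fibreIntegral (hu : T.IsSmooth u) : Continuous (T.fibreIntegral u) := by
  rw [continuous_iff_continuousAt]
  intro x
  have h1 : ContinuousOn (fun y => T.fibreIntegral u ((extChartAt (𝓡 2) x).symm y))
      (chartTarget x) := by
    refine ContinuousOn.congr ?_ fun y hy => fibreIntegral_symm hy u
    refine (T.contDiffOn_coordFun (isSmooth_fibreConv continuous_const hu) x).continuousOn.comp
      (continuous_id.prodMk continuous_const).continuousOn fun y hy => ⟨hy, stdVec_ne_zero 0⟩
  have h2 := (h1.comp (continuousOn_extChartAt x) (extChartAt (𝓡 2) x).mapsTo).continuousAt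
    (extChartAt_source_mem_nhds x)
  refine h2.congr ?_
  filter_upwards [extChartAt_source_mem_nhds (I := 𝓡 2) x] with y hy
  exact congrArg (T.fibreIntegral u) ((extChartAt (𝓡 2) x).left_inv hy)

theorem fibreIntegral_add (hu : T.IsSmooth u) (hv : T.IsSmooth v) (x : M) :
    T.fibreIntegral (fun p => u p + v p) x = T.fibreIntegral u x + T.fibreIntegral v x :=
  intervalIntegral.integral_add ((continuous_rot hu _).intervalIntegrable _ _)
    ((continuous_rot hv _).intervalIntegrable _ _)

theorem fibreIntegral_const_mul (a : ℂ) (u : T.SM → ℂ) (x : M) :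
    T.fibreIntegral (fun p => a * u p) x = a * T.fibreIntegral u x :=
  intervalIntegral.integral_const_mul _ _

theorem fibreIntegral_ofReal (f : T.SM → ℝ) (x : M) :
    ((T.fibreIntegral f x : ℝ) : ℂ) = T.fibreIntegral (fun p => (f p : ℂ)) x :=
  intervalIntegral.integral_ofReal.symm

/-! Functions of frequency one: the integrand `X f - X_⊥ V f` is a divergence -/

/-- Along the fibres a solution of `V²f = -f` is a combination of sine and cosine. -/
theorem rot_of_V_V_eq {f : T.SM → ℂ} (hf : T.IsSmooth f) (hV : ∀ p, T.V (T.V f) p = -f p)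
    (t : ℝ) (p : T.SM) :
    f (T.rot t p) = Real.cos t * f p + Real.sin t * T.V f p := by
  have hVf := T.isSmooth_V hf
  have h1 := rot_of_V_eq (k := 1) (hf.sub (hVf.const_mul Complex.I)) (fun q => by
    rw [V_sub hf (hVf.const_mul _), V_const_mul _ hVf, hV]
    push_cast
    linear_combination T.V f q * Complex.I_sq) t p
  have h2 := rot_of_V_eq (k := -1) (hf.add (hVf.const_mul Complex.I)) (fun q => by
    rw [V_add hf (hVf.const_mul _), V_const_mul _ hVf, hV]
    push_cast
    linear_combination T.V f q * Complex.I_sq) t p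
  have e1 : character 1 t = Complex.cos t + Complex.sin t * Complex.I := by
    rw [character, ← Complex.exp_mul_I]
    congr 1
    push_cast
    ring
  have e2 : character (-1) t = Complex.cos t - Complex.sin t * Complex.I := by
    have h := Complex.exp_mul_I (-(t : ℂ))
    rw [Complex.cos_neg, Complex.sin_neg] at h
    rw [sub_eq_add_neg, ← neg_mul, ← h, character]
    congr 1
    push_cast
    ring
  rw [e1] at h1
  rw [e2] at h2
  push_cast
  linear_combination (1 / 2) * h1 + (1 / 2) * h2 - Complex.sin t * T.V f p * Complex.I_sq

section

variable [CompactSpace M]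

/-- The integral of `X f - X_⊥ V f` vanishes for real functions of frequency `±1` supported in a
chart: such a function is `f = -⟨e, v⟩` for a vector field `e`, and the integrand is `-div e`. -/
theorem chartIntegral_X_sub_Xperp {f : T.SM → ℂ} (hf : T.IsSmooth f)
    (hV : ∀ p, T.V (T.V f) p = -f p) (hreal : ∀ p, (starRingEnd ℂ) (f p) = f p) {A : Set M}
    (hA : IsClosed A) (hAc : A ⊆ (extChartAt (𝓡 2) c).source)
    (hfA : ∀ p : T.SM, p.base ∉ A → f p = 0) :
    T.chartIntegral c (T.fibreIntegral fun p => T.X f p - T.Xperp (T.V f) p) = 0 := by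
  have hVf := T.isSmooth_V hf
  have hVreal : ∀ p, (starRingEnd ℂ) (T.V f p) = T.V f p := fun p => by
    rw [← V_conj hf, funext hreal]
  have hVfA : ∀ p : T.SM, p.base ∉ A → T.V f p = 0 := by
    intro p hp
    have h0 : (fun t => f (T.rot t p)) = fun _ => 0 := funext fun t => hfA _ hp
    rw [V, h0, deriv_const]
  set S := T.localSurface c with hS
  -- the reference direction in the tangent planes, and the components of `e` in it
  let q : Plane → Plane × Plane := fun y => (y, stdVec 0)
  have hq : ∀ y ∈ chartTarget c, q y ∈ domain (chartTarget c) := fun y hy =>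
    ⟨hy, stdVec_ne_zero 0⟩
  have hqs : ContDiffOn ℝ ∞ q (chartTarget c) := (contDiff_id.prodMk contDiff_const).contDiffOn
  let w₀ : Plane → Plane := fun y => (S.norm (q y))⁻¹ • stdVec 0
  let e : Plane → Plane := fun y =>
    -((T.coordFun c f (q y)).re • w₀ y + (T.coordFun c (T.V f) (q y)).re • S.J y (w₀ y))
  have hw₀ : ContDiffOn ℝ ∞ w₀ (chartTarget c) :=
    ((S.contDiffOn_norm.comp hqs hq).inv fun y hy => (S.norm_pos (hq y hy)).ne').smul
      contDiffOn_const
  have he : ContDiffOn ℝ ∞ e (chartTarget c) := by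
    have h1 := Complex.reCLM.contDiff.comp_contDiffOn ((T.contDiffOn_coordFun hf c).comp hqs hq)
    have h2 := Complex.reCLM.contDiff.comp_contDiffOn ((T.contDiffOn_coordFun hVf c).comp hqs hq)
    exact ((h1.smul hw₀).add (h2.smul (S.J_smooth.clm_apply hw₀))).neg
  -- the values on an arbitrary direction
  have key : ∀ z ∈ domain (chartTarget c),
      T.coordFun c f z = ((-((S.norm z)⁻¹ * S.g z.1 (e z.1) z.2) : ℝ) : ℂ) ∧
      T.coordFun c (T.V f) z = ((-((S.norm z)⁻¹ * S.g z.1 (e z.1) (S.J z.1 z.2)) : ℝ) : ℂ) := by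
    intro z hz
    have hbase : (T.ray hz).base = (T.ray (hq z.1 hz.1)).base := rfl
    obtain ⟨s, hs⟩ := exists_rot_eq hbase
    have hc := T.coord_rot (T.ray_base (hq z.1 hz.1)) s
    rw [hs, T.coord_ray, T.coord_ray] at hc
    have hw : (S.norm z)⁻¹ • z.2 = Real.cos s • w₀ z.1 + Real.sin s • S.J z.1 (w₀ z.1) :=
      congrArg Prod.snd hc
    have hN0 := S.norm_pos (hq z.1 hz.1)
    have hg : S.g z.1 (w₀ z.1) (w₀ z.1) = 1 := by
      have h1 : S.norm (q z.1) ^ 2 = S.g z.1 (stdVec 0) (stdVec 0) :=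
        Real.sq_sqrt (S.g_pos z.1 hz.1 _ (stdVec_ne_zero 0)).le
      simp only [w₀, map_smul, smul_apply, smul_eq_mul, ← h1]
      field_simp
    have hgJ : S.g z.1 (S.J z.1 (w₀ z.1)) (S.J z.1 (w₀ z.1)) = 1 :=
      (S.J_isometry z.1 hz.1 _ _).trans hg
    have hJ1 := S.g_self_J hz.1 (w₀ z.1)
    have hJ2 := S.g_J_self hz.1 (w₀ z.1)
    have hJJ := S.J_sq z.1 hz.1 (w₀ z.1)
    have hfr : ∀ g : T.SM → ℂ, (∀ p, (starRingEnd ℂ) (g p) = g p) → g (T.ray (hq z.1 hz.1)) =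
        ((T.coordFun c g (q z.1)).re : ℂ) := by
      intro g hg
      rw [T.coordFun_eq (hq z.1 hz.1)]
      exact (Complex.conj_eq_iff_re.1 (hg _)).symm
    constructor
    · rw [T.coordFun_eq hz, ← hs, rot_of_V_V_eq hf hV, hfr f hreal, hfr _ hVreal,
        ← smul_eq_mul (S.norm z)⁻¹, ← map_smul, hw]
      simp only [e, map_add, map_smul, map_neg, neg_apply, add_apply, smul_apply, smul_eq_mul, hg,
        hgJ, hJ1, hJ2]
      push_cast
      ring
    · have hVV : ∀ p, T.V (T.V (T.V f)) p = -T.V f p := fun p => by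
        rw [funext hV]
        have h := V_const_mul (-1) hf p
        simpa using h
      rw [T.coordFun_eq hz, ← hs, rot_of_V_V_eq hVf hVV, hV, hfr f hreal, hfr _ hVreal,
        ← smul_eq_mul (S.norm z)⁻¹, ← map_smul, ← map_smul, hw]
      simp only [e, map_add, map_smul, map_neg, neg_apply, add_apply, smul_apply, smul_eq_mul, hg,
        hgJ, hJ1, hJ2, hJJ]
      push_cast
      ring
  have hfib : ∀ y ∈ chartTarget c,
      T.fibreIntegral (fun p => T.X f p - T.Xperp (T.V f) p) ((extChartAt (𝓡 2) c).symm y) =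
        -(2 * Real.pi) * (S.divergence e y : ℝ) := by
    intro y hy
    have h1 : ∀ p : T.SM, p.base = (extChartAt (𝓡 2) c).symm y →
        T.X f p - T.Xperp (T.V f) p = -((S.divergence e y : ℝ) : ℂ) := by
      intro p hp
      have hps : p.base ∈ (extChartAt (𝓡 2) c).source := hp ▸ (extChartAt (𝓡 2) c).map_target hy
      have h := T.X_add_Xperp_of_linear (c := c) (hVf.const_mul (-1)) hf he
        (fun z hz => by
          have h1 : T.coordFun c (fun p => -1 * T.V f p) z = -1 * T.coordFun c (T.V f) z := by
            rw [T.coordFun_eq hz, T.coordFun_eq hz]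
          rw [h1, (key z hz).2, Complex.real_smul, ← hS]
          push_cast
          ring)
        (fun z hz => by
          rw [(key z hz).1, Complex.real_smul, ← hS]
          push_cast
          ring) hps
      rw [Xperp_const_mul _ hVf, hp, (extChartAt (𝓡 2) c).right_inv hy] at h
      rw [← h]
      ring
    have h2 : ∀ t, T.X f (T.rot t (T.unitAt ((extChartAt (𝓡 2) c).symm y))) -
        T.Xperp (T.V f) (T.rot t (T.unitAt ((extChartAt (𝓡 2) c).symm y))) =
          -((S.divergence e y : ℝ) : ℂ) := fun t => h1 _ rfl
    rw [fibreIntegral]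
    simp only [h2]
    simp
  have hdiv := S.integral_divergence he (K := extChartAt (𝓡 2) c '' A)
    (hA.isCompact.image_of_continuousOn ((continuousOn_extChartAt c).mono hAc))
    (by
      rintro _ ⟨x, hx, rfl⟩
      exact (extChartAt (𝓡 2) c).map_source (hAc hx))
    (fun y hy hyA => by
      have hb : (T.ray (hq y hy)).base ∉ A := fun h =>
        hyA ⟨_, h, (extChartAt (𝓡 2) c).right_inv hy⟩
      simp only [e]
      rw [T.coordFun_eq (hq y hy), T.coordFun_eq (hq y hy), hfA _ hb, hVfA _ hb]
      simp)
  rw [chartIntegral]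
  have hcongr : ∀ y ∈ chartTarget c, √(T.gram c y).det •
      T.fibreIntegral (fun p => T.X f p - T.Xperp (T.V f) p) ((extChartAt (𝓡 2) c).symm y) =
      -(2 * Real.pi) * ((√(S.det y) * S.divergence e y : ℝ) : ℂ) := by
    intro y hy
    rw [hfib y hy, Complex.real_smul, hS, det_eq]
    push_cast
    ring
  rw [setIntegral_congr_fun (isOpen_chartTarget c).measurableSet hcongr, MeasureTheory.integral_const_mul]
  have h3 : ∫ y in chartTarget c, ((√(S.det y) * S.divergence e y : ℝ) : ℂ) =
      ((∫ y in chartTarget c, √(S.det y) * S.divergence e y : ℝ) : ℂ) := integral_ofReal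
  rw [h3, hdiv, Complex.ofReal_zero, mul_zero]

end

section

variable [CompactSpace M] [T2Space M]

theorem integral_add (hu : T.IsSmooth u) (hv : T.IsSmooth v) :
    T.integral (fun p => u p + v p) = T.integral u + T.integral v := by
  rw [integral, funext (fibreIntegral_add hu hv), T.areaIntegral_add (continuous_fibreIntegral hu)
    (continuous_fibreIntegral hv)]
  rfl

theorem integral_const_mul (a : ℂ) (u : T.SM → ℂ) :
    T.integral (fun p => a * u p) = a * T.integral u := by
  rw [integral, funext (fibreIntegral_const_mul a u), areaIntegral_const_mul]
  rfl

theorem integral_sub (hu : T.IsSmooth u) (hv : T.IsSmooth v) :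
    T.integral (fun p => u p - v p) = T.integral u - T.integral v := by
  rw [sub_eq_add_neg_one_mul, integral_add hu (hv.const_mul _), integral_const_mul]
  ring

theorem integral_zero : T.integral (fun _ => (0 : ℂ)) = 0 := by
  have h := integral_const_mul (T := T) 0 (fun _ => (0 : ℂ))
  simpa using h

theorem integral_sum {ι : Type*} (s : Finset ι) {f : ι → T.SM → ℂ}
    (hf : ∀ i ∈ s, T.IsSmooth (f i)) :
    T.integral (fun p => ∑ i ∈ s, f i p) = ∑ i ∈ s, T.integral (f i) := by
  classical
  induction s using Finset.induction_on with
  | empty => simpa using integral_zero (T := T)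
  | insert a s ha ih =>
    have hs : ∀ i ∈ s, T.IsSmooth (f i) := fun i hi => hf i (Finset.mem_insert_of_mem hi)
    simp only [Finset.sum_insert ha]
    rw [integral_add (hf a (Finset.mem_insert_self a s)) (IsSmooth.sum s hs), ih hs]

theorem integral_V (hu : T.IsSmooth u) : T.integral (T.V u) = 0 := by
  have h : T.fibreIntegral (T.V u) = T.fibreIntegral fun _ => (0 : ℂ) := by
    funext x
    rw [fibreIntegral, intervalIntegral.integral_eq_sub_of_hasDerivAt
      (fun t _ => hasDerivAt_rot_apply hu (T.unitAt x) t)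
      ((continuous_rot (T.isSmooth_V hu) _).intervalIntegrable _ _), rot_two_pi u, rot_zero,
      sub_self, fibreIntegral, intervalIntegral.integral_zero]
  rw [integral, h]
  exact integral_zero

/-- Only the frequencies `±1` of `u` contribute to the integral of `X u`. -/
theorem fibreIntegral_X (hu : T.IsSmooth u) (x : M) :
    T.fibreIntegral (T.X u) x = (1 / 2) * T.fibreIntegral (fun p =>
      T.X (fun p => T.fourier 1 u p + T.fourier (-1) u p) p -
        T.Xperp (T.V fun p => T.fourier 1 u p + T.fourier (-1) u p) p) x := by
  have h1 := isSmooth_fourier 1 hu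
  have h2 := isSmooth_fourier (-1) hu
  have hX0 : ∀ p, T.fourier 0 (T.X u) p =
      T.etaMinus (T.fourier 1 u) p + T.etaPlus (T.fourier (-1) u) p := by
    intro p
    have e1 := fourier_etaMinus hu 1 p
    have e2 := fourier_etaPlus hu (-1) p
    rw [sub_self] at e1
    rw [neg_add_cancel] at e2
    rw [← e1, ← e2, ← fourier_add _ (isSmooth_etaMinus hu) (isSmooth_etaPlus hu)]
    congr 1
    funext q
    rw [add_comm, etaPlus_add_etaMinus]
  have hD : (fun p => T.X (fun p => T.fourier 1 u p + T.fourier (-1) u p) p -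
      T.Xperp (T.V fun p => T.fourier 1 u p + T.fourier (-1) u p) p) =
      fun p => 2 * T.fourier 0 (T.X u) p := by
    funext p
    have hV : (T.V fun p => T.fourier 1 u p + T.fourier (-1) u p) =
        fun p => Complex.I * T.fourier 1 u p + -Complex.I * T.fourier (-1) u p := by
      funext q
      rw [V_add h1 h2, V_fourier, V_fourier]
      push_cast
      ring
    rw [hX0, hV, X_add h1 h2, Xperp_add (h1.const_mul _) (h2.const_mul _), Xperp_const_mul _ h1,
      Xperp_const_mul _ h2, etaMinus, etaPlus]
    ring
  rw [hD, fibreIntegral_const_mul, show x = (T.unitAt x).base from rfl, fibreIntegral_eq_fourier,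
    fibreIntegral_eq_fourier, fourier_fourier _ _ (T.isSmooth_X hu), if_pos rfl]
  ring

/-- The vector fields `X`, `V` and `X_⊥` are local. -/
theorem V_eq_zero_of_base {A : Set M} (h : ∀ p : T.SM, p.base ∉ A → u p = 0) (p : T.SM)
    (hp : p.base ∉ A) : T.V u p = 0 := by
  have h0 : (fun t => u (T.rot t p)) = fun _ => 0 := funext fun t => h _ hp
  rw [V, h0, deriv_const]

theorem X_eq_zero_of_base {A : Set M} (hA : IsClosed A) (h : ∀ p : T.SM, p.base ∉ A → u p = 0)
    (p : T.SM) (hp : p.base ∉ A) : T.X u p = 0 := by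
  have hcont : ContinuousAt (fun z : Plane × Plane => (extChartAt (𝓡 2) p.base).symm z.1)
      (extChartAt (𝓡 2) p.base p.base, components p.base p.base p.vec) :=
    (continuousAt_extChartAt_symm p.base).comp
      (f := fun z : Plane × Plane => z.1) continuousAt_fst
  have hmem : (extChartAt (𝓡 2) p.base).symm (extChartAt (𝓡 2) p.base p.base) ∈ Aᶜ := by
    rwa [extChartAt_to_inv]
  have h0 : (fun z : Plane × Plane => T.ext u (ofCoord p.base z.1 z.2)) =ᶠ[nhds
      (extChartAt (𝓡 2) p.base p.base, components p.base p.base p.vec)] fun _ => 0 := by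
    filter_upwards [hcont.preimage_mem_nhds (hA.isOpen_compl.mem_nhds hmem)] with z hz
    by_cases hv : (ofCoord p.base z.1 z.2).2 = 0
    · simp [ext, hv]
    · rw [T.ext_of_ne hv]
      exact h _ hz
  rw [X, h0.fderiv_eq]
  simp

theorem Xperp_eq_zero_of_base {A : Set M} (hA : IsClosed A)
    (h : ∀ p : T.SM, p.base ∉ A → u p = 0) (p : T.SM) (hp : p.base ∉ A) : T.Xperp u p = 0 := by
  rw [Xperp, X_eq_zero_of_base hA (V_eq_zero_of_base h) p hp,
    V_eq_zero_of_base (X_eq_zero_of_base hA h) p hp, sub_zero]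

/-- The integral of `X u` vanishes for functions supported over a chart. -/
theorem integral_X_of_support (hu : T.IsSmooth u) {A : Set M} (hA : IsClosed A)
    (hAc : A ⊆ (extChartAt (𝓡 2) c).source) (huA : ∀ p : T.SM, p.base ∉ A → u p = 0) :
    T.integral (T.X u) = 0 := by
  -- the operator `D` acting on the frequencies `±1`
  let D : (T.SM → ℂ) → T.SM → ℂ := fun f p => T.X f p - T.Xperp (T.V f) p
  have hDs : ∀ f, T.IsSmooth f → T.IsSmooth (D f) := fun f hf =>
    (T.isSmooth_X hf).sub (T.isSmooth_Xperp (T.isSmooth_V hf))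
  have hreal : ∀ f : T.SM → ℂ, T.IsSmooth f → (∀ p, T.V (T.V f) p = -f p) →
      (∀ p, (starRingEnd ℂ) (f p) = f p) → (∀ p : T.SM, p.base ∉ A → f p = 0) →
      T.integral (D f) = 0 := by
    intro f hf hV hr hfA
    rw [integral, T.areaIntegral_eq_chartIntegral (c := c) (continuous_fibreIntegral (hDs f hf))]
    · exact chartIntegral_X_sub_Xperp hf hV hr hA hAc hfA
    · refine Set.Subset.trans (closure_minimal (fun x hx => ?_) hA) hAc
      by_contra hxA
      apply hx
      have h0 : ∀ t, D f (T.rot t (T.unitAt x)) = 0 := fun t => by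
        have hb : (T.rot t (T.unitAt x)).base ∉ A := hxA
        change T.X f _ - T.Xperp (T.V f) _ = 0
        rw [X_eq_zero_of_base hA hfA _ hb,
          Xperp_eq_zero_of_base hA (V_eq_zero_of_base hfA) _ hb, sub_zero]
      rw [fibreIntegral]
      simp only [h0, intervalIntegral.integral_zero]
  -- the frequencies `±1` of `u`
  set f : T.SM → ℂ := fun p => T.fourier 1 u p + T.fourier (-1) u p with hf_def
  have h1 := isSmooth_fourier 1 hu
  have h2 := isSmooth_fourier (-1) hu
  have hf : T.IsSmooth f := h1.add h2
  have hVf : ∀ p, T.V (T.V f) p = -f p := by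
    intro p
    have hV : T.V f = fun p => Complex.I * T.fourier 1 u p + -Complex.I * T.fourier (-1) u p := by
      funext q
      rw [V_add h1 h2, V_fourier, V_fourier]
      push_cast
      ring
    rw [hV, V_add (h1.const_mul _) (h2.const_mul _), V_const_mul _ h1, V_const_mul _ h2, V_fourier,
      V_fourier]
    push_cast
    linear_combination (T.fourier 1 u p + T.fourier (-1) u p) * Complex.I_sq
  have hfA : ∀ p : T.SM, p.base ∉ A → f p = 0 := by
    intro p hp
    have h0 : ∀ k, T.fourier k u p = 0 := fun k => by
      have : ∀ t, u (T.rot t p) = 0 := fun t => huA _ hp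
      rw [fourier_eq]
      simp [this]
    change T.fourier 1 u p + T.fourier (-1) u p = 0
    rw [h0, h0, add_zero]
  -- the functions `af + āf̄` are real
  have hcomb : ∀ a : ℂ, a * T.integral (D f) +
      (starRingEnd ℂ) a * T.integral (D fun p => (starRingEnd ℂ) (f p)) = 0 := by
    intro a
    have hc := hf.conj
    have ha := hf.const_mul a
    have hb := hc.const_mul ((starRingEnd ℂ) a)
    have hVs := T.isSmooth_V hf
    have hVc := T.isSmooth_V hc
    have h3 := hreal (fun p => a * f p + (starRingEnd ℂ) a * (starRingEnd ℂ) (f p)) (ha.add hb)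
      (fun p => by
        rw [funext (V_add ha hb), funext (V_const_mul a hf), funext (V_const_mul _ hc),
          funext (V_conj hf), V_add (hVs.const_mul _) (hVs.conj.const_mul _), V_const_mul _ hVs,
          V_const_mul _ hVs.conj, V_conj hVs, hVf, map_neg]
        ring)
      (fun p => by
        simp only [map_add, map_mul, Complex.conj_conj]
        ring)
      (fun p hp => by rw [hfA p hp, map_zero, mul_zero, mul_zero, add_zero])
    rw [← integral_const_mul, ← integral_const_mul, ← integral_add ((hDs f hf).const_mul _)
      ((hDs _ hc).const_mul _), ← h3]
    congr 1
    funext p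
    change _ = T.X _ p - T.Xperp _ p
    rw [X_add ha hb, X_const_mul _ hf, X_const_mul _ hc, funext (V_add ha hb),
      funext (V_const_mul a hf), funext (V_const_mul _ hc),
      Xperp_add (hVs.const_mul _) (hVc.const_mul _), Xperp_const_mul _ hVs, Xperp_const_mul _ hVc]
    change a * (T.X f p - T.Xperp (T.V f) p) + (starRingEnd ℂ) a * (T.X _ p - T.Xperp _ p) = _
    ring
  have hD0 : T.integral (D f) = 0 := by
    have e1 := hcomb 1
    have e2 := hcomb Complex.I
    rw [map_one] at e1
    rw [Complex.conj_I] at e2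
    linear_combination (1 / 2) * e1 - (1 / 2) * Complex.I * e2 +
      (1 / 2) * (T.integral (D f) - T.integral (D fun p => (starRingEnd ℂ) (f p))) * Complex.I_sq
  have h4 : T.integral (T.X u) = (1 / 2) * T.integral (D f) := by
    rw [integral, funext (fibreIntegral_X hu), areaIntegral_const_mul]
    rfl
  rw [h4, hD0, mul_zero]

theorem isSmooth_partition (c : M) :
    T.IsSmooth fun p => ((partitionOfUnity M c p.base : ℝ) : ℂ) := by
  refine isSmooth_comp_base (f := fun x => ((partitionOfUnity M c x : ℝ) : ℂ)) fun c' => ?_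
  have h1 := (partitionOfUnity M c).contMDiff.comp_contMDiffOn
    (contMDiffOn_extChartAt_symm (n := ∞) (I := 𝓡 2) c')
  exact Complex.ofRealCLM.contDiff.comp_contDiffOn (contMDiffOn_iff_contDiffOn.1 h1)

/-- The geodesic flow preserves the volume. -/
theorem integral_X (hu : T.IsSmooth u) : T.integral (T.X u) = 0 := by
  let w : M → T.SM → ℂ := fun c p => ((partitionOfUnity M c p.base : ℝ) : ℂ) * u p
  have hw : ∀ c, T.IsSmooth (w c) := fun c => (isSmooth_partition c).mul hu
  have hX : ∀ (s : Finset M) (p : T.SM), T.X (fun p => ∑ c ∈ s, w c p) p = ∑ c ∈ s, T.X (w c) p := by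
    classical
    intro s
    induction s using Finset.induction_on with
    | empty => intro p; simpa using X_const (T := T) 0 p
    | insert a s ha ih =>
      intro p
      simp only [Finset.sum_insert ha]
      rw [X_add (hw a) (IsSmooth.sum s fun i _ => hw i), ih]
  have hsum : u = fun p => ∑ c ∈ centres M, w c p := by
    funext p
    simp only [w]
    rw [← Finset.sum_mul, ← Complex.ofReal_sum, sum_partition, Complex.ofReal_one, one_mul]
  have h1 : T.X u = fun p => ∑ c ∈ centres M, T.X (w c) p := by
    conv_lhs => rw [hsum]
    exact funext (hX _)
  rw [h1, integral_sum _ fun c _ => T.isSmooth_X (hw c)]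
  refine Finset.sum_eq_zero fun c _ => ?_
  have h := (SmoothPartitionOfUnity.exists_isSubordinate_chartAt_source (𝓡 2) M).choose_spec c
  refine integral_X_of_support (c := c) (hw c) (isClosed_tsupport (partitionOfUnity M c)) ?_ ?_
  · rw [extChartAt_source]
    exact h
  · intro p hp
    simp only [w]
    rw [image_eq_zero_of_notMem_tsupport hp, Complex.ofReal_zero, zero_mul]

theorem integral_Xperp (hu : T.IsSmooth u) : T.integral (T.Xperp u) = 0 := by
  have h : T.Xperp u = fun p => T.X (T.V u) p - T.V (T.X u) p := rfl
  rw [h, integral_sub (T.isSmooth_X (T.isSmooth_V hu)) (T.isSmooth_V (T.isSmooth_X hu)),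
    integral_X (T.isSmooth_V hu), integral_V (T.isSmooth_X hu), sub_zero]

/-! The `L²` norm -/

theorem ofReal_integral (f : T.SM → ℝ) :
    ((T.integral f : ℝ) : ℂ) = T.integral fun p => (f p : ℂ) := by
  rw [integral, areaIntegral_ofReal, funext (fibreIntegral_ofReal f)]
  rfl

theorem l2Norm_sq (u : T.SM → ℂ) : T.l2Norm u ^ 2 = T.integral fun p => ‖u p‖ ^ 2 := by
  rw [l2Norm, Real.sq_sqrt]
  exact T.areaIntegral_nonneg fun x => intervalIntegral.integral_nonneg Real.two_pi_pos.le
    fun t _ => sq_nonneg _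

theorem ofReal_l2Norm_sq (u : T.SM → ℂ) :
    ((T.l2Norm u ^ 2 : ℝ) : ℂ) = T.integral fun p => u p * (starRingEnd ℂ) (u p) := by
  rw [l2Norm_sq, ofReal_integral]
  congr 1
  funext p
  rw [Complex.mul_conj, Complex.normSq_eq_norm_sq]

theorem l2Norm_conj (u : T.SM → ℂ) : T.l2Norm (fun p => (starRingEnd ℂ) (u p)) = T.l2Norm u := by
  simp [l2Norm]

theorem l2Norm_const_mul_sq (a : ℂ) (u : T.SM → ℂ) :
    T.l2Norm (fun p => a * u p) ^ 2 = ‖a‖ ^ 2 * T.l2Norm u ^ 2 := by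
  have h := ofReal_l2Norm_sq (T := T) fun p => a * u p
  have h1 : (fun p => a * u p * (starRingEnd ℂ) (a * u p)) =
      fun p => (a * (starRingEnd ℂ) a) * (u p * (starRingEnd ℂ) (u p)) := by
    funext p
    rw [map_mul]
    ring
  rw [h1, integral_const_mul, ← ofReal_l2Norm_sq, Complex.mul_conj, Complex.normSq_eq_norm_sq,
    ← Complex.ofReal_mul] at h
  exact_mod_cast h

/-- Functions without common frequencies are orthogonal. -/
theorem l2Norm_add_sq (hu : T.IsSmooth u) (hv : T.IsSmooth v)
    (h : ∀ k, T.fourier k u = 0 ∨ T.fourier k v = 0) :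
    T.l2Norm (fun p => u p + v p) ^ 2 = T.l2Norm u ^ 2 + T.l2Norm v ^ 2 := by
  have hn : ∀ w : T.SM → ℂ, (T.l2Norm w ^ 2 : ℂ) =
      T.areaIntegral fun x => ((T.fibreIntegral (fun p => ‖w p‖ ^ 2) x : ℝ) : ℂ) := by
    intro w
    rw [← areaIntegral_ofReal, ← Complex.ofReal_pow, l2Norm_sq]
    rfl
  have hcont : ∀ w, T.IsSmooth w →
      Continuous fun x => ((T.fibreIntegral (fun p => ‖w p‖ ^ 2) x : ℝ) : ℂ) := by
    intro w hw
    have h1 := continuous_fibreIntegral (hw.mul hw.conj)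
    refine h1.congr fun x => ?_
    rw [fibreIntegral_ofReal]
    congr 1
    funext p
    rw [Complex.mul_conj, Complex.normSq_eq_norm_sq]
  have h2 : (T.l2Norm (fun p => u p + v p) ^ 2 : ℂ) = T.l2Norm u ^ 2 + T.l2Norm v ^ 2 := by
    rw [hn, hn, hn, ← T.areaIntegral_add (hcont u hu) (hcont v hv)]
    congr 1
    funext x
    rw [← Complex.ofReal_add]
    exact congrArg _ (integral_norm_sq_add hu hv h (T.unitAt x))
  exact_mod_cast h2

end

end GaussianThermostat

/-! ### The Pestov identity -/

namespace GaussianThermostat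

variable {M : Type*} [TopologicalSpace M] [ChartedSpace Plane M] [IsManifold (𝓡 2) ∞ M]
variable {T : GaussianThermostat M} {u v : T.SM → ℂ}

theorem isSmooth_G (hu : T.IsSmooth u) : T.IsSmooth (T.G u) :=
  (T.isSmooth_X hu).add (T.isSmooth_lam.mul (T.isSmooth_V hu))

theorem G_add (hu : T.IsSmooth u) (hv : T.IsSmooth v) (p : T.SM) :
    T.G (fun p => u p + v p) p = T.G u p + T.G v p := by
  rw [G, X_add hu hv, V_add hu hv, G, G]
  ring

theorem G_conj (hu : T.IsSmooth u) (p : T.SM) :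
    T.G (fun p => (starRingEnd ℂ) (u p)) p = (starRingEnd ℂ) (T.G u p) := by
  rw [G, X_conj hu, V_conj hu, G, map_add, map_mul, conj_lam]

variable (T) in
/-- The vector field `H = [V, G_E]`. -/
def H (u : T.SM → ℂ) (p : T.SM) : ℂ := T.V T.lam p * T.V u p - T.Xperp u p

theorem isSmooth_H (hu : T.IsSmooth u) : T.IsSmooth (T.H u) :=
  ((T.isSmooth_V T.isSmooth_lam).mul (T.isSmooth_V hu)).sub (T.isSmooth_Xperp hu)

theorem V_G (hu : T.IsSmooth u) (p : T.SM) : T.V (T.G u) p = T.G (T.V u) p + T.H u p := by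
  have h : T.G u = fun p => T.X u p + T.lam p * T.V u p := rfl
  have hV := T.isSmooth_V hu
  rw [h, V_add (T.isSmooth_X hu) (T.isSmooth_lam.mul hV), V_mul T.isSmooth_lam hV, V_X, G, H]
  ring

theorem V_H (hu : T.IsSmooth u) (p : T.SM) : T.V (T.H u) p = T.H (T.V u) p - T.G u p := by
  have h : T.H u = fun p => T.V T.lam p * T.V u p - T.Xperp u p := rfl
  have hV := T.isSmooth_V hu
  have hl := T.isSmooth_V T.isSmooth_lam
  rw [h, V_sub (hl.mul hV) (T.isSmooth_Xperp hu), V_mul hl hV, T.V_Xperp hu, T.V_V_lam, G, H]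
  ring

/-- The structure equation in which the thermostat curvature appears. -/
theorem G_H (hu : T.IsSmooth u) (p : T.SM) :
    T.G (T.H u) p = T.H (T.G u) p - T.lam p * T.G u p - T.V T.lam p * T.H u p +
      (T.curvature p.base : ℂ) * T.V u p := by
  have hX := T.isSmooth_X hu
  have hV := T.isSmooth_V hu
  have hY := T.isSmooth_Xperp hu
  have hl := T.isSmooth_lam
  have ha := T.isSmooth_V hl
  have h1 : T.H u = fun p => T.V T.lam p * T.V u p - T.Xperp u p := rfl
  have h2 : T.G u = fun p => T.X u p + T.lam p * T.V u p := rfl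
  have hdiv := T.X_V_lam_add_Xperp_lam p
  have hXV : T.X (T.V u) p = T.V (T.X u) p + T.Xperp u p := by
    rw [Xperp]
    ring
  have e1 : T.G (T.H u) p = T.X (T.V T.lam) p * T.V u p + T.V T.lam p * T.X (T.V u) p -
      T.X (T.Xperp u) p + T.lam p * (T.V (T.V T.lam) p * T.V u p + T.V T.lam p * T.V (T.V u) p -
        T.V (T.Xperp u) p) := by
    rw [h1, G, X_sub (ha.mul hV) hY, V_sub (ha.mul hV) hY, X_mul ha hV, V_mul ha hV]
  have e2 : T.H (T.G u) p = T.V T.lam p * (T.V (T.X u) p + (T.V T.lam p * T.V u p +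
      T.lam p * T.V (T.V u) p)) - (T.Xperp (T.X u) p + (T.Xperp T.lam p * T.V u p +
        T.lam p * T.Xperp (T.V u) p)) := by
    rw [h2, H, V_add hX (hl.mul hV), Xperp_add hX (hl.mul hV), V_mul hl hV, Xperp_mul hl hV]
  rw [e1, e2, T.X_Xperp hu, T.V_Xperp hu, T.V_V_lam, hXV, G, H, curvature]
  push_cast
  linear_combination T.V u p * hdiv

section

variable [CompactSpace M] [T2Space M]

/-! Integration by parts -/

theorem integral_V_mul (hu : T.IsSmooth u) (hv : T.IsSmooth v) :
    T.integral (fun p => T.V u p * v p) = -T.integral fun p => u p * T.V v p := by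
  have h := integral_V (hu.mul hv)
  rw [funext (V_mul hu hv), integral_add ((T.isSmooth_V hu).mul hv) (hu.mul (T.isSmooth_V hv))] at h
  exact eq_neg_of_add_eq_zero_left h

theorem integral_X_mul (hu : T.IsSmooth u) (hv : T.IsSmooth v) :
    T.integral (fun p => T.X u p * v p) = -T.integral fun p => u p * T.X v p := by
  have h := integral_X (hu.mul hv)
  rw [funext (X_mul hu hv), integral_add ((T.isSmooth_X hu).mul hv) (hu.mul (T.isSmooth_X hv))] at h
  exact eq_neg_of_add_eq_zero_left h

theorem integral_Xperp_mul (hu : T.IsSmooth u) (hv : T.IsSmooth v) :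
    T.integral (fun p => T.Xperp u p * v p) = -T.integral fun p => u p * T.Xperp v p := by
  have h := integral_Xperp (hu.mul hv)
  rw [funext (Xperp_mul hu hv),
    integral_add ((T.isSmooth_Xperp hu).mul hv) (hu.mul (T.isSmooth_Xperp hv))] at h
  exact eq_neg_of_add_eq_zero_left h

theorem integral_G_mul (hu : T.IsSmooth u) (hv : T.IsSmooth v) :
    T.integral (fun p => T.G u p * v p) =
      -T.integral fun p => u p * (T.G v p + T.V T.lam p * v p) := by
  have hl := T.isSmooth_lam
  have h1 := integral_X_mul hu hv
  have h2 := integral_V_mul hu (hl.mul hv)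
  rw [funext (V_mul hl hv)] at h2
  have e1 : (fun p => T.G u p * v p) =
      fun p => T.X u p * v p + T.V u p * (T.lam p * v p) := by
    funext p
    rw [G]
    ring
  have e2 : (fun p => u p * (T.G v p + T.V T.lam p * v p)) =
      fun p => u p * T.X v p + u p * (T.V T.lam p * v p + T.lam p * T.V v p) := by
    funext p
    rw [G]
    ring
  have hVl := T.isSmooth_V hl
  rw [e1, e2, integral_add ((T.isSmooth_X hu).mul hv) ((T.isSmooth_V hu).mul (hl.mul hv)),
    integral_add (hu.mul (T.isSmooth_X hv)) (hu.mul ((hVl.mul hv).add (hl.mul (T.isSmooth_V hv)))),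
    h1, h2]
  ring

theorem integral_H_mul (hu : T.IsSmooth u) (hv : T.IsSmooth v) :
    T.integral (fun p => T.H u p * v p) =
      -T.integral fun p => u p * (T.H v p - T.lam p * v p) := by
  have hl := T.isSmooth_V T.isSmooth_lam
  have h1 := integral_Xperp_mul hu hv
  have h2 := integral_V_mul hu (hl.mul hv)
  rw [funext (V_mul hl hv), funext T.V_V_lam] at h2
  have e1 : (fun p => T.H u p * v p) =
      fun p => T.V u p * (T.V T.lam p * v p) - T.Xperp u p * v p := by
    funext p
    rw [H]
    ring
  have e2 : (fun p => u p * (T.H v p - T.lam p * v p)) =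
      fun p => u p * (-T.lam p * v p + T.V T.lam p * T.V v p) - u p * T.Xperp v p := by
    funext p
    rw [H]
    ring
  have hn : T.IsSmooth fun p => -T.lam p := by
    simpa using T.isSmooth_lam.const_mul (-1)
  rw [e1, e2, integral_sub ((T.isSmooth_V hu).mul (hl.mul hv)) ((T.isSmooth_Xperp hu).mul hv),
    integral_sub (hu.mul ((hn.mul hv).add (hl.mul (T.isSmooth_V hv))))
      (hu.mul (T.isSmooth_Xperp hv)), h1, h2]
  ring

/-- The Pestov identity `‖V G u‖² = ‖G V u‖² + ‖G u‖² - (𝕂 V u, V u)`. -/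
theorem pestov (hu : T.IsSmooth u) : T.l2Norm (T.V (T.G u)) ^ 2 =
    T.l2Norm (T.G (T.V u)) ^ 2 + T.l2Norm (T.G u) ^ 2 -
      (T.l2Inner (fun p => (T.curvature p.base : ℂ) * T.V u p) (T.V u)).re := by
  have hV := T.isSmooth_V hu
  have hG := isSmooth_G hu
  have hH := isSmooth_H hu
  have hc := hu.conj
  have hVc := T.isSmooth_V hc
  have hGc := isSmooth_G hc
  have hHc := isSmooth_H hc
  have hVG := T.isSmooth_V hG
  have hGV := isSmooth_G hV
  have hl := T.isSmooth_lam
  have ha := T.isSmooth_V hl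
  have hGVc := isSmooth_G hVc
  have hVGc := T.isSmooth_V hGc
  set c : T.SM → ℂ := fun p => (starRingEnd ℂ) (u p) with hc_def
  have n1 : ((T.l2Norm (T.V (T.G u)) ^ 2 : ℝ) : ℂ) =
      T.integral fun p => T.V (T.G u) p * T.V (T.G c) p := by
    rw [ofReal_l2Norm_sq, hc_def, funext (G_conj hu), funext (V_conj hG)]
  have n2 : ((T.l2Norm (T.G (T.V u)) ^ 2 : ℝ) : ℂ) =
      T.integral fun p => T.G (T.V u) p * T.G (T.V c) p := by
    rw [ofReal_l2Norm_sq, hc_def, funext (V_conj hu), funext (G_conj hV)]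
  have n3 : ((T.l2Norm (T.G u) ^ 2 : ℝ) : ℂ) = T.integral fun p => T.G u p * T.G c p := by
    rw [ofReal_l2Norm_sq, hc_def, funext (G_conj hu)]
  have n4 : T.l2Inner (fun p => (T.curvature p.base : ℂ) * T.V u p) (T.V u) =
      T.integral fun p => T.V u p * ((T.curvature p.base : ℂ) * T.V c p) := by
    rw [l2Inner, hc_def, funext (V_conj hu)]
    congr 1
    funext p
    ring
  -- the integrations by parts
  have i1 : T.integral (fun p => T.H u p * T.V (T.G c) p) =
      -T.integral (fun p => T.H (T.V u) p * T.G c p) + T.integral fun p => T.G u p * T.G c p := by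
    have h := integral_V_mul hH hGc
    rw [funext (V_H hu)] at h
    simp only [sub_mul] at h
    rw [integral_sub ((isSmooth_H hV).mul hGc) (hG.mul hGc)] at h
    linear_combination h
  have i2 := integral_H_mul hV hGc
  have i3 := integral_G_mul hV hHc
  have s1 : T.integral (fun p => T.V (T.G u) p * T.V (T.G c) p) =
      T.integral (fun p => T.G (T.V u) p * T.G (T.V c) p) +
        T.integral (fun p => T.G (T.V u) p * T.H c p) +
          T.integral fun p => T.H u p * T.V (T.G c) p := by
    rw [← integral_add (hGV.mul hGVc) (hGV.mul hHc),
      ← integral_add ((hGV.mul hGVc).add (hGV.mul hHc)) (hH.mul hVGc)]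
    congr 1
    funext p
    rw [V_G hu, V_G hc]
    ring
  have s2 : T.integral (fun p => T.V u p * ((T.curvature p.base : ℂ) * T.V c p)) =
      T.integral (fun p => T.V u p * (T.G (T.H c) p + T.V T.lam p * T.H c p)) -
        T.integral fun p => T.V u p * (T.H (T.G c) p - T.lam p * T.G c p) := by
    rw [← integral_sub (hV.mul ((isSmooth_G hHc).add (ha.mul hHc)))
      (hV.mul ((isSmooth_H hGc).sub (hl.mul hGc)))]
    congr 1
    funext p
    rw [G_H hc]
    ring
  have key : T.l2Inner (fun p => (T.curvature p.base : ℂ) * T.V u p) (T.V u) =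
      ((T.l2Norm (T.G (T.V u)) ^ 2 + T.l2Norm (T.G u) ^ 2 - T.l2Norm (T.V (T.G u)) ^ 2 : ℝ) : ℂ) := by
    rw [Complex.ofReal_sub, Complex.ofReal_add, n1, n2, n3, n4, s1, s2, i1, i2, i3]
    ring
  rw [key, Complex.ofReal_re]
  ring

end

/-! ### The projections `T_m` -/

theorem isSmooth_proj (m : ℕ) (hu : T.IsSmooth u) : T.IsSmooth (T.proj m u) :=
  hu.sub (IsSmooth.sum _ fun k _ => isSmooth_fourier k hu)

theorem fourier_sum {ι : Type*} (s : Finset ι) {f : ι → T.SM → ℂ}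
    (hf : ∀ i, T.IsSmooth (f i)) (k : ℤ) (p : T.SM) :
    T.fourier k (fun p => ∑ i ∈ s, f i p) p = ∑ i ∈ s, T.fourier k (f i) p := by
  classical
  induction s using Finset.induction_on with
  | empty => simp [fourier]
  | insert a s ha ih =>
    simp only [Finset.sum_insert ha]
    rw [fourier_add _ (hf a) (IsSmooth.sum s fun i _ => hf i), ih]

theorem fourier_proj (m : ℕ) (hu : T.IsSmooth u) (k : ℤ) (p : T.SM) :
    T.fourier k (T.proj m u) p =
      if k ∈ Finset.Icc (-(m : ℤ)) m then 0 else T.fourier k u p := by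
  have h : T.proj m u = fun p => u p - ∑ k ∈ Finset.Icc (-(m : ℤ)) m, T.fourier k u p := rfl
  rw [h, fourier_sub _ hu (IsSmooth.sum _ fun k _ => isSmooth_fourier k hu),
    fourier_sum _ fun k => isSmooth_fourier k hu]
  simp only [fourier_fourier _ _ hu, Finset.sum_ite_eq]
  split_ifs <;> simp

theorem proj_add (m : ℕ) (hu : T.IsSmooth u) (hv : T.IsSmooth v) (p : T.SM) :
    T.proj m (fun p => u p + v p) p = T.proj m u p + T.proj m v p := by
  simp only [proj, fourier_add _ hu hv, Finset.sum_add_distrib]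
  ring

theorem proj_conj (m : ℕ) (u : T.SM → ℂ) (p : T.SM) :
    T.proj m (fun p => (starRingEnd ℂ) (u p)) p = (starRingEnd ℂ) (T.proj m u p) := by
  simp only [proj, fourier_conj, map_sub, map_sum]
  congr 1
  refine Finset.sum_nbij' (fun k => -k) (fun k => -k) ?_ ?_ ?_ ?_ ?_
  · intro k hk
    rw [Finset.mem_Icc] at hk ⊢
    omega
  · intro k hk
    rw [Finset.mem_Icc] at hk ⊢
    omega
  · simp
  · simp
  · simp

section

variable [CompactSpace M] [T2Space M]

theorem l2Norm_sum_fourier_sq (s : Finset ℤ) (hu : T.IsSmooth u) :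
    T.l2Norm (fun p => ∑ k ∈ s, T.fourier k u p) ^ 2 = ∑ k ∈ s, T.l2Norm (T.fourier k u) ^ 2 := by
  classical
  induction s using Finset.induction_on with
  | empty => simp [l2Norm_sq, integral, fibreIntegral, areaIntegral]
  | insert a s ha ih =>
    simp only [Finset.sum_insert ha]
    rw [l2Norm_add_sq (isSmooth_fourier a hu) (IsSmooth.sum s fun k _ => isSmooth_fourier k hu), ih]
    intro j
    by_cases hj : j = a
    · right
      funext p
      rw [fourier_sum _ fun k => isSmooth_fourier k hu]
      simp only [fourier_fourier _ _ hu, Finset.sum_ite_eq]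
      simp [hj, ha]
    · left
      funext p
      rw [fourier_fourier _ _ hu, if_neg hj]
      rfl

/-- Pythagoras' theorem for the projection `T_m` and the components removed by it. -/
theorem l2Norm_sq_eq_proj (m : ℕ) (hu : T.IsSmooth u) : T.l2Norm u ^ 2 =
    T.l2Norm (T.proj m u) ^ 2 + ∑ k ∈ Finset.Icc (-(m : ℤ)) m, T.l2Norm (T.fourier k u) ^ 2 := by
  have hs : T.IsSmooth fun p => ∑ k ∈ Finset.Icc (-(m : ℤ)) m, T.fourier k u p :=
    IsSmooth.sum _ fun k _ => isSmooth_fourier k hu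
  rw [← l2Norm_sum_fourier_sq _ hu, ← l2Norm_add_sq (isSmooth_proj m hu) hs]
  · congr 2
    funext p
    rw [proj]
    ring
  · intro k
    by_cases hk : k ∈ Finset.Icc (-(m : ℤ)) m
    · left
      funext p
      rw [fourier_proj m hu, if_pos hk]
      rfl
    · right
      funext p
      rw [fourier_sum _ fun k => isSmooth_fourier k hu]
      simp only [fourier_fourier _ _ hu, Finset.sum_ite_eq]
      rw [if_neg hk]
      rfl

/-! ### The inequality -/

omit [CompactSpace M] [T2Space M] in
theorem fourier_G (hu : T.IsSmooth u) (k : ℤ) (p : T.SM) : T.fourier k (T.G u) p =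
    T.muPlus (T.fourier (k - 1) u) p + T.muMinus (T.fourier (k + 1) u) p := by
  rw [← fourier_muPlus hu, ← fourier_muMinus hu, sub_add_cancel, add_sub_cancel_right,
    ← fourier_add _ (isSmooth_muPlus hu) (isSmooth_muMinus hu),
    ← funext (muPlus_add_muMinus (T := T) u)]

omit [CompactSpace M] [T2Space M] in
theorem muPlus_zero : T.muPlus 0 = 0 := by
  funext p
  have h := muPlus_const_mul 0 (isSmooth_const (T := T) 0) p
  simp only [zero_mul] at h
  exact h

omit [CompactSpace M] [T2Space M] in
theorem muMinus_zero : T.muMinus 0 = 0 := by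
  funext p
  have h := muMinus_const_mul 0 (isSmooth_const (T := T) 0) p
  simp only [zero_mul] at h
  exact h

omit [CompactSpace M] [T2Space M] in
/-- For `u` with frequencies `k ≥ m` the two lowest components of `G u` are `μ_- u_m` and
`μ_- u_{m+1}`. -/
theorem fourier_G_of_lowest {m : ℕ} (hu : T.IsSmooth u)
    (h : ∀ k < (m : ℤ), T.fourier k u = 0) :
    T.fourier ((m : ℤ) - 1) (T.G u) = T.muMinus (T.fourier m u) ∧
    T.fourier m (T.G u) = T.muMinus (T.fourier ((m : ℤ) + 1) u) ∧
    ∀ k < (m : ℤ) - 1, T.fourier k (T.G u) = 0 := by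
  refine ⟨?_, ?_, fun k hk => ?_⟩ <;> funext p <;> rw [fourier_G hu]
  · rw [h _ (by omega), muPlus_zero, sub_add_cancel]
    simp
  · rw [h _ (by omega), muPlus_zero]
    simp
  · rw [h _ (by omega), h _ (by omega), muPlus_zero, muMinus_zero]
    simp

/-- Pythagoras' theorem for functions with frequencies `k ≥ m - 1`. -/
theorem l2Norm_sq_of_lowest {m : ℕ} (hm : 1 ≤ m) (hu : T.IsSmooth u)
    (h : ∀ k < (m : ℤ) - 1, T.fourier k u = 0) :
    T.l2Norm u ^ 2 = T.l2Norm (T.proj m u) ^ 2 + (T.l2Norm (T.fourier ((m : ℤ) - 1) u) ^ 2 +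
      T.l2Norm (T.fourier m u) ^ 2) := by
  rw [l2Norm_sq_eq_proj m hu, Finset.sum_eq_add ((m : ℤ) - 1) m (by omega)]
  · intro k hk hne
    rw [Finset.mem_Icc] at hk
    rw [h k (by omega)]
    simp [l2Norm_sq, integral, fibreIntegral, areaIntegral]
  · intro hk
    exact absurd (Finset.mem_Icc.2 (by omega)) hk
  · intro hk
    exact absurd (Finset.mem_Icc.2 (by omega)) hk

/-- The inequality for functions with positive frequencies. -/
theorem le_l2Norm_Q_of_positive {α : ℝ} (hα : T.IsControlled α) {m : ℕ} (hm : 1 ≤ m)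
    (hu : T.IsSmooth u) (h : ∀ k < (m : ℤ), T.fourier k u = 0) :
    (1 - ((m : ℝ) - 1) ^ 2 + α * (m : ℝ) ^ 2) * T.l2Norm (T.muMinus (T.fourier m u)) ^ 2 +
      (1 - (m : ℝ) ^ 2 + α * ((m : ℝ) + 1) ^ 2) *
        T.l2Norm (T.muMinus (T.fourier ((m : ℤ) + 1) u)) ^ 2 +
      T.l2Norm (T.proj m (T.G u)) ^ 2 + α * T.l2Norm (T.proj m (T.G (T.V u))) ^ 2 ≤
      T.l2Norm (T.Q m u) ^ 2 := by
  have hV := T.isSmooth_V hu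
  have hG := isSmooth_G hu
  have hV' : ∀ k, T.fourier k (T.V u) = fun p => Complex.I * k * T.fourier k u p := fun k =>
    funext fun p => fourier_V k hu p
  have hVG' : ∀ k, T.fourier k (T.V (T.G u)) = fun p => Complex.I * k * T.fourier k (T.G u) p :=
    fun k => funext fun p => fourier_V k hG p
  have hVh : ∀ k < (m : ℤ), T.fourier k (T.V u) = 0 := by
    intro k hk
    rw [hV', h k hk]
    funext p
    simp
  obtain ⟨a1, a2, a3⟩ := fourier_G_of_lowest hu h
  obtain ⟨b1, b2, b3⟩ := fourier_G_of_lowest hV hVh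
  have hVG3 : ∀ k < (m : ℤ) - 1, T.fourier k (T.V (T.G u)) = 0 := by
    intro k hk
    rw [hVG', a3 k hk]
    funext p
    simp
  have hnorm : ∀ k : ℤ, ‖Complex.I * (k : ℂ)‖ ^ 2 = (k : ℝ) ^ 2 := by
    intro k
    rw [norm_mul, Complex.norm_I, one_mul, Complex.norm_intCast, sq_abs]
  have hmu : ∀ k : ℤ, T.l2Norm (T.muMinus (T.fourier k (T.V u))) ^ 2 =
      (k : ℝ) ^ 2 * T.l2Norm (T.muMinus (T.fourier k u)) ^ 2 := by
    intro k
    rw [hV', funext (muMinus_const_mul (Complex.I * k) (isSmooth_fourier k hu)),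
      l2Norm_const_mul_sq, hnorm]
  have c1 := l2Norm_sq_of_lowest hm (T.isSmooth_V hG) hVG3
  have c2 := l2Norm_sq_of_lowest hm hG a3
  have c3 := l2Norm_sq_of_lowest hm (isSmooth_G hV) b3
  rw [hVG', hVG', l2Norm_const_mul_sq, l2Norm_const_mul_sq, hnorm, hnorm, a1, a2] at c1
  rw [a1, a2] at c2
  rw [b1, b2, hmu, hmu] at c3
  have hp := pestov hu
  have hcontrol := hα.2 (T.V u) hV
  push_cast at c1 c3
  have c4 := congrArg (fun x => α * x) c3
  beta_reduce at c4
  rw [Q]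
  linarith

end

end GaussianThermostat

end

open GaussianThermostat

theorem proposition5p1 {M : Type*} [TopologicalSpace M] [T2Space M] [CompactSpace M]
    [ChartedSpace Plane M] [IsManifold (𝓡 2) ∞ M]
    (T : GaussianThermostat M) (α : ℝ) (hα : T.IsControlled α) (m : ℕ) (hm : 1 ≤ m)
    (u : T.SM → ℂ) (hu : T.IsHighFrequency m u) :
    (1 - ((m : ℝ) - 1) ^ 2 + α * (m : ℝ) ^ 2) *
        (T.l2Norm (T.muMinus (T.fourier m u)) ^ 2 +
          T.l2Norm (T.muPlus (T.fourier (-(m : ℤ)) u)) ^ 2)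
      + (1 - (m : ℝ) ^ 2 + α * ((m : ℝ) + 1) ^ 2) *
        (T.l2Norm (T.muMinus (T.fourier ((m : ℤ) + 1) u)) ^ 2 +
          T.l2Norm (T.muPlus (T.fourier (-(m : ℤ) - 1) u)) ^ 2)
      + T.l2Norm (T.proj m (T.G u)) ^ 2
      + α * T.l2Norm (T.proj m (T.G (T.V u))) ^ 2
      ≤ T.l2Norm (T.Q m u) ^ 2 := by
  obtain ⟨hs, hlow⟩ := hu
  -- the parts of `u` with frequencies `k ≥ m` and `k ≤ -m`
  set v : T.SM → ℂ := positivePart m u with hv_def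
  set w : T.SM → ℂ := fun p => u p - positivePart m u p with hw_def
  have hv : T.IsSmooth v := isSmooth_positivePart m hs
  have hw : T.IsSmooth w := hs.sub hv
  have huvw : u = fun p => v p + w p := by
    funext p
    simp only [hv_def, hw_def]
    ring
  have fv : ∀ k, T.fourier k v = if (m : ℤ) ≤ k then T.fourier k u else 0 := by
    intro k
    funext p
    rw [hv_def, fourier_positivePart hm hs]
    split_ifs <;> rfl
  have fw : ∀ k, T.fourier k w = if k ≤ -(m : ℤ) then T.fourier k u else 0 := by
    intro k
    funext p
    have h1 : T.fourier k w p = T.fourier k u p - T.fourier k v p := fourier_sub k hs hv p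
    rw [h1, fv]
    by_cases h2 : (m : ℤ) ≤ k
    · rw [if_pos h2, if_neg (by omega), sub_self]
      rfl
    · rw [if_neg h2]
      by_cases h3 : k ≤ -(m : ℤ)
      · rw [if_pos h3, Pi.zero_apply, sub_zero]
      · rw [if_neg h3, hlow k (abs_lt.2 (by omega)), sub_self]
        rfl
  -- the negative part is handled by complex conjugation
  have hwc := hw.conj
  set c : T.SM → ℂ := fun p => (starRingEnd ℂ) (w p) with hc_def
  have fc : ∀ k, T.fourier k c = fun p => (starRingEnd ℂ) (T.fourier (-k) w p) := fun k =>
    funext fun p => fourier_conj k w p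
  have muc : ∀ k, T.l2Norm (T.muMinus (T.fourier k c)) = T.l2Norm (T.muPlus (T.fourier (-k) w)) := by
    intro k
    rw [fc, funext (muMinus_conj (isSmooth_fourier (-k) hw)), l2Norm_conj]
  have hVw := T.isSmooth_V hw
  have hGw := isSmooth_G hw
  have hGVw := isSmooth_G hVw
  have hVGw := T.isSmooth_V hGw
  have hVv := T.isSmooth_V hv
  have hGv := isSmooth_G hv
  have hGVv := isSmooth_G hVv
  have hVGv := T.isSmooth_V hGv
  have pG : T.l2Norm (T.proj m (T.G c)) = T.l2Norm (T.proj m (T.G w)) := by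
    rw [hc_def, funext (G_conj hw), funext (proj_conj m (T.G w)), l2Norm_conj]
  have pGV : T.l2Norm (T.proj m (T.G (T.V c))) = T.l2Norm (T.proj m (T.G (T.V w))) := by
    rw [hc_def, funext (V_conj hw), funext (G_conj hVw), funext (proj_conj m (T.G (T.V w))),
      l2Norm_conj]
  have pQ : T.l2Norm (T.Q m c) = T.l2Norm (T.proj m (T.V (T.G w))) := by
    rw [Q, hc_def, funext (G_conj hw), funext (V_conj hGw), funext (proj_conj m (T.V (T.G w))),
      l2Norm_conj]
  have hvlow : ∀ k < (m : ℤ), T.fourier k v = 0 := fun k hk => by rw [fv, if_neg (by omega)]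
  have hwlow : ∀ k, -(m : ℤ) < k → T.fourier k w = 0 := fun k hk => by rw [fw, if_neg (by omega)]
  have hclow : ∀ k < (m : ℤ), T.fourier k c = 0 := fun k hk => by
    rw [fc, hwlow _ (by omega)]
    funext p
    simp
  have h1 := le_l2Norm_Q_of_positive hα hm hv hvlow
  have h2 := le_l2Norm_Q_of_positive hα hm hwc hclow
  rw [muc, muc, pG, pGV, pQ, fw, fw, if_pos le_rfl, if_pos (by omega), neg_add'] at h2
  rw [fv, fv, if_pos le_rfl, if_pos (by omega), Q] at h1
  -- the projections of the two parts have no common frequencies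
  have hGlow : ∀ f, T.IsSmooth f → (∀ k < (m : ℤ), T.fourier k f = 0) →
      ∀ k < (m : ℤ) - 1, T.fourier k (T.G f) = 0 := fun f hf h =>
    (fourier_G_of_lowest hf h).2.2
  have hGhigh : ∀ f, T.IsSmooth f → (∀ k, -(m : ℤ) < k → T.fourier k f = 0) →
      ∀ k, -(m : ℤ) + 1 < k → T.fourier k (T.G f) = 0 := by
    intro f hf h k hk
    funext p
    rw [fourier_G hf, h _ (by omega), h _ (by omega), muPlus_zero, muMinus_zero]
    simp
  have hVzero : ∀ f, T.IsSmooth f → ∀ k, T.fourier k f = 0 → T.fourier k (T.V f) = 0 := by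
    intro f hf k h
    funext p
    rw [fourier_V k hf, h]
    simp
  have hsplit : ∀ f g : T.SM → ℂ, T.IsSmooth f → T.IsSmooth g →
      (∀ k < (m : ℤ) - 1, T.fourier k f = 0) → (∀ k, -(m : ℤ) + 1 < k → T.fourier k g = 0) →
      T.l2Norm (T.proj m fun p => f p + g p) ^ 2 =
        T.l2Norm (T.proj m f) ^ 2 + T.l2Norm (T.proj m g) ^ 2 := by
    intro f g hf hg h h'
    rw [funext (proj_add m hf hg), l2Norm_add_sq (isSmooth_proj m hf) (isSmooth_proj m hg)]
    intro k
    by_cases hk : k ≤ (m : ℤ)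
    · left
      funext p
      rw [fourier_proj m hf]
      split_ifs with hmem
      · rfl
      · rw [Finset.mem_Icc] at hmem
        rw [h k (by omega)]
    · right
      funext p
      rw [fourier_proj m hg, h' k (by omega)]
      simp
  have hG_add : T.G u = fun p => T.G v p + T.G w p := by
    rw [huvw]
    exact funext (G_add hv hw)
  have hGV_add : T.G (T.V u) = fun p => T.G (T.V v) p + T.G (T.V w) p := by
    rw [huvw, funext (V_add hv hw)]
    exact funext (G_add hVv hVw)
  have hVG_add : T.V (T.G u) = fun p => T.V (T.G v) p + T.V (T.G w) p := by
    rw [hG_add]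
    exact funext (V_add hGv hGw)
  have s1 := hsplit _ _ hGv hGw (hGlow v hv hvlow) (hGhigh w hw hwlow)
  have s2 := hsplit _ _ hGVv hGVw
    (hGlow _ hVv fun k hk => hVzero v hv k (hvlow k hk))
    (hGhigh _ hVw fun k hk => hVzero w hw k (hwlow k hk))
  have s3 := hsplit _ _ hVGv hVGw
    (fun k hk => hVzero _ hGv k (hGlow v hv hvlow k hk))
    (fun k hk => hVzero _ hGw k (hGhigh w hw hwlow k hk))
  rw [Q, hG_add, hGV_add, s1, s2, ← hG_add, hVG_add, s3]
  linarith
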